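/- Let $d\ge 2$, let $\Omega\subset\mathbb R^d$ be a bounded Lipschitz domain (a bounded open set which near its boundary coincides, up to rigid motions, with the region above the graph of a Lipschitz function; connectedness is not required), and let $1<p<\infty$, $s\in(0,1)$ with $ps>1$. Put $\delta(x)=\operatorname{dist}(x,\partial\Omega)$ and, for $u\in L^p(\Omega)$, $$|u|^p=\int_\Omega\int_{\Omega\cap B_{\delta(x)}(x)}\frac{|u(y)-u(x)|^p}{\delta(x)^{d+ps}}\,dy\,dx,\qquad \|u\|=\bigl(\|u\|_{L^p(\Omega)}^p+|u|^p\bigr)^{1/p}.$$ Let $\mathfrak W^{s,p}(\Omega)$ be the closure, with respect to $\|\cdot\|$, of the Lipschitz functions on $\overline\Omega$, and $\mathring{\mathfrak W}^{s,p}(\Omega)$ the closure of the Lipschitz functions with compact support in $\Omega$. Let $W^{s,p}(\Omega)$ be the space of $u\in L^p(\Omega)$ with $\int_\Omega\int_\Omega |u(y)-u(x)|^p|y-x|^{-d-ps}\,dy\,dx<\infty$. Let $A:\Omega\times\Omega\to\mathbb R$ be measurable and symmetric with $0<\alpha_1\le A(x,y)\le\alpha_2<\infty$ for all $x,y\in\Omega$,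 and let $F:\mathbb R\to\mathbb R$ be convex such that, for some constants $c_1,c_2,c_3>0$, $c_1|t|^p\le F(t)\le c_2|t|^p$ for all $t\in\mathbb R$ and $|F'(t)|\le c_3|t|^{p-1}$ for almost every $t\in\mathbb R$. Define $$E(u)=\int_\Omega\int_{\Omega\cap B_{\delta(x)}(x)}\frac{A(x,y)}{\delta(x)^{d+ps}}\,F(u(y)-u(x))\,dy\,dx .$$ Let $\Omega_0$ be an open set whose closure is compact and contained in $\Omega$, let $\phi\in W^{s,p}(\Omega)$, let $h\in L^p(\Omega)\setminus W^{s,p}(\Omega)$ with $h\ge 0$ a.e. in $\Omega$, and let $f$ be a bounded linear functional on $(\mathfrak W^{s,p}(\Omega),\|\cdot\|)$. Put $$K_\phi(p,h)=\{u\in\mathfrak W^{s,p}(\Omega):\ u\ge h\ \text{a.e. in }\Omega_0,\ u-\phi\in\mathring{\mathfrak W}^{s,p}(\Omega)\}.$$ Then there is $u\in K_\phi(p,h)$ with $E(u)<\infty$ and $$E(u)-\langle f,u\rangle=\inf_{v\in K_\phi(p,h)}\bigl(E(v)-\langle f,v\rangle\bigr).$$ -/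

import Mathlib

open MeasureTheory Set
open scoped ENNReal NNReal

namespace HetLoc

/-- Euclidean space `ℝ^d`. -/
abbrev E (d : ℕ) : Type := EuclideanSpace ℝ (Fin d)

/-- `D` is, up to a rigid motion `T`, the open region above the graph of a Lipschitz function `ζ`
of the remaining `d - 1` coordinates. -/
def IsLipschitzHypograph {d : ℕ} (D : Set (E d)) : Prop :=
  ∃ (T : E d ≃ᵃⁱ[ℝ] E d) (k : Fin d) (L : ℝ≥0)
    (ζ : EuclideanSpace ℝ {i : Fin d // i ≠ k} → ℝ),
    LipschitzWith L ζ ∧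
      D = T '' {x : E d | ζ (WithLp.toLp 2 fun i => x i.1) < x k}

/-- Lipschitz domains: open sets with compact boundary which near their boundary coincide with
rigid motions of Lipschitz hypographs (a finite cover is no restriction, the boundary being
compact). -/
def IsLipschitzDomain {d : ℕ} (Ω : Set (E d)) : Prop :=
  IsOpen Ω ∧ IsCompact (frontier Ω) ∧
    ∃ (N : ℕ) (O D : Fin N → Set (E d)),
      (∀ j, IsOpen (O j) ∧ Bornology.IsBounded (O j)) ∧
      frontier Ω ⊆ ⋃ j, O j ∧
      (∀ j, IsLipschitzHypograph (D j)) ∧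
      ∀ j, Ω ∩ O j = D j ∩ O j

/-- `δ(x) = dist(x, ∂Ω)`. -/
noncomputable def bdist {d : ℕ} (Ω : Set (E d)) (x : E d) : ℝ :=
  Metric.infDist x (frontier Ω)

/-- The real space `L^p(Ω)`, for a real exponent `p`. -/
abbrev LpΩ {d : ℕ} (Ω : Set (E d)) (p : ℝ) : Type :=
  Lp ℝ (ENNReal.ofReal p) ((volume : Measure (E d)).restrict Ω)

/-- `∫_Ω ∫_{Ω ∩ B(x, δ(x))} |u(y) - u(x)|^p / δ(x)^{d + p s} dy dx`, the `p`-th power of the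
heterogeneously localized seminorm. -/
noncomputable def semiPow {d : ℕ} (Ω : Set (E d)) (s p : ℝ) (u : E d → ℝ) : ℝ≥0∞ :=
  ∫⁻ x in Ω, ∫⁻ y in Ω ∩ Metric.ball x (bdist Ω x),
    ‖u y - u x‖ₑ ^ p / ENNReal.ofReal (bdist Ω x) ^ ((d : ℝ) + p * s)

/-- `(‖u‖_{L^p}^p + |u|^p)^{1/p}`, possibly infinite. -/
noncomputable def wNorm {d : ℕ} (Ω : Set (E d)) (s p : ℝ) (u : E d → ℝ) : ℝ≥0∞ :=
  ((∫⁻ x in Ω, ‖u x‖ₑ ^ p) + semiPow Ω s p u) ^ (1 / p)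

/-- Functions that are Lipschitz on the closure of `Ω` and vanish, on it, outside a compact set. -/
def IsLipClosed {d : ℕ} (Ω : Set (E d)) (v : E d → ℝ) : Prop :=
  (∃ L : ℝ≥0, LipschitzOnWith L v (closure Ω)) ∧
    ∃ C : Set (E d), IsCompact C ∧ ∀ x ∈ closure Ω, x ∉ C → v x = 0

/-- Lipschitz functions with compact support contained in `Ω` (extended by zero). -/
def IsLipCompact {d : ℕ} (Ω : Set (E d)) (v : E d → ℝ) : Prop :=
  (∃ L : ℝ≥0, LipschitzWith L v) ∧ HasCompactSupport v ∧ tsupport v ⊆ Ω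

/-- Classes in `L^p(Ω)` of finite norm that are limits, in the norm `wNorm`, of classes of
functions satisfying `P`. -/
def wClosure {d : ℕ} (Ω : Set (E d)) (s p : ℝ) (P : (E d → ℝ) → Prop) : Set (LpΩ Ω p) :=
  {u | wNorm Ω s p u < ∞ ∧ ∀ ε : ℝ≥0∞, 0 < ε →
    ∃ w : LpΩ Ω p, (∃ v, P v ∧ w =ᵐ[volume.restrict Ω] v) ∧ wNorm Ω s p (u - w : LpΩ Ω p) < ε}

section Aux

variable {d : ℕ} {Ω : Set (E d)} {s p : ℝ}

lemma semiPow_congr {u v : E d → ℝ} (h : u =ᵐ[volume.restrict Ω] v) :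
    semiPow Ω s p u = semiPow Ω s p v := by
  unfold semiPow
  refine lintegral_congr_ae ?_
  filter_upwards [h] with x hx
  refine lintegral_congr_ae ?_
  have h' := ae_restrict_of_ae_restrict_of_subset
    (inter_subset_left (t := Metric.ball x (bdist Ω x))) h
  filter_upwards [h'] with y hy
  rw [hx, hy]

lemma wNorm_congr {u v : E d → ℝ} (h : u =ᵐ[volume.restrict Ω] v) :
    wNorm Ω s p u = wNorm Ω s p v := by
  unfold wNorm
  rw [semiPow_congr h]
  congr 2
  refine lintegral_congr_ae ?_
  filter_upwards [h] with x hx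
  rw [hx]

lemma semiPow_eq (u : E d → ℝ) :
    semiPow Ω s p u = ∫⁻ x in Ω, ∫⁻ y in Ω,
      {z : E d × E d | dist z.2 z.1 < bdist Ω z.1}.indicator
        (fun z => ‖u z.2 - u z.1‖ₑ ^ p / ENNReal.ofReal (bdist Ω z.1) ^ ((d : ℝ) + p * s))
        (x, y) := by
  unfold semiPow
  congr 1
  ext x
  rw [inter_comm, ← Measure.restrict_restrict measurableSet_ball,
    ← lintegral_indicator measurableSet_ball]
  rfl

lemma measurable_kernel {u : E d → ℝ} (hu : Measurable u) :
    Measurable ({z : E d × E d | dist z.2 z.1 < bdist Ω z.1}.indicator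
      (fun z => ‖u z.2 - u z.1‖ₑ ^ p / ENNReal.ofReal (bdist Ω z.1) ^ ((d : ℝ) + p * s))) := by
  have hb : Measurable (fun z : E d × E d => bdist Ω z.1) :=
    (Metric.continuous_infDist_pt (frontier Ω)).measurable.comp measurable_fst
  refine Measurable.indicator ?_ (measurableSet_lt (by fun_prop) hb)
  refine Measurable.div ?_ ?_
  · exact ((hu.comp measurable_snd).sub (hu.comp measurable_fst)).enorm.pow_const p
  · exact hb.ennreal_ofReal.pow_const _

lemma semiPow_add_le (hp : 1 ≤ p) {u v : E d → ℝ} (hu : Measurable u) :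
    semiPow Ω s p (u + v) ≤ 2 ^ (p - 1) * (semiPow Ω s p u + semiPow Ω s p v) := by
  have h2 : (2 : ℝ≥0∞) ^ (p - 1) ≠ ∞ :=
    ENNReal.rpow_ne_top_of_nonneg (by linarith) (by simp)
  rw [semiPow_eq, semiPow_eq u, semiPow_eq v,
    ← lintegral_add_left (measurable_kernel hu).lintegral_prod_right',
    ← lintegral_const_mul' _ _ h2]
  refine lintegral_mono fun x => ?_
  have hm := (measurable_kernel (Ω := Ω) (s := s) (p := p) hu).comp
    (measurable_prodMk_left (x := x))
  simp only [Function.comp_def] at hm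
  rw [← lintegral_add_left hm, ← lintegral_const_mul' _ _ h2]
  refine lintegral_mono fun y => ?_
  simp only [indicator]
  split_ifs
  · have h : ‖(u + v) y - (u + v) x‖ₑ ^ p ≤
        2 ^ (p - 1) * (‖u y - u x‖ₑ ^ p + ‖v y - v x‖ₑ ^ p) := by
      refine le_trans ?_ (ENNReal.rpow_add_le_mul_rpow_add_rpow _ _ hp)
      refine ENNReal.rpow_le_rpow ?_ (by linarith)
      have : (u + v) y - (u + v) x = (u y - u x) + (v y - v x) := by
        simp only [Pi.add_apply]; ring
      rw [this]
      exact enorm_add_le _ _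
    calc _ ≤ _ := ENNReal.div_le_div_right h _
      _ = _ := by rw [mul_div_assoc, ENNReal.add_div]
  · simp

lemma lpPow_add_le (hp : 1 ≤ p) {u v : E d → ℝ} (hu : Measurable u) :
    ∫⁻ x in Ω, ‖(u + v) x‖ₑ ^ p ≤
      2 ^ (p - 1) * ((∫⁻ x in Ω, ‖u x‖ₑ ^ p) + ∫⁻ x in Ω, ‖v x‖ₑ ^ p) := by
  have h2 : (2 : ℝ≥0∞) ^ (p - 1) ≠ ∞ :=
    ENNReal.rpow_ne_top_of_nonneg (by linarith) (by simp)
  rw [← lintegral_add_left (hu.enorm.pow_const p), ← lintegral_const_mul' _ _ h2]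
  refine lintegral_mono fun x => ?_
  refine le_trans ?_ (ENNReal.rpow_add_le_mul_rpow_add_rpow _ _ hp)
  exact ENNReal.rpow_le_rpow (enorm_add_le _ _) (by linarith)

lemma wNorm_add_le (hp : 1 ≤ p) (u v : LpΩ Ω p) :
    wNorm Ω s p (u + v : LpΩ Ω p) ≤ 2 * (wNorm Ω s p u + wNorm Ω s p v) := by
  have hu : Measurable (u : E d → ℝ) := (Lp.stronglyMeasurable u).measurable
  have hp0 : 0 < p := by linarith
  have hq0 : 0 ≤ 1 / p := by positivity
  have hq1 : 1 / p ≤ 1 := by rw [div_le_one hp0]; exact hp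
  rw [wNorm_congr (Lp.coeFn_add u v)]
  unfold wNorm
  set a := ∫⁻ x in Ω, ‖u x‖ₑ ^ p
  set b := ∫⁻ x in Ω, ‖v x‖ₑ ^ p
  calc _ ≤ ((2 : ℝ≥0∞) ^ p * ((a + semiPow Ω s p u) + (b + semiPow Ω s p v))) ^ (1 / p) := by
        refine ENNReal.rpow_le_rpow ?_ hq0
        calc _ ≤ (2 : ℝ≥0∞) ^ (p - 1) * (a + b) +
              2 ^ (p - 1) * (semiPow Ω s p u + semiPow Ω s p v) :=
              add_le_add (lpPow_add_le hp hu) (semiPow_add_le hp hu)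
          _ = (2 : ℝ≥0∞) ^ (p - 1) * ((a + semiPow Ω s p u) + (b + semiPow Ω s p v)) := by ring
          _ ≤ _ := by
              gcongr
              · norm_num
              · linarith
    _ = 2 * ((a + semiPow Ω s p u) + (b + semiPow Ω s p v)) ^ (1 / p) := by
        rw [ENNReal.mul_rpow_of_nonneg _ _ hq0, ← ENNReal.rpow_mul,
          mul_one_div_cancel hp0.ne', ENNReal.rpow_one]
    _ ≤ _ := by
        gcongr
        exact ENNReal.rpow_add_le_add_rpow _ _ hq0 hq1

lemma wNorm_smul_le (hp : 1 ≤ p) (c : ℝ) (u : LpΩ Ω p) :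
    wNorm Ω s p (c • u : LpΩ Ω p) ≤ ‖c‖ₑ * wNorm Ω s p u := by
  have hp0 : 0 < p := by linarith
  have hq0 : 0 ≤ 1 / p := by positivity
  have hc : ‖c‖ₑ ^ p ≠ ∞ := ENNReal.rpow_ne_top_of_nonneg hp0.le (by simp)
  rw [wNorm_congr (Lp.coeFn_smul c u)]
  have h1 : ∫⁻ x in Ω, ‖(c • (u : E d → ℝ)) x‖ₑ ^ p = ‖c‖ₑ ^ p * ∫⁻ x in Ω, ‖u x‖ₑ ^ p := by
    rw [← lintegral_const_mul' _ _ hc]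
    congr 1
    ext x
    rw [Pi.smul_apply, smul_eq_mul, enorm_mul, ENNReal.mul_rpow_of_nonneg _ _ hp0.le]
  have h2 : semiPow Ω s p (c • (u : E d → ℝ)) = ‖c‖ₑ ^ p * semiPow Ω s p u := by
    unfold semiPow
    rw [← lintegral_const_mul' _ _ hc]
    congr 1
    ext x
    rw [← lintegral_const_mul' _ _ hc]
    congr 1
    ext y
    rw [Pi.smul_apply, Pi.smul_apply, ← smul_sub, smul_eq_mul, enorm_mul,
      ENNReal.mul_rpow_of_nonneg _ _ hp0.le, mul_div_assoc]
  unfold wNorm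
  rw [h1, h2, ← mul_add, ENNReal.mul_rpow_of_nonneg _ _ hq0, ← ENNReal.rpow_mul,
    mul_one_div_cancel hp0.ne', ENNReal.rpow_one]

lemma wNorm_zero (hp : 1 ≤ p) : wNorm Ω s p (0 : LpΩ Ω p) = 0 := by
  simpa using wNorm_smul_le (s := s) hp 0 (0 : LpΩ Ω p)

lemma isLipClosed_zero : IsLipClosed Ω (0 : E d → ℝ) :=
  ⟨⟨0, (LipschitzWith.const (0 : ℝ)).lipschitzOnWith⟩, ∅, isCompact_empty, fun _ _ _ => rfl⟩

lemma IsLipClosed.add {u v : E d → ℝ} (hu : IsLipClosed Ω u) (hv : IsLipClosed Ω v) :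
    IsLipClosed Ω (u + v) := by
  obtain ⟨⟨L, hL⟩, C, hC, hC'⟩ := hu
  obtain ⟨⟨M, hM⟩, D, hD, hD'⟩ := hv
  refine ⟨⟨L + M, hL.add hM⟩, C ∪ D, hC.union hD, fun x hx hxn => ?_⟩
  rw [mem_union, not_or] at hxn
  rw [Pi.add_apply, hC' x hx hxn.1, hD' x hx hxn.2, add_zero]

lemma IsLipClosed.smul {u : E d → ℝ} (c : ℝ) (hu : IsLipClosed Ω u) :
    IsLipClosed Ω (c • u) := by
  obtain ⟨⟨L, hL⟩, C, hC, hC'⟩ := hu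
  refine ⟨⟨‖c‖₊ * L, ?_⟩, C, hC, fun x hx hxn => ?_⟩
  · exact (lipschitzWith_smul c).comp_lipschitzOnWith hL
  · rw [Pi.smul_apply, hC' x hx hxn, smul_zero]

end Aux

/-- The space `𝔚^{s,p}(Ω)`: the closure of the compactly supported Lipschitz functions on the
closure of `Ω`, with respect to the norm `wNorm`. -/
def W {d : ℕ} (Ω : Set (E d)) (s p : ℝ) (hp : 1 ≤ p) : Submodule ℝ (LpΩ Ω p) where
  carrier := wClosure Ω s p (IsLipClosed Ω)
  zero_mem' := by
    refine ⟨by rw [wNorm_zero hp]; simp,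
      fun ε hε => ⟨0, ⟨0, isLipClosed_zero, Lp.coeFn_zero ..⟩, ?_⟩⟩
    rw [sub_zero, wNorm_zero hp]
    exact hε
  add_mem' := by
    rintro u v ⟨hu, hu'⟩ ⟨hv, hv'⟩
    refine ⟨(wNorm_add_le hp u v).trans_lt
      (ENNReal.mul_lt_top (by simp) (ENNReal.add_lt_top.2 ⟨hu, hv⟩)), fun ε hε => ?_⟩
    have hε4 : 0 < ε / 4 := ENNReal.div_pos hε.ne' (by simp)
    obtain ⟨w, ⟨a, ha, hwa⟩, hw⟩ := hu' (ε / 4) hε4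
    obtain ⟨z, ⟨b, hb, hzb⟩, hz⟩ := hv' (ε / 4) hε4
    refine ⟨w + z, ⟨a + b, ha.add hb, (Lp.coeFn_add w z).trans (hwa.add hzb)⟩, ?_⟩
    rw [add_sub_add_comm]
    refine (wNorm_add_le hp _ _).trans_lt ?_
    have h4 : ε = 2 * (ε / 4 + ε / 4) := by
      rw [← two_mul, ← mul_assoc]
      norm_num
      rw [ENNReal.mul_div_cancel (by norm_num) (by norm_num)]
    conv_rhs => rw [h4]
    exact (ENNReal.mul_lt_mul_iff_right (by simp) (by simp)).2 (ENNReal.add_lt_add hw hz)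
  smul_mem' := by
    rintro c u ⟨hu, hu'⟩
    refine ⟨(wNorm_smul_le hp c u).trans_lt (ENNReal.mul_lt_top (by simp) hu), fun ε hε => ?_⟩
    rcases eq_or_ne c 0 with rfl | hc
    · refine ⟨0, ⟨0, isLipClosed_zero, Lp.coeFn_zero ..⟩, ?_⟩
      rw [zero_smul, sub_zero, wNorm_zero hp]
      exact hε
    have hc0 : ‖c‖ₑ ≠ 0 := by simpa using hc
    have hct : ‖c‖ₑ ≠ ∞ := by simp
    obtain ⟨w, ⟨a, ha, hwa⟩, hw⟩ := hu' (ε / ‖c‖ₑ) (ENNReal.div_pos hε.ne' hct)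
    refine ⟨c • w, ⟨c • a, ha.smul c, (Lp.coeFn_smul c w).trans (hwa.const_smul c)⟩, ?_⟩
    rw [← smul_sub]
    refine (wNorm_smul_le hp _ _).trans_lt ?_
    rwa [mul_comm, ← ENNReal.lt_div_iff_mul_lt (Or.inl hc0) (Or.inl hct)]

/-- The space `𝔚̊^{s,p}(Ω)`: the closure of the Lipschitz functions with compact support in `Ω`,
with respect to the norm `wNorm`. -/
def W₀ {d : ℕ} (Ω : Set (E d)) (s p : ℝ) : Set (LpΩ Ω p) :=
  wClosure Ω s p (IsLipCompact Ω)

/-- Bounded linear functionals on `𝔚^{s,p}(Ω)` with respect to the norm `wNorm`. -/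
def IsBoundedFunctional {d : ℕ} {Ω : Set (E d)} {s p : ℝ} {hp : 1 ≤ p}
    (f : W Ω s p hp →ₗ[ℝ] ℝ) : Prop :=
  ∃ C : ℝ≥0, ∀ u : W Ω s p hp, ‖f u‖ₑ ≤ C * wNorm Ω s p (u : LpΩ Ω p)

/-- Membership of a class in `L^p(Ω)` in the fractional Sobolev space `W^{s,p}(Ω)`: its Gagliardo
seminorm is finite. -/
def MemSobolev {d : ℕ} {Ω : Set (E d)} {p : ℝ} (s : ℝ) (u : LpΩ Ω p) : Prop :=
  ∫⁻ x in Ω, ∫⁻ y in Ω, ‖u y - u x‖ₑ ^ p / ENNReal.ofReal ‖y - x‖ ^ ((d : ℝ) + p * s) < ∞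

/-- The energy
`E(u) = ∫_Ω ∫_{Ω ∩ B(x, δ(x))} A(x,y) / δ(x)^{d + p s} * F(u(y) - u(x)) dy dx`, for integrands
which are nonnegative, as a value in `[0, ∞]`. -/
noncomputable def energy {d : ℕ} {Ω : Set (E d)} {p : ℝ} (s : ℝ) (A : E d → E d → ℝ) (F : ℝ → ℝ)
    (u : LpΩ Ω p) : ℝ≥0∞ :=
  ∫⁻ x in Ω, ∫⁻ y in Ω ∩ Metric.ball x (bdist Ω x),
    ENNReal.ofReal (A x y / bdist Ω x ^ ((d : ℝ) + p * s) * F (u y - u x))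

/-- The admissible set `K_φ(p, h)` for the obstacle `h` on `Ω₀` and the boundary datum `φ`. -/
def K {d : ℕ} {Ω : Set (E d)} (Ω₀ : Set (E d)) (s p : ℝ) (hp : 1 ≤ p) (φ h : LpΩ Ω p) :
    Set (W Ω s p hp) :=
  {u | (∀ᵐ x ∂(volume.restrict Ω₀), h x ≤ (u : LpΩ Ω p) x) ∧ (u : LpΩ Ω p) - φ ∈ W₀ Ω s p}

end HetLoc

/-! ### Uniform convexity and convergence in the norm of `W` -/

namespace HetLoc
open Filter Topology

/-! This is the direct method, with uniform convexity of the norm playing the role usually given to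
weak compactness. Three facts make it work.

Competitors exist. The kernel `δ(x)^{-d-ps}` is singular only at the boundary, so an `L^p` function
supported in a compact subset of `Ω` is approximated in norm by its mollifications and lies in `W₀`
(`mem_W₀_of_compact_support`). Adding `(h - φ)⁺` restricted to the closure of `Ω₀` to `φ` therefore
gives an admissible function, however rough `h` is inside. For this `φ` itself must lie in `W`
(`mem_W_of_memSobolev`). A partition of unity reduces that to pieces. Interior pieces have compact
support. A boundary piece is flattened, shifted into the half-space and mollified
(`exists_boundary_localization`); averaging does not increase the Gagliardo seminorm, so the
approximants converge in `L^p` with bounded seminorms.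

The functional is coercive. On `φ + W₀` the Poincaré inequality `exists_poincare_W₀` bounds the norm
by the seminorm. Near the boundary one follows a chain of points descending geometrically to a
boundary point, where the function vanishes, and sums the increments (`exists_chain_bound`). The
change of variables costs a factor `θ^{-n}` at step `n` while the weight gains `θ^{nps}`, so the sum
converges because `ps > 1`. Interior points reach the boundary layer by finitely many steps of fixed
length. Since `p > 1`, the energy then dominates the linear term.

Bounded convex sets have strong limits. Integrating a two-point inequality shows that almost-minimal
points of a decreasing sequence of nonempty, bounded, midpoint-convex sets form a Cauchy sequence
(`exists_tendsto_of_antitone`). Applied to sublevel sets of `E - f` in `K`, this gives a strongly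
convergent minimizing sequence, and Fatou's lemma gives lower semicontinuity of the energy. The same
lemma shows that an `L^p` limit of Lipschitz functions with bounded seminorms lies in `W`
(`mem_W_of_bounded_approx`). -/

/-- Quantitative uniform convexity of `t ↦ |t| ^ p`. -/
lemma exists_uniform_convexity_const {p : ℝ} (hp : 1 < p) {ε : ℝ} (hε : 0 < ε) :
    ∃ c : ℝ, 0 < c ∧ ∀ a b : ℝ,
      |a - b| ^ p + c * |(a + b) / 2| ^ p ≤ (ε + c / 2) * (|a| ^ p + |b| ^ p) := by
  have hp0 : 0 < p := by linarith
  set D : ℝ × ℝ → ℝ := fun z => (|z.1| ^ p + |z.2| ^ p) / 2 - |(z.1 + z.2) / 2| ^ p with hD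
  set N : ℝ × ℝ → ℝ := fun z => |z.1 - z.2| ^ p - ε * (|z.1| ^ p + |z.2| ^ p) with hN
  have hpow : Continuous fun t : ℝ => |t| ^ p :=
    continuous_abs.rpow_const fun _ => Or.inr hp0.le
  have hDc : Continuous D := by
    refine (((hpow.comp continuous_fst).add (hpow.comp continuous_snd)).div_const 2).sub
      (hpow.comp ((continuous_fst.add continuous_snd).div_const 2))
  have hNc : Continuous N :=
    (hpow.comp (continuous_fst.sub continuous_snd)).sub
      (((hpow.comp continuous_fst).add (hpow.comp continuous_snd)).const_mul ε)
  have hmid : ∀ a b : ℝ, |(a + b) / 2| ^ p ≤ ((|a| + |b|) / 2) ^ p := fun a b => by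
    refine Real.rpow_le_rpow (abs_nonneg _) ?_ hp0.le
    rw [abs_div, abs_two]
    gcongr
    exact abs_add_le a b
  have hconv : ∀ a b : ℝ, ((|a| + |b|) / 2) ^ p ≤ (|a| ^ p + |b| ^ p) / 2 := fun a b => by
    have := (convexOn_rpow hp.le).2 (abs_nonneg a) (abs_nonneg b)
      (by norm_num : (0 : ℝ) ≤ 1 / 2) (by norm_num : (0 : ℝ) ≤ 1 / 2) (by norm_num)
    simp only [smul_eq_mul] at this
    calc _ = (1 / 2 * |a| + 1 / 2 * |b|) ^ p := by congr 1; ring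
      _ ≤ _ := this
      _ = _ := by ring
  have hD0 : ∀ z, 0 ≤ D z := fun z => by
    have := (hmid z.1 z.2).trans (hconv z.1 z.2)
    simp only [hD]; linarith
  have hDpos : ∀ z : ℝ × ℝ, z.1 ≠ z.2 → 0 < D z := by
    rintro ⟨a, b⟩ hab
    simp only [hD] at hab ⊢
    -- Strict convexity of the power on `[0, ∞)` covers `|a| ≠ |b|`; in the remaining case `a = -b`
    -- and the midpoint term vanishes.
    by_cases hab' : |a| = |b|
    · have hba : a = -b := by
        rcases abs_eq_abs.1 hab' with h | h
        · exact absurd h hab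
        · exact h
      subst hba
      have hb : b ≠ 0 := by rintro rfl; simp at hab
      have : 0 < |b| ^ p := Real.rpow_pos_of_pos (abs_pos.2 hb) _
      simp only [neg_add_cancel, zero_div, abs_zero, Real.zero_rpow hp0.ne', abs_neg]
      linarith
    · have := (strictConvexOn_rpow hp).2 (abs_nonneg a) (abs_nonneg b) hab'
        (by norm_num : (0 : ℝ) < 1 / 2) (by norm_num : (0 : ℝ) < 1 / 2) (by norm_num)
      simp only [smul_eq_mul] at this
      have h1 : (1 / 2 * |a| + 1 / 2 * |b|) = (|a| + |b|) / 2 := by ring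
      rw [h1] at this
      have := hmid a b
      linarith
  -- On the sphere, `N` is negative on the diagonal, so `D` is positive on the compact set where `N
  -- ≥ 0`. There `D` has a positive minimum and `N` is bounded, which yields `c`.
  obtain ⟨c, hc, hcS⟩ : ∃ c : ℝ, 0 < c ∧ ∀ z ∈ Metric.sphere (0 : ℝ × ℝ) 1, N z ≤ c * D z := by
    have hS : IsCompact (Metric.sphere (0 : ℝ × ℝ) 1 ∩ {z | 0 ≤ N z}) :=
      (isCompact_sphere _ _).inter_right (isClosed_le continuous_const hNc)
    obtain ⟨M, hM⟩ := (isCompact_sphere (0 : ℝ × ℝ) 1).bddAbove_image hNc.continuousOn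
    rcases (Metric.sphere (0 : ℝ × ℝ) 1 ∩ {z | 0 ≤ N z}).eq_empty_or_nonempty with he | hne
    · refine ⟨1, one_pos, fun z hz => ?_⟩
      have : ¬ 0 ≤ N z := fun h => (he.subset ⟨hz, h⟩ : z ∈ (∅ : Set (ℝ × ℝ)))
      have := hD0 z
      linarith
    · obtain ⟨z₀, ⟨hz₀, hz₀N⟩, hmin⟩ := hS.exists_isMinOn hne hDc.continuousOn
      have hz₀D : 0 < D z₀ := by
        refine hDpos z₀ fun heq => ?_
        have hne0 : z₀ ≠ 0 := by rintro rfl; simp at hz₀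
        have h1 : 0 < |z₀.1| ^ p + |z₀.2| ^ p := by
          rw [← heq]
          have : z₀.1 ≠ 0 := fun h0 => hne0 (Prod.ext h0 (heq ▸ h0))
          have := Real.rpow_pos_of_pos (abs_pos.2 this) p
          linarith
        have h2 : N z₀ = - (ε * (|z₀.1| ^ p + |z₀.2| ^ p)) := by
          simp only [hN, heq, sub_self, abs_zero, Real.zero_rpow hp0.ne']; ring
        have : 0 ≤ N z₀ := hz₀N
        nlinarith
      refine ⟨(|M| + 1) / D z₀, by positivity, fun z hz => ?_⟩
      by_cases hzN : 0 ≤ N z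
      · have h1 : D z₀ ≤ D z := hmin ⟨hz, hzN⟩
        have h2 : N z ≤ M := hM ⟨z, hz, rfl⟩
        have h3 : M ≤ |M| + 1 := (le_abs_self M).trans (by linarith)
        calc N z ≤ |M| + 1 := h2.trans h3
          _ = (|M| + 1) / D z₀ * D z₀ := by field_simp
          _ ≤ _ := by gcongr
      · have : 0 ≤ (|M| + 1) / D z₀ * D z := mul_nonneg (by positivity) (hD0 z)
        linarith
  refine ⟨c, hc, fun a b => ?_⟩
  by_cases h0 : ((a, b) : ℝ × ℝ) = 0
  · obtain ⟨rfl, rfl⟩ : a = 0 ∧ b = 0 := by simpa using h0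
    simp [Real.zero_rpow hp0.ne']
  -- `N` and `D` are homogeneous of degree `p`, so the inequality extends from the sphere by
  -- scaling.
  · set r := ‖((a, b) : ℝ × ℝ)‖ with hr
    have hr0 : 0 < r := norm_pos_iff.2 h0
    have hz : r⁻¹ • ((a, b) : ℝ × ℝ) ∈ Metric.sphere (0 : ℝ × ℝ) 1 := by
      rw [mem_sphere_zero_iff_norm, norm_smul, norm_inv, Real.norm_eq_abs, abs_of_pos hr0, ← hr,
        inv_mul_cancel₀ hr0.ne']
    have key := hcS _ hz
    have hsc : ∀ t : ℝ, |r⁻¹ * t| ^ p = (r⁻¹) ^ p * |t| ^ p := fun t => by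
      rw [abs_mul, abs_of_pos (inv_pos.2 hr0), Real.mul_rpow (by positivity) (abs_nonneg _)]
    have hrp : 0 < (r⁻¹) ^ p := Real.rpow_pos_of_pos (inv_pos.2 hr0) _
    simp only [hN, hD, Prod.smul_fst, Prod.smul_snd, smul_eq_mul, ← mul_sub, ← mul_add,
      mul_div_assoc, hsc] at key
    have key2 : (r⁻¹) ^ p * (|a - b| ^ p + c * |(a + b) / 2| ^ p) ≤
        (r⁻¹) ^ p * ((ε + c / 2) * (|a| ^ p + |b| ^ p)) := by
      nlinarith
    exact le_of_mul_le_mul_left key2 hrp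

lemma enorm_rpow_eq (t : ℝ) {p : ℝ} (hp : 0 ≤ p) : ‖t‖ₑ ^ p = ENNReal.ofReal (|t| ^ p) := by
  rw [Real.enorm_eq_ofReal_abs, ENNReal.ofReal_rpow_of_nonneg (abs_nonneg _) hp]

lemma exists_uniform_convexity_const_enorm {p : ℝ} (hp : 1 < p) {ε : ℝ} (hε : 0 < ε) :
    ∃ c : ℝ, 0 < c ∧ ∀ a b : ℝ,
      ‖a - b‖ₑ ^ p + ENNReal.ofReal c * ‖(1 / 2 : ℝ) * (a + b)‖ₑ ^ p ≤
        ENNReal.ofReal (ε + c / 2) * (‖a‖ₑ ^ p + ‖b‖ₑ ^ p) := by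
  obtain ⟨c, hc, h⟩ := exists_uniform_convexity_const hp hε
  have hp0 : 0 ≤ p := by linarith
  refine ⟨c, hc, fun a b => ?_⟩
  simp only [enorm_rpow_eq _ hp0]
  rw [← ENNReal.ofReal_mul hc.le, ← ENNReal.ofReal_add (by positivity) (by positivity),
    ← ENNReal.ofReal_add (by positivity) (by positivity), ← ENNReal.ofReal_mul (by positivity)]
  refine ENNReal.ofReal_le_ofReal ?_
  convert h a b using 4
  rw [show (1 / 2 : ℝ) * (a + b) = (a + b) / 2 by ring]

/-! ### The weighted measure on pairs, and strong convergence from uniform convexity. -/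

variable {d : ℕ} {Ω : Set (E d)} {s p : ℝ}

/-- The measure `1_{|y - x| < δ(x)} δ(x)^{-d-ps} dy dx` on pairs of points of `Ω`. -/
noncomputable def pairMeasure (Ω : Set (E d)) (s p : ℝ) : Measure (E d × E d) :=
  (((volume.restrict Ω).prod (volume.restrict Ω)).restrict
    {z : E d × E d | dist z.2 z.1 < bdist Ω z.1}).withDensity
      fun z => (ENNReal.ofReal (bdist Ω z.1) ^ ((d : ℝ) + p * s))⁻¹

lemma measurable_bdist (Ω : Set (E d)) : Measurable (bdist Ω) :=
  (Metric.continuous_infDist_pt (frontier Ω)).measurable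

lemma measurableSet_pairs (Ω : Set (E d)) :
    MeasurableSet {z : E d × E d | dist z.2 z.1 < bdist Ω z.1} :=
  measurableSet_lt (by fun_prop) ((measurable_bdist Ω).comp measurable_fst)

lemma measurable_weight (Ω : Set (E d)) (a : ℝ) :
    Measurable fun z : E d × E d => (ENNReal.ofReal (bdist Ω z.1) ^ a)⁻¹ :=
  ((((measurable_bdist Ω).comp measurable_fst).ennreal_ofReal).pow_const _).inv

lemma pairMeasure_absolutelyContinuous :
    pairMeasure Ω s p ≪ (volume.restrict Ω).prod (volume.restrict Ω) :=
  (withDensity_absolutelyContinuous _ _).trans Measure.absolutelyContinuous_restrict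

lemma ae_pairMeasure_of_ae {P : E d → Prop} (h : ∀ᵐ x ∂(volume.restrict Ω), P x) :
    ∀ᵐ z ∂(pairMeasure Ω s p), P z.1 ∧ P z.2 := by
  refine pairMeasure_absolutelyContinuous.ae_le ?_
  exact (Measure.quasiMeasurePreserving_fst.ae h).and (Measure.quasiMeasurePreserving_snd.ae h)

lemma lintegral_pairMeasure {g : E d × E d → ℝ≥0∞}
    (hg : AEMeasurable g ((volume.restrict Ω).prod (volume.restrict Ω))) :
    ∫⁻ z, g z ∂(pairMeasure Ω s p) =
      ∫⁻ x in Ω, ∫⁻ y in Ω ∩ Metric.ball x (bdist Ω x),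
        g (x, y) / ENNReal.ofReal (bdist Ω x) ^ ((d : ℝ) + p * s) := by
  have hS := measurableSet_pairs Ω
  rw [pairMeasure, lintegral_withDensity_eq_lintegral_mul₀ (measurable_weight Ω _).aemeasurable
    hg.restrict, ← lintegral_indicator hS, lintegral_prod]
  · refine lintegral_congr fun x => ?_
    rw [inter_comm, ← Measure.restrict_restrict measurableSet_ball,
      ← lintegral_indicator measurableSet_ball]
    refine lintegral_congr fun y => ?_
    simp only [indicator, mem_ofPred_eq, Metric.mem_ball, Pi.mul_apply]
    split_ifs
    · rw [mul_comm, div_eq_mul_inv]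
    · rfl
  · exact ((measurable_weight Ω _).aemeasurable.mul hg).indicator hS

lemma semiPow_eq_lintegral {u : E d → ℝ} (hu : Measurable u) :
    semiPow Ω s p u = ∫⁻ z, ‖u z.2 - u z.1‖ₑ ^ p ∂(pairMeasure Ω s p) := by
  rw [lintegral_pairMeasure]
  · rfl
  · exact (((hu.comp measurable_snd).sub (hu.comp measurable_fst)).enorm.pow_const p).aemeasurable

lemma measurable_coeFn (u : LpΩ Ω p) : Measurable (u : E d → ℝ) :=
  (Lp.stronglyMeasurable u).measurable

lemma energy_eq_lintegral {A : E d → E d → ℝ}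
    (hA : AEMeasurable (Function.uncurry A) ((volume.restrict Ω).prod (volume.restrict Ω)))
    {F : ℝ → ℝ} (hF : Measurable F) (u : LpΩ Ω p) :
    energy s A F u =
      ∫⁻ z, ENNReal.ofReal (A z.1 z.2 * F (u z.2 - u z.1)) ∂(pairMeasure Ω s p) := by
  have hu := measurable_coeFn u
  rw [lintegral_pairMeasure]
  · unfold energy
    refine lintegral_congr fun x => ?_
    rw [inter_comm, ← Measure.restrict_restrict measurableSet_ball]
    refine setLIntegral_congr_fun measurableSet_ball fun y hy => ?_
    -- A nonempty ball has positive radius, so real and extended division by the weight agree.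
    have hpos : 0 < bdist Ω x := dist_nonneg.trans_lt hy
    dsimp only
    rw [ENNReal.ofReal_rpow_of_pos hpos, ← ENNReal.ofReal_div_of_pos (Real.rpow_pos_of_pos hpos _),
      div_mul_eq_mul_div]
  · refine (hA.mul ?_).ennreal_ofReal
    exact (hF.comp ((hu.comp measurable_snd).sub (hu.comp measurable_fst))).aemeasurable

/-- The `p`-th power of `wNorm`. -/
noncomputable def gPow (Ω : Set (E d)) (s p : ℝ) (u : E d → ℝ) : ℝ≥0∞ :=
  (∫⁻ x in Ω, ‖u x‖ₑ ^ p) + semiPow Ω s p u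

lemma gPow_congr {u v : E d → ℝ} (h : u =ᵐ[volume.restrict Ω] v) :
    gPow Ω s p u = gPow Ω s p v := by
  unfold gPow
  rw [semiPow_congr h]
  congr 1
  refine lintegral_congr_ae ?_
  filter_upwards [h] with x hx
  rw [hx]

lemma semiPow_neg (u : E d → ℝ) : semiPow Ω s p (-u) = semiPow Ω s p u := by
  unfold semiPow
  refine lintegral_congr fun x => lintegral_congr fun y => ?_
  rw [Pi.neg_apply, Pi.neg_apply, neg_sub_neg, ← enorm_neg (u x - u y), neg_sub]

lemma gPow_neg (u : E d → ℝ) : gPow Ω s p (-u) = gPow Ω s p u := by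
  simp only [gPow, semiPow_neg, Pi.neg_apply, enorm_neg]

lemma gPow_sub_comm (u v : LpΩ Ω p) :
    gPow Ω s p (u - v : LpΩ Ω p) = gPow Ω s p (v - u : LpΩ Ω p) := by
  rw [← neg_sub v u, gPow_congr (Lp.coeFn_neg (v - u)), gPow_neg]

lemma wNorm_eq_gPow (u : E d → ℝ) : wNorm Ω s p u = gPow Ω s p u ^ (1 / p) := rfl

lemma wNorm_rpow (hp : 0 < p) (u : E d → ℝ) : wNorm Ω s p u ^ p = gPow Ω s p u := by
  rw [wNorm_eq_gPow, ← ENNReal.rpow_mul, one_div_mul_cancel hp.ne', ENNReal.rpow_one]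

lemma wNorm_lt_iff (hp : 0 < p) (u : E d → ℝ) (ε : ℝ≥0∞) :
    wNorm Ω s p u < ε ↔ gPow Ω s p u < ε ^ p := by
  rw [← wNorm_rpow hp, ENNReal.rpow_lt_rpow_iff hp]

lemma wNorm_lt_top_iff (hp : 0 < p) (u : E d → ℝ) :
    wNorm Ω s p u < ∞ ↔ gPow Ω s p u < ∞ := by
  rw [wNorm_lt_iff hp, ENNReal.top_rpow_of_pos hp]

lemma lintegral_eq_eLpNorm_rpow (hp : 0 < p) (u : E d → ℝ) (μ : Measure (E d)) :
    ∫⁻ x, ‖u x‖ₑ ^ p ∂μ = eLpNorm u (ENNReal.ofReal p) μ ^ p := by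
  rw [eLpNorm_eq_lintegral_rpow_enorm_toReal (by simpa using hp) (by simp),
    ENNReal.toReal_ofReal hp.le, ← ENNReal.rpow_mul, one_div_mul_cancel hp.ne', ENNReal.rpow_one]

/-- The two-point inequality is integrated twice: over `Ω` with the values of `u` and `v`, and over
pairs with their increments. -/
lemma gPow_uniform_convexity {ε c : ℝ}
    (h : ∀ a b : ℝ, ‖a - b‖ₑ ^ p + ENNReal.ofReal c * ‖(1 / 2 : ℝ) * (a + b)‖ₑ ^ p ≤
        ENNReal.ofReal (ε + c / 2) * (‖a‖ₑ ^ p + ‖b‖ₑ ^ p)) (u v : LpΩ Ω p) :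
    gPow Ω s p (u - v : LpΩ Ω p) +
        ENNReal.ofReal c * gPow Ω s p ((1 / 2 : ℝ) • (u + v) : LpΩ Ω p) ≤
      ENNReal.ofReal (ε + c / 2) * (gPow Ω s p u + gPow Ω s p v) := by
  have hu := measurable_coeFn u
  have hv := measurable_coeFn v
  have e1 : ((u - v : LpΩ Ω p) : E d → ℝ) =ᵐ[volume.restrict Ω] fun x => u x - v x :=
    Lp.coeFn_sub u v
  have e2 : (((1 / 2 : ℝ) • (u + v) : LpΩ Ω p) : E d → ℝ) =ᵐ[volume.restrict Ω]
      fun x => (1 / 2 : ℝ) * (u x + v x) := by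
    filter_upwards [Lp.coeFn_smul (1 / 2 : ℝ) (u + v), Lp.coeFn_add u v] with x h1 h2
    rw [h1, Pi.smul_apply, h2, smul_eq_mul, Pi.add_apply]
  rw [gPow_congr e1, gPow_congr e2]
  unfold gPow
  rw [semiPow_eq_lintegral (by fun_prop), semiPow_eq_lintegral (by fun_prop),
    semiPow_eq_lintegral hu, semiPow_eq_lintegral hv]
  have k1 : (∫⁻ x in Ω, ‖u x - v x‖ₑ ^ p) +
      ENNReal.ofReal c * (∫⁻ x in Ω, ‖(1 / 2 : ℝ) * (u x + v x)‖ₑ ^ p) ≤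
      ENNReal.ofReal (ε + c / 2) * ((∫⁻ x in Ω, ‖u x‖ₑ ^ p) + ∫⁻ x in Ω, ‖v x‖ₑ ^ p) := by
    rw [← lintegral_const_mul' _ _ ENNReal.ofReal_ne_top, ← lintegral_add_left (by fun_prop),
      ← lintegral_add_left (by fun_prop), ← lintegral_const_mul' _ _ ENNReal.ofReal_ne_top]
    exact lintegral_mono fun x => h _ _
  have k2 : (∫⁻ z, ‖(u z.2 - v z.2) - (u z.1 - v z.1)‖ₑ ^ p ∂(pairMeasure Ω s p)) +
      ENNReal.ofReal c * (∫⁻ z, ‖(1 / 2 : ℝ) * (u z.2 + v z.2) -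
        (1 / 2 : ℝ) * (u z.1 + v z.1)‖ₑ ^ p ∂(pairMeasure Ω s p)) ≤
      ENNReal.ofReal (ε + c / 2) * ((∫⁻ z, ‖u z.2 - u z.1‖ₑ ^ p ∂(pairMeasure Ω s p)) +
        ∫⁻ z, ‖v z.2 - v z.1‖ₑ ^ p ∂(pairMeasure Ω s p)) := by
    rw [← lintegral_const_mul' _ _ ENNReal.ofReal_ne_top, ← lintegral_add_left (by fun_prop),
      ← lintegral_add_left (by fun_prop), ← lintegral_const_mul' _ _ ENNReal.ofReal_ne_top]
    refine lintegral_mono fun z => ?_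
    convert h (u z.2 - u z.1) (v z.2 - v z.1) using 4
    · ring_nf
    · ring_nf
  calc _ ≤ _ := le_of_eq (by ring)
    _ ≤ _ := add_le_add k1 k2
    _ = _ := by ring

lemma exists_subseq_ae [Fact (1 ≤ ENNReal.ofReal p)] {y : ℕ → LpΩ Ω p} {u : LpΩ Ω p}
    (h : Tendsto y atTop (𝓝 u)) :
    ∃ ns : ℕ → ℕ, StrictMono ns ∧
      ∀ᵐ x ∂(volume.restrict Ω), Tendsto (fun k => y (ns k) x) atTop (𝓝 (u x)) :=
  (tendstoInMeasure_of_tendsto_Lp h).exists_seq_tendsto_ae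

/-- Lower semicontinuity, under convergence in `L^p`, of integrals over pairs. -/
lemma lintegral_pair_le_of_tendsto [Fact (1 ≤ ENNReal.ofReal p)] {y : ℕ → LpΩ Ω p} {u : LpΩ Ω p}
    (h : Tendsto y atTop (𝓝 u)) {H : E d × E d → ℝ → ℝ → ℝ≥0∞}
    (hH : ∀ z, Continuous fun t : ℝ × ℝ => H z t.1 t.2)
    (hm : ∀ w : LpΩ Ω p, AEMeasurable (fun z => H z (w z.1) (w z.2)) (pairMeasure Ω s p))
    {C : ℝ≥0∞} (hC : ∀ᶠ k in atTop, ∫⁻ z, H z (y k z.1) (y k z.2) ∂(pairMeasure Ω s p) ≤ C) :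
    ∫⁻ z, H z (u z.1) (u z.2) ∂(pairMeasure Ω s p) ≤ C := by
  -- Along an a.e. convergent subsequence the integrand converges for almost every pair, and Fatou's
  -- lemma applies.
  obtain ⟨ns, hns, hae⟩ := exists_subseq_ae h
  calc ∫⁻ z, H z (u z.1) (u z.2) ∂(pairMeasure Ω s p)
      = ∫⁻ z, liminf (fun k => H z (y (ns k) z.1) (y (ns k) z.2)) atTop ∂(pairMeasure Ω s p) := by
        refine lintegral_congr_ae ?_
        filter_upwards [ae_pairMeasure_of_ae hae] with z hz
        exact ((((hH z).tendsto (u z.1, u z.2)).comp (hz.1.prodMk_nhds hz.2)).liminf_eq).symm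
    _ ≤ liminf (fun k => ∫⁻ z, H z (y (ns k) z.1) (y (ns k) z.2) ∂(pairMeasure Ω s p)) atTop :=
        lintegral_liminf_le' fun k => hm _
    _ ≤ C := liminf_le_of_frequently_le' (hns.tendsto_atTop.eventually hC).frequently

lemma lintegral_le_of_tendsto [Fact (1 ≤ ENNReal.ofReal p)] {y : ℕ → LpΩ Ω p} {u : LpΩ Ω p}
    (h : Tendsto y atTop (𝓝 u))
    {C : ℝ≥0∞} (hC : ∀ᶠ k in atTop, ∫⁻ x in Ω, ‖y k x‖ₑ ^ p ≤ C) :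
    ∫⁻ x in Ω, ‖u x‖ₑ ^ p ≤ C := by
  obtain ⟨ns, hns, hae⟩ := exists_subseq_ae h
  calc ∫⁻ x in Ω, ‖u x‖ₑ ^ p
      = ∫⁻ x in Ω, liminf (fun k => ‖y (ns k) x‖ₑ ^ p) atTop := by
        refine lintegral_congr_ae ?_
        filter_upwards [hae] with z hz
        exact ((((ENNReal.continuous_rpow_const (y := p)).comp continuous_enorm).tendsto _).comp
          hz).liminf_eq.symm
    _ ≤ liminf (fun k => ∫⁻ x in Ω, ‖y (ns k) x‖ₑ ^ p) atTop :=
        lintegral_liminf_le' fun k => ((measurable_coeFn _).enorm.pow_const p).aemeasurable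
    _ ≤ C := liminf_le_of_frequently_le' (hns.tendsto_atTop.eventually hC).frequently

lemma semiPow_le_of_tendsto [Fact (1 ≤ ENNReal.ofReal p)] {y : ℕ → LpΩ Ω p} {u : LpΩ Ω p}
    (h : Tendsto y atTop (𝓝 u))
    {C : ℝ≥0∞} (hC : ∀ᶠ k in atTop, semiPow Ω s p (y k) ≤ C) :
    semiPow Ω s p u ≤ C := by
  rw [semiPow_eq_lintegral (measurable_coeFn u)]
  refine lintegral_pair_le_of_tendsto h (H := fun z a b => ‖b - a‖ₑ ^ p)
    (fun z => ?_) (fun w => ?_) ?_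
  · exact (ENNReal.continuous_rpow_const (y := p)).comp
      (continuous_enorm.comp (continuous_snd.sub continuous_fst))
  · have := measurable_coeFn w
    exact (by fun_prop : Measurable _).aemeasurable
  · filter_upwards [hC] with k hk
    rwa [← semiPow_eq_lintegral (measurable_coeFn _)]

/-- The factor `2` comes from bounding the two summands of `gPow` separately; it is harmless for
finiteness and for smallness. -/
lemma gPow_le_of_tendsto [Fact (1 ≤ ENNReal.ofReal p)] {y : ℕ → LpΩ Ω p} {u : LpΩ Ω p}
    (h : Tendsto y atTop (𝓝 u))
    {C : ℝ≥0∞} (hC : ∀ᶠ k in atTop, gPow Ω s p (y k) ≤ C) :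
    gPow Ω s p u ≤ 2 * C := by
  rw [two_mul]
  exact add_le_add (lintegral_le_of_tendsto h (hC.mono fun k hk => le_self_add.trans hk))
    (semiPow_le_of_tendsto h (hC.mono fun k hk => le_add_self.trans hk))

lemma enorm_Lp_rpow_le_gPow (hp : 0 < p) (u : LpΩ Ω p) :
    ‖u‖ₑ ^ p ≤ gPow Ω s p u := by
  rw [Lp.enorm_def, ← lintegral_eq_eLpNorm_rpow hp]
  exact le_self_add

lemma tendsto_of_tendsto_gPow (hp : 1 ≤ p) [Fact (1 ≤ ENNReal.ofReal p)] {y : ℕ → LpΩ Ω p}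
    {u : LpΩ Ω p} (h : Tendsto (fun k => gPow Ω s p (y k - u : LpΩ Ω p)) atTop (𝓝 0)) :
    Tendsto y atTop (𝓝 u) := by
  have hp0 : 0 < p := by linarith
  rw [tendsto_iff_edist_tendsto_0]
  have h1 : Tendsto (fun k => gPow Ω s p (y k - u : LpΩ Ω p) ^ (1 / p)) atTop (𝓝 0) := by
    have := ((ENNReal.continuous_rpow_const (y := 1 / p)).tendsto 0).comp h
    rwa [ENNReal.zero_rpow_of_pos (by positivity)] at this
  refine tendsto_of_tendsto_of_tendsto_of_le_of_le tendsto_const_nhds h1 (fun _ => zero_le)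
    fun k => ?_
  rw [edist_eq_enorm_sub, one_div, ENNReal.le_rpow_inv_iff hp0]
  exact enorm_Lp_rpow_le_gPow hp0 _

/-- Completeness with respect to `gPow`. -/
lemma exists_tendsto_gPow_of_cauchy (hp : 1 ≤ p) {y : ℕ → LpΩ Ω p}
    (h : ∀ ε : ℝ≥0∞, 0 < ε → ∃ N, ∀ n ≥ N, ∀ m ≥ N, gPow Ω s p (y n - y m : LpΩ Ω p) ≤ ε) :
    ∃ u : LpΩ Ω p, Tendsto (fun k => gPow Ω s p (y k - u : LpΩ Ω p)) atTop (𝓝 0) := by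
  have hp0 : 0 < p := by linarith
  have : Fact (1 ≤ ENNReal.ofReal p) := ⟨by simpa using ENNReal.ofReal_le_ofReal hp⟩
  have hcau : CauchySeq y := by
    rw [EMetric.cauchySeq_iff]
    intro ε hε
    obtain ⟨δ, hδ, hδε⟩ := exists_between hε
    obtain ⟨N, hN⟩ := h (δ ^ p) (ENNReal.rpow_pos_of_nonneg hδ hp0.le)
    refine ⟨N, fun n hn m hm => lt_of_le_of_lt ?_ hδε⟩
    rw [edist_eq_enorm_sub, ← ENNReal.rpow_le_rpow_iff hp0]
    exact (enorm_Lp_rpow_le_gPow hp0 _).trans (hN n hn m hm)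
  obtain ⟨u, hu⟩ := cauchySeq_tendsto_of_complete hcau
  refine ⟨u, ENNReal.tendsto_nhds_zero.2 fun ε hε => ?_⟩
  obtain ⟨N, hN⟩ := h (ε / 2) (ENNReal.half_pos hε.ne')
  filter_upwards [eventually_ge_atTop N] with n hn
  -- Lower semicontinuity in `m` of the norm of `y n - y m` upgrades the `L^p` limit to a limit in
  -- `gPow`.
  have h1 : Tendsto (fun m => y n - y m) atTop (𝓝 (y n - u)) := tendsto_const_nhds.sub hu
  have := gPow_le_of_tendsto (s := s) h1 (C := ε / 2)
    (by filter_upwards [eventually_ge_atTop N] with m hm using hN n hn m hm)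
  rwa [ENNReal.mul_div_cancel (by simp) (by simp)] at this

/-- A decreasing sequence of nonempty bounded convex sets has points that converge, with respect
to `gPow`. -/
lemma exists_tendsto_of_antitone (hp : 1 < p) {C : ℕ → Set (LpΩ Ω p)} (hanti : Antitone C)
    (hne : ∀ n, (C n).Nonempty)
    (hconv : ∀ n, ∀ u ∈ C n, ∀ v ∈ C n, (1 / 2 : ℝ) • (u + v) ∈ C n)
    {M : ℝ≥0∞} (hM : M ≠ ∞) (hbdd : ∀ u ∈ C 0, gPow Ω s p u ≤ M) :
    ∃ (y : ℕ → LpΩ Ω p) (u : LpΩ Ω p), (∀ n, y n ∈ C n) ∧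
      Tendsto (fun k => gPow Ω s p (y k - u : LpΩ Ω p)) atTop (𝓝 0) := by
  -- The infima `g n` increase and are bounded by `M`, hence converge; the sequence `y` is made of
  -- near-minimizers.
  set g : ℕ → ℝ≥0∞ := fun n => ⨅ u ∈ C n, gPow Ω s p u with hg
  have hgle : ∀ n, ∀ u ∈ C n, g n ≤ gPow Ω s p u := fun n u hu => iInf₂_le u hu
  have hgM : ∀ n, g n ≤ M := fun n => by
    obtain ⟨u, hu⟩ := hne n
    exact (hgle n u hu).trans (hbdd u (hanti (Nat.zero_le n) hu))
  have hgfin : ∀ n, g n ≠ ∞ := fun n => ((hgM n).trans_lt hM.lt_top).ne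
  have hgmono : Monotone g := fun n m hnm => iInf_le_iInf_of_subset (hanti hnm)
  have hex : ∀ n : ℕ, ∃ u ∈ C n, gPow Ω s p u ≤ g n + ENNReal.ofReal (1 / (n + 1)) := fun n => by
    have h1 : g n < g n + ENNReal.ofReal (1 / (n + 1)) :=
      ENNReal.lt_add_right (hgfin n) (by rw [ne_eq, ENNReal.ofReal_eq_zero, not_le]; positivity)
    obtain ⟨u, hu, hlt⟩ : ∃ u ∈ C n, gPow Ω s p u < g n + ENNReal.ofReal (1 / (n + 1)) := by
      simpa only [hg, iInf_lt_iff, exists_prop] using h1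
    exact ⟨u, hu, hlt.le⟩
  choose y hyC hy using hex
  set r : ℕ → ℝ := fun n => (g n).toReal
  have hr : ∀ n, ENNReal.ofReal (r n) = g n := fun n => ENNReal.ofReal_toReal (hgfin n)
  have hr0 : ∀ n, 0 ≤ r n := fun n => ENNReal.toReal_nonneg
  have hrmono : Monotone r := fun n m hnm => ENNReal.toReal_mono (hgfin m) (hgmono hnm)
  have hrM : ∀ n, r n ≤ M.toReal := fun n => ENNReal.toReal_mono hM (hgM n)
  obtain ⟨l, hl⟩ : ∃ l, Tendsto r atTop (𝓝 l) :=
    ⟨_, tendsto_atTop_ciSup hrmono ⟨M.toReal, by rintro _ ⟨n, rfl⟩; exact hrM n⟩⟩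
  have hrl : ∀ n, r n ≤ l := fun n => hrmono.ge_of_tendsto hl n
  have hl0 : 0 ≤ l := (hr0 0).trans (hrl 0)
  obtain ⟨u, hu⟩ := exists_tendsto_gPow_of_cauchy (Ω := Ω) (s := s) hp.le (y := y) (by
    intro ε hε
    obtain ⟨ε', hε', hεε'⟩ : ∃ ε' : ℝ, 0 < ε' ∧ ENNReal.ofReal ε' ≤ ε := by
      rcases eq_or_ne ε ∞ with rfl | h
      · exact ⟨1, one_pos, le_top⟩
      · exact ⟨ε.toReal, ENNReal.toReal_pos hε.ne' h, (ENNReal.ofReal_toReal h).le⟩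
    obtain ⟨c, hc, huc⟩ := exists_uniform_convexity_const_enorm hp
      (ε := ε' / (4 * (l + 1))) (by positivity)
    -- With this `η` the final bound tends to `(η + c / 2) * 2l - c * l = 2ηl`, which is below `ε'`.
    set η : ℝ := ε' / (4 * (l + 1)) with hη
    have hηpos : 0 < η := by positivity
    have ht : Tendsto (fun n : ℕ => (η + c / 2) * (2 * l + 2 * (1 / ((n : ℝ) + 1))) - c * r n) atTop
        (𝓝 ((η + c / 2) * (2 * l + 2 * 0) - c * l)) :=
      ((((tendsto_one_div_add_atTop_nhds_zero_nat).const_mul 2).const_add (2 * l)).const_mul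
        (η + c / 2)).sub (hl.const_mul c)
    have hlim : (η + c / 2) * (2 * l + 2 * 0) - c * l < ε' := by
      have h3 : η * (4 * (l + 1)) = ε' := by rw [hη]; field_simp
      nlinarith
    obtain ⟨N, hN⟩ := eventually_atTop.1 (ht.eventually_lt_const hlim)
    have main : ∀ n ≥ N, ∀ m ≥ n, gPow Ω s p (y n - y m : LpΩ Ω p) ≤ ENNReal.ofReal ε' := by
      intro n hn m hm
      have h1 := gPow_uniform_convexity (s := s) huc (y n) (y m)
      -- The midpoint stays in `C n`, so its `gPow` cannot drop below the infimum `g n`; uniform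
      -- convexity then forces `y n` and `y m` together.
      have h2 : g n ≤ gPow Ω s p ((1 / 2 : ℝ) • (y n + y m) : LpΩ Ω p) :=
        hgle n _ (hconv n _ (hyC n) _ (hanti hm (hyC m)))
      have hb : ∀ k ≥ n, gPow Ω s p (y k) ≤ ENNReal.ofReal (l + 1 / ((n : ℝ) + 1)) := by
        intro k hk
        refine (hy k).trans ?_
        rw [← hr, ← ENNReal.ofReal_add (hr0 k) (by positivity)]
        refine ENNReal.ofReal_le_ofReal (add_le_add (hrl k) ?_)
        gcongr
      have h3 : gPow Ω s p (y n - y m : LpΩ Ω p) + ENNReal.ofReal (c * r n) ≤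
          ENNReal.ofReal ((η + c / 2) * (2 * l + 2 * (1 / ((n : ℝ) + 1)))) := by
        calc _ ≤ gPow Ω s p (y n - y m : LpΩ Ω p) +
              ENNReal.ofReal c * gPow Ω s p ((1 / 2 : ℝ) • (y n + y m) : LpΩ Ω p) := by
              rw [ENNReal.ofReal_mul hc.le, hr]
              gcongr
          _ ≤ _ := h1
          _ ≤ ENNReal.ofReal (η + c / 2) * (ENNReal.ofReal (l + 1 / ((n : ℝ) + 1)) +
              ENNReal.ofReal (l + 1 / ((n : ℝ) + 1))) := by
              gcongr
              · exact hb n le_rfl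
              · exact hb m hm
          _ = _ := by
              rw [← ENNReal.ofReal_add (by positivity) (by positivity),
                ← ENNReal.ofReal_mul (by positivity)]
              congr 1
              ring
      have h4 := hN n hn
      rw [sub_lt_iff_lt_add] at h4
      have h5 := h3.trans (ENNReal.ofReal_le_ofReal h4.le)
      rw [ENNReal.ofReal_add hε'.le (by have := hr0 n; positivity)] at h5
      exact (ENNReal.add_le_add_iff_right ENNReal.ofReal_ne_top).1 h5
    refine ⟨N, fun n hn m hm => le_trans ?_ hεε'⟩
    rcases le_total n m with hnm | hnm
    · exact main n hn m hnm
    · have : gPow Ω s p (y n - y m : LpΩ Ω p) = gPow Ω s p (y m - y n : LpΩ Ω p) :=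
        gPow_sub_comm _ _
      rw [this]
      exact main m hm n hnm)
  exact ⟨y, u, hyC, hu⟩

end HetLoc

/-! ### Distance to the boundary and flat charts -/

namespace HetLoc
open Filter Topology

section Distance

variable {d : ℕ} {Ω : Set (E d)}

/-- A point of the complement nearest to a point of `Ω` can be found on the frontier. -/
lemma bdist_le_dist {x z : E d} (hx : x ∈ Ω) (hz : z ∉ Ω) : bdist Ω x ≤ dist x z := by
  obtain ⟨y, hy, hxy⟩ := exists_mem_frontier_infDist_compl_eq_dist hx
    (fun h => hz (h ▸ mem_univ z))
  calc bdist Ω x ≤ dist x y := Metric.infDist_le_dist_of_mem hy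
    _ = Metric.infDist x Ωᶜ := hxy.symm
    _ ≤ dist x z := Metric.infDist_le_dist_of_mem hz

lemma mem_of_dist_lt_bdist {x z : E d} (hx : x ∈ Ω) (hz : dist z x < bdist Ω x) : z ∈ Ω := by
  by_contra h
  have := bdist_le_dist hx h
  rw [dist_comm] at this
  linarith

/-- Nonemptiness of the frontier matters: `Metric.infDist` to the empty set is `0`. -/
lemma le_bdist (hΩ : IsOpen Ω) (hne : (frontier Ω).Nonempty) {x : E d} {ρ : ℝ}
    (h : ∀ z, dist x z < ρ → z ∈ Ω) : ρ ≤ bdist Ω x := by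
  refine (Metric.le_infDist hne).2 fun y hy => ?_
  by_contra! hlt
  exact (hΩ.frontier_eq ▸ hy : y ∈ closure Ω \ Ω).2 (h y hlt)

lemma bdist_pos (hΩ : IsOpen Ω) (hne : (frontier Ω).Nonempty) {x : E d} (hx : x ∈ Ω) :
    0 < bdist Ω x := by
  obtain ⟨ρ, hρ, h⟩ := Metric.isOpen_iff.1 hΩ x hx
  exact hρ.trans_le (le_bdist hΩ hne fun z hz => h (by rwa [Metric.mem_ball, dist_comm]))

lemma bdist_le_add_dist (x y : E d) : bdist Ω x ≤ bdist Ω y + dist x y :=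
  Metric.infDist_le_infDist_add_dist

end Distance

/-- `Ψ` is a measure preserving bi-Lipschitz chart which, in the ball of radius `R` about the
preimage of `b`, straightens `Ω` to the half-space of points with positive `k`-th coordinate. -/
structure IsFlatChart {d : ℕ} (Ω : Set (E d)) (b : E d) (Ψ : E d ≃ₜ E d) (k : Fin d) (L : ℝ≥0)
    (R : ℝ) : Prop where
  pos : 0 < R
  one_le : 1 ≤ L
  lip : LipschitzWith L Ψ
  lip_symm : LipschitzWith L Ψ.symm
  preserving : MeasurePreserving Ψ volume volume
  mem_iff : ∀ x, dist x (Ψ.symm b) < R → (Ψ x ∈ Ω ↔ 0 < x k)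

/-! ### Measure-preserving flattening of a Lipschitz graph. -/

section Shear

variable {d : ℕ} (k : Fin d)

/-- Forget the `k`-th coordinate. -/
noncomputable def dropCoord (x : E d) : EuclideanSpace ℝ {i : Fin d // i ≠ k} :=
  WithLp.toLp 2 fun i => x i.1

/-- The shear `x ↦ x + ζ(x') e_k`. -/
noncomputable def shear (ζ : EuclideanSpace ℝ {i : Fin d // i ≠ k} → ℝ) (x : E d) : E d :=
  x + EuclideanSpace.single k (ζ (dropCoord k x))

lemma dropCoord_add_single (x : E d) (c : ℝ) :
    dropCoord k (x + EuclideanSpace.single k c) = dropCoord k x := by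
  ext i
  simp [dropCoord, i.2]

lemma lipschitzWith_dropCoord : LipschitzWith 1 (dropCoord k) := by
  refine LipschitzWith.of_dist_le_mul fun x y => ?_
  rw [NNReal.coe_one, one_mul, EuclideanSpace.dist_eq, EuclideanSpace.dist_eq]
  refine Real.sqrt_le_sqrt ?_
  have := Fintype.sum_subtype_add_sum_subtype (fun i => i ≠ k) fun i => dist (x i) (y i) ^ 2
  rw [← this]
  have h0 : 0 ≤ ∑ i : {i // ¬ i ≠ k}, dist (x i) (y i) ^ 2 := by positivity
  simpa [dropCoord] using h0

lemma lipschitzWith_shear {ζ : EuclideanSpace ℝ {i : Fin d // i ≠ k} → ℝ} {L : ℝ≥0}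
    (hζ : LipschitzWith L ζ) : LipschitzWith (1 + L) (shear k ζ) := by
  refine LipschitzWith.id.add ?_
  refine LipschitzWith.of_dist_le_mul fun x y => ?_
  rw [PiLp.dist_single_same]
  have h1 := hζ.dist_le_mul (dropCoord k x) (dropCoord k y)
  have h2 := (lipschitzWith_dropCoord k).dist_le_mul x y
  rw [NNReal.coe_one, one_mul] at h2
  exact h1.trans (by gcongr)

/-- The shear as a homeomorphism. -/
noncomputable def shearHomeo (ζ : EuclideanSpace ℝ {i : Fin d // i ≠ k} → ℝ) {L : ℝ≥0}
    (hζ : LipschitzWith L ζ) : E d ≃ₜ E d where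
  toFun := shear k ζ
  invFun := shear k (-ζ)
  left_inv x := by
    rw [shear, shear, dropCoord_add_single, add_assoc]
    ext i
    by_cases h : i = k <;> simp [h]
  right_inv x := by
    rw [shear, shear, dropCoord_add_single, add_assoc]
    ext i
    by_cases h : i = k <;> simp [h]
  continuous_toFun := (lipschitzWith_shear k hζ).continuous
  continuous_invFun := (lipschitzWith_shear k hζ.neg).continuous

/-- After splitting off the `k`-th coordinate, the shear is a translation in each fibre, so Fubini
applies. -/
lemma measurePreserving_shear {ζ : EuclideanSpace ℝ {i : Fin d // i ≠ k} → ℝ}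
    (hζ : Continuous ζ) : MeasurePreserving (shear k ζ) volume volume := by
  have e1 := EuclideanSpace.volume_preserving_symm_measurableEquiv_toLp (Fin d)
  have e2 := volume_preserving_piEquivPiSubtypeProd (fun _ : Fin d => ℝ) (fun i => i ≠ k)
  have e := e2.comp e1
  have hs : MeasurePreserving
      (fun q : ({i : Fin d // i ≠ k} → ℝ) × ({i : Fin d // ¬ i ≠ k} → ℝ) =>
        (q.1, q.2 + fun _ => ζ (WithLp.toLp 2 q.1))) (volume.prod volume) (volume.prod volume) := by
    refine MeasurePreserving.skew_product
      (g := fun a (c : {i : Fin d // ¬ i ≠ k} → ℝ) => c + fun _ => ζ (WithLp.toLp 2 a))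
      (MeasurePreserving.id _) ?_ ?_
    · refine Continuous.measurable ?_
      refine continuous_snd.add (continuous_pi fun _ => hζ.comp ?_)
      exact (PiLp.continuous_toLp 2 _).comp continuous_fst
    · exact Eventually.of_forall fun a => map_add_right_eq_self _ _
  have e' : MeasurePreserving ((MeasurableEquiv.toLp 2 (Fin d → ℝ)).symm.trans
      (MeasurableEquiv.piEquivPiSubtypeProd (fun _ : Fin d => ℝ) (fun i => i ≠ k)))
      volume (volume.prod volume) := e
  have := (e'.symm _).comp (hs.comp e')
  convert this using 1
  ext x i
  by_cases h : i = k
  · subst h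
    simp [shear, dropCoord, MeasurableEquiv.piEquivPiSubtypeProd, Equiv.piEquivPiSubtypeProd]
  · simp [shear, h, MeasurableEquiv.piEquivPiSubtypeProd, Equiv.piEquivPiSubtypeProd]

end Shear

lemma measurePreserving_affineIsometryEquiv {d : ℕ} (T : E d ≃ᵃⁱ[ℝ] E d) :
    MeasurePreserving T volume volume := by
  have h1 : MeasurePreserving T.linearIsometryEquiv volume volume :=
    T.linearIsometryEquiv.measurePreserving
  have := (measurePreserving_add_right volume (T 0)).comp h1
  convert this using 1
  ext1 x
  have := T.map_vadd 0 x
  simpa using this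

/-- The chart is a shear followed by a rigid motion. Both preserve volume, so no Jacobian of the
chart appears in later changes of variables. -/
lemma exists_flatChart {d : ℕ} {Ω : Set (E d)} (hΩ : IsLipschitzDomain Ω) {b : E d}
    (hb : b ∈ frontier Ω) :
    ∃ (Ψ : E d ≃ₜ E d) (k : Fin d) (L : ℝ≥0) (R : ℝ), IsFlatChart Ω b Ψ k L R := by
  obtain ⟨-, -, N, O, D, hO, hcov, hD, hΩD⟩ := hΩ
  obtain ⟨j, hj⟩ := mem_iUnion.1 (hcov hb)
  obtain ⟨T, k, L, ζ, hζ, hDj⟩ := hD j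
  set Ψ : E d ≃ₜ E d := (shearHomeo k ζ hζ).trans T.toHomeomorph with hΨ
  have hΨapp : ∀ x, Ψ x = T (shear k ζ x) := fun _ => rfl
  have hΨs : ∀ x, Ψ.symm x = shear k (-ζ) (T.symm x) := fun _ => rfl
  have hpre : IsOpen (Ψ ⁻¹' (O j)) := (hO j).1.preimage Ψ.continuous
  obtain ⟨R, hR, hRO⟩ := Metric.isOpen_iff.1 hpre (Ψ.symm b) (by simpa using hj)
  refine ⟨Ψ, k, 1 + L, R, hR, le_self_add, ?_, ?_, ?_, fun x hx => ?_⟩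
  · have := T.lipschitz.comp (lipschitzWith_shear k hζ)
    rwa [one_mul] at this
  · have := (lipschitzWith_shear k hζ.neg).comp T.symm.lipschitz
    rwa [mul_one] at this
  · exact (measurePreserving_affineIsometryEquiv T).comp (measurePreserving_shear k hζ.continuous)
  · have hxO : Ψ x ∈ O j := hRO hx
    have h1 : Ψ x ∈ Ω ↔ Ψ x ∈ D j := by
      have := Set.ext_iff.1 (hΩD j) (Ψ x)
      simpa [hxO] using this
    rw [h1, hDj, hΨapp, T.injective.mem_set_image]
    change ζ (dropCoord k (shear k ζ x)) < shear k ζ x k ↔ _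
    rw [shear, dropCoord_add_single]
    simp

/-! ### Comparison of the height in a chart with the distance to the boundary. -/

section FlatChart

variable {d : ℕ} {Ω : Set (E d)} {b : E d} {Ψ : E d ≃ₜ E d} {k : Fin d} {L : ℝ≥0} {R : ℝ}

lemma abs_coord_sub_le (x y : E d) (k : Fin d) : |x k - y k| ≤ dist x y := by
  rw [dist_eq_norm]
  exact PiLp.norm_apply_le (x - y) k

namespace IsFlatChart

variable (h : IsFlatChart Ω b Ψ k L R)
include h

/-- The boundary point `b` is not in the open set `Ω`, so its preimage has nonpositive height. -/
lemma coord_le (hΩ : IsOpen Ω) (hb : b ∈ frontier Ω) (x : E d) :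
    x k ≤ dist x (Ψ.symm b) := by
  have h0 : (Ψ.symm b) k ≤ 0 := by
    by_contra! hlt
    have := (h.mem_iff (Ψ.symm b) (by simpa using h.pos)).2 hlt
    rw [Ψ.apply_symm_apply] at this
    exact (hΩ.frontier_eq ▸ hb : b ∈ closure Ω \ Ω).2 this
  have := (abs_le.1 (abs_coord_sub_le x (Ψ.symm b) k)).2
  linarith

lemma L_pos : 0 < (L : ℝ) := lt_of_lt_of_le one_pos (by exact_mod_cast h.one_le)

lemma dist_le_mul_dist (x y : E d) : dist x y ≤ L * dist (Ψ x) (Ψ y) := by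
  simpa using h.lip_symm.dist_le_mul (Ψ x) (Ψ y)

/-- A point within `y k / L` of `Ψ y` pulls back to within `y k` of `y`, hence to positive height
inside the chart, hence lies in `Ω`. -/
lemma coord_le_bdist (hΩ : IsOpen Ω) (hb : b ∈ frontier Ω) {y : E d}
    (hy : 2 * dist y (Ψ.symm b) < R) : y k ≤ L * bdist Ω (Ψ y) := by
  have hL := h.L_pos
  rw [← div_le_iff₀' hL]
  refine le_bdist hΩ ⟨b, hb⟩ fun z hz => ?_
  have h1 : dist y (Ψ.symm z) < y k := by
    have := h.dist_le_mul_dist y (Ψ.symm z)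
    rw [Ψ.apply_symm_apply] at this
    rw [lt_div_iff₀' hL] at hz
    linarith
  have h2 := h.coord_le hΩ hb y
  have h3 : dist (Ψ.symm z) (Ψ.symm b) < R := by
    have := dist_triangle_left (Ψ.symm z) (Ψ.symm b) y
    linarith
  have h4 := (h.mem_iff _ h3).2 (by
    have := (abs_le.1 (abs_coord_sub_le y (Ψ.symm z) k)).2
    linarith)
  rwa [Ψ.apply_symm_apply] at h4

/-- The vertical projection of `y` to height `0` is at distance `y k` and is mapped outside `Ω`. -/
lemma bdist_le_coord (hΩ : IsOpen Ω) (hb : b ∈ frontier Ω) {y : E d} (hy0 : 0 < y k)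
    (hy : 2 * dist y (Ψ.symm b) < R) : bdist Ω (Ψ y) ≤ L * y k := by
  have h2 := h.coord_le hΩ hb y
  have hdist : dist y (y + EuclideanSpace.single k (- y k)) = y k := by
    rw [dist_self_add_right]
    simp [abs_of_pos hy0]
  have hz : Ψ (y + EuclideanSpace.single k (- y k)) ∉ Ω := by
    rw [h.mem_iff]
    · simp
    · have := dist_triangle_left (y + EuclideanSpace.single k (- y k)) (Ψ.symm b) y
      linarith
  refine (bdist_le_dist ((h.mem_iff y ?_).2 hy0) hz).trans ?_
  · have := dist_nonneg (x := y) (y := Ψ.symm b)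
    linarith
  · refine (h.lip.dist_le_mul _ _).trans ?_
    rw [hdist]

end IsFlatChart

end FlatChart

end HetLoc

/-! ### Change of variables and the boundary estimate along chains -/

namespace HetLoc
open Filter Topology

section Sums

/-- A weighted power mean inequality for series. -/
lemma exists_tsum_rpow_le {p : ℝ} (hp : 1 < p) {τ : ℝ≥0∞} (hτ0 : τ ≠ 0) (hτ1 : τ < 1) :
    ∃ K : ℝ≥0∞, K ≠ ∞ ∧ ∀ b : ℕ → ℝ≥0∞, (∑' n, b n) ^ p ≤ K * ∑' n, (τ⁻¹) ^ n * b n ^ p := by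
  have hp0 : 0 < p := by linarith
  have hτt : τ ≠ ∞ := (hτ1.trans ENNReal.one_lt_top).ne
  obtain ⟨q, hpq⟩ : ∃ q, p.HolderConjugate q := ⟨_, Real.HolderConjugate.conjExponent hp⟩
  have hq0 : 0 < q := hpq.symm.pos
  -- Hölder's inequality for `b n = (τ^{-n/p} b n) * τ^{n/p}`; the second factor has a geometric
  -- `q`-sum.
  refine ⟨((∑' n : ℕ, ((τ ^ (1 / p)) ^ n) ^ q) ^ (1 / q)) ^ p, ?_, fun b => ?_⟩
  · refine ENNReal.rpow_ne_top_of_nonneg hp0.le (ENNReal.rpow_ne_top_of_nonneg (by positivity) ?_)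
    have : ∀ n : ℕ, ((τ ^ (1 / p)) ^ n) ^ q = ((τ ^ (1 / p)) ^ q) ^ n := fun n => by
      simp only [← ENNReal.rpow_natCast, ← ENNReal.rpow_mul]
      congr 1
      ring
    simp_rw [this, ENNReal.tsum_geometric]
    rw [ENNReal.inv_ne_top, ne_eq, tsub_eq_zero_iff_le, not_le, ← ENNReal.rpow_mul]
    exact ENNReal.rpow_lt_one hτ1 (by positivity)
  · have hs0 : τ ^ (1 / p) ≠ 0 := (ENNReal.rpow_pos hτ0.bot_lt hτt).ne'
    have hst : τ ^ (1 / p) ≠ ∞ := ENNReal.rpow_ne_top_of_nonneg (by positivity) hτt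
    have hol := ENNReal.lintegral_mul_le_Lp_mul_Lq (Measure.count : Measure ℕ) hpq
      (f := fun n => ((τ ^ (1 / p)) ^ n)⁻¹ * b n) (g := fun n => (τ ^ (1 / p)) ^ n)
      (measurable_of_countable _).aemeasurable (measurable_of_countable _).aemeasurable
    simp only [lintegral_count, Pi.mul_apply] at hol
    have e1 : ∀ n : ℕ, ((τ ^ (1 / p)) ^ n)⁻¹ * b n * (τ ^ (1 / p)) ^ n = b n := fun n => by
      rw [mul_right_comm, ENNReal.inv_mul_cancel (pow_ne_zero _ hs0) (ENNReal.pow_ne_top hst),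
        one_mul]
    have e2 : ∀ n : ℕ, (((τ ^ (1 / p)) ^ n)⁻¹ * b n) ^ p = (τ⁻¹) ^ n * b n ^ p := fun n => by
      rw [ENNReal.mul_rpow_of_nonneg _ _ hp0.le, ENNReal.inv_rpow, ← ENNReal.rpow_natCast,
        ← ENNReal.rpow_mul, ← ENNReal.rpow_mul, ← ENNReal.inv_pow, ← ENNReal.rpow_natCast]
      congr 3
      field_simp
    simp_rw [e1, e2] at hol
    calc (∑' n, b n) ^ p ≤ _ := ENNReal.rpow_le_rpow hol hp0.le
      _ = _ := by
        rw [ENNReal.mul_rpow_of_nonneg _ _ hp0.le, ← ENNReal.rpow_mul (∑' n, _) (1 / p) p,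
          one_div_mul_cancel hp0.ne', ENNReal.rpow_one, mul_comm]

lemma enorm_le_tsum_of_tendsto_zero {a : ℕ → ℝ} (ha : Tendsto a atTop (𝓝 0)) :
    ‖a 0‖ₑ ≤ ∑' n, ‖a n - a (n + 1)‖ₑ := by
  have h : ∀ N, ‖a 0 - a N‖ₑ ≤ ∑' n, ‖a n - a (n + 1)‖ₑ := fun N => by
    refine le_trans ?_ (ENNReal.sum_le_tsum (Finset.range N))
    rw [← Finset.sum_range_sub']
    exact enorm_sum_le _ _
  have ht : Tendsto (fun N => ‖a 0 - a N‖ₑ) atTop (𝓝 ‖a 0 - 0‖ₑ) :=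
    (tendsto_const_nhds.sub ha).enorm
  rw [sub_zero] at ht
  exact le_of_tendsto' ht h

end Sums

section ChangeOfVariables

variable {d : ℕ}

/-- The substitution is a rank-one perturbation of the identity, with determinant `1 + c * ω k`. -/
lemma lintegral_comp_add_coord_smul (k : Fin d) (ω : E d) (c : ℝ) (hc : 0 < 1 + c * ω k)
    {f : E d → ℝ≥0∞} (hf : Measurable f) :
    ∫⁻ x, f (x + (c * x k) • ω) = ENNReal.ofReal (1 + c * ω k)⁻¹ * ∫⁻ x, f x := by
  set A : E d →ₗ[ℝ] E d := LinearMap.transvection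
    ((EuclideanSpace.proj k : E d →L[ℝ] ℝ) : E d →ₗ[ℝ] ℝ) (c • ω) with hA
  have hAx : ∀ x, A x = x + (c * x k) • ω := fun x => by
    simp [hA, LinearMap.transvection.apply, smul_smul, mul_comm]
  have hdet : LinearMap.det A = 1 + c * ω k := by
    rw [hA, LinearMap.transvection.det]
    simp
  have hmap := Measure.map_linearMap_addHaar_eq_smul_addHaar (volume : Measure (E d))
    (f := A) (by rw [hdet]; exact hc.ne')
  have hAm : Measurable A := A.continuous_of_finiteDimensional.measurable
  calc ∫⁻ x, f (x + (c * x k) • ω) = ∫⁻ x, f (A x) := by simp_rw [hAx]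
    _ = ∫⁻ y, f y ∂(volume.map A) := (lintegral_map hf hAm).symm
    _ = _ := by
      rw [hmap, lintegral_smul_measure, hdet, abs_of_pos (inv_pos.2 hc), smul_eq_mul]

lemma lintegral_comp_add_smul (y : E d) {t : ℝ} (ht : 0 < t) {f : E d → ℝ≥0∞}
    (hf : Measurable f) :
    ∫⁻ ω, f (y + t • ω) = (ENNReal.ofReal t ^ (d : ℝ))⁻¹ * ∫⁻ z, f z := by
  have h1 : ∫⁻ ω, f (y + t • ω) = ∫⁻ z, f (y + z) ∂(volume.map (t • · : E d → E d)) :=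
    (lintegral_map (hf.comp (measurable_const_add y)) (measurable_const_smul t)).symm
  rw [h1, Measure.map_addHaar_smul _ ht.ne', lintegral_smul_measure,
    lintegral_add_left_eq_self f y, finrank_euclideanSpace_fin, smul_eq_mul,
    abs_of_pos (by positivity), ENNReal.ofReal_inv_of_pos (by positivity),
    ENNReal.ofReal_pow ht.le, ENNReal.rpow_natCast]

lemma lintegral_lintegral_comp_measurePreserving {Ψ : E d ≃ₜ E d}
    (h : MeasurePreserving Ψ volume volume) (g : E d → E d → ℝ≥0∞) :
    ∫⁻ x, ∫⁻ y, g (Ψ x) (Ψ y) = ∫⁻ x, ∫⁻ y, g x y := by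
  have he : MeasurableEmbedding Ψ := Ψ.measurableEmbedding
  have h1 : ∀ x, ∫⁻ y, g (Ψ x) (Ψ y) = ∫⁻ y, g (Ψ x) y := fun x =>
    h.lintegral_comp_emb he _
  simp_rw [h1]
  exact h.lintegral_comp_emb he (fun x => ∫⁻ y, g x y)

end ChangeOfVariables

section Kernel

variable {d : ℕ} {Ω : Set (E d)} {s p : ℝ}

/-- The integrand of `semiPow`, extended by zero. -/
noncomputable def pairDensity (Ω : Set (E d)) (s p : ℝ) (u : E d → ℝ) (x y : E d) : ℝ≥0∞ :=
  {z : E d × E d | z.1 ∈ Ω ∧ dist z.2 z.1 < bdist Ω z.1}.indicator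
    (fun z => ‖u z.2 - u z.1‖ₑ ^ p / ENNReal.ofReal (bdist Ω z.1) ^ ((d : ℝ) + p * s)) (x, y)

lemma semiPow_eq_pairDensity (hΩ : IsOpen Ω) (u : E d → ℝ) :
    semiPow Ω s p u = ∫⁻ x, ∫⁻ y, pairDensity Ω s p u x y := by
  unfold semiPow
  rw [← lintegral_indicator hΩ.measurableSet]
  refine lintegral_congr fun x => ?_
  by_cases hx : x ∈ Ω
  · rw [indicator_of_mem hx, ← lintegral_indicator (hΩ.measurableSet.inter measurableSet_ball)]
    refine lintegral_congr fun y => ?_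
    unfold pairDensity
    simp only [indicator, mem_inter_iff, Metric.mem_ball, mem_ofPred_eq, hx, true_and]
    by_cases hy : dist y x < bdist Ω x
    · simp [hy, mem_of_dist_lt_bdist hx hy]
    · simp [hy]
  · rw [indicator_of_notMem hx]
    simp [pairDensity, hx]

lemma measurable_pairDensity (hΩ : IsOpen Ω) {u : E d → ℝ} (hu : Measurable u) :
    Measurable (Function.uncurry (pairDensity Ω s p u)) := by
  refine Measurable.indicator ?_ ((measurable_fst hΩ.measurableSet).inter (measurableSet_pairs Ω))
  refine Measurable.div ?_ ?_
  · exact ((hu.comp measurable_snd).sub (hu.comp measurable_fst)).enorm.pow_const p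
  · exact ((measurable_bdist Ω).comp measurable_fst).ennreal_ofReal.pow_const _

end Kernel

section BoundaryEstimate

variable {d : ℕ} {Ω : Set (E d)} {s p : ℝ}

/-- The chain argument along one direction `ω` in a half-space: the `L^p` norm of a function
vanishing on the boundary is controlled by the increments `u (y + y_k ω) - u y`. -/
lemma exists_chain_bound (k : Fin d) {θ₀ : ℝ} (h0 : 0 < θ₀) (h1 : θ₀ < 1) (hp : 1 < p)
    (hps : 1 < p * s) (a : E d) {ρ : ℝ} (hρ : 0 < ρ) :
    ∃ C : ℝ≥0∞, C ≠ ∞ ∧ ∀ ω : E d, -1 < ω k → 1 + ω k ≤ θ₀ → ‖ω‖ ≤ -3 * ω k →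
      ∀ u : E d → ℝ, Continuous u →
        (∀ x, dist x a < 4 * ρ → x k = 0 → u x = 0) →
        ∫⁻ x in {x | dist x a < ρ ∧ 0 < x k ∧ x k ≤ ρ}, ‖u x‖ₑ ^ p ≤
          C * ∫⁻ y in {y | dist y a < 4 * ρ ∧ 0 < y k},
            ‖u (y + y k • ω) - u y‖ₑ ^ p / ENNReal.ofReal (y k) ^ (p * s) := by
  have hp0 : 0 < p := by linarith
  -- The `n`-th link decays like `θ₀ ^ (n (ps - 1))`. Half of this decay pays for the weight
  -- `τ^{-n}` in the power mean inequality, the other half makes the series converge.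
  set τ : ℝ := θ₀ ^ ((p * s - 1) / 2) with hτ
  have hτ0 : 0 < τ := Real.rpow_pos_of_pos h0 _
  have hτ1 : τ < 1 := Real.rpow_lt_one h0.le h1 (by linarith)
  obtain ⟨K, hK, hKb⟩ := exists_tsum_rpow_le hp (τ := ENNReal.ofReal τ) (by simpa using hτ0)
    (by rw [← ENNReal.ofReal_one]; exact (ENNReal.ofReal_lt_ofReal_iff one_pos).2 hτ1)
  refine ⟨K * (ENNReal.ofReal (ρ ^ (p * s)) * (1 - ENNReal.ofReal τ)⁻¹), ?_, ?_⟩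
  · refine ENNReal.mul_ne_top hK (ENNReal.mul_ne_top ENNReal.ofReal_ne_top ?_)
    rw [ENNReal.inv_ne_top, ne_eq, tsub_eq_zero_iff_le, not_le, ← ENNReal.ofReal_one]
    exact (ENNReal.ofReal_lt_ofReal_iff one_pos).2 hτ1
  intro ω hω1 hω0 hωn u hu hu0
  set θ : ℝ := 1 + ω k with hθ
  have hθ0 : 0 < θ := by linarith
  have hθ1 : θ < 1 := by linarith
  have hωk : ω k = -(1 - θ) := by rw [hθ]; ring
  -- `c n` is the sum of `θ ^ j` over `j < n`, so `S n` is the `n`-th iterate of `x ↦ x + x k • ω`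
  -- and multiplies the height by `θ ^ n`.
  set c : ℕ → ℝ := fun n => (1 - θ ^ n) / (1 - θ) with hc
  have hc1 : ∀ n, c n * (1 - θ) = 1 - θ ^ n := fun n => div_mul_cancel₀ _ (by linarith)
  have hpw : ∀ n, θ ^ n ≤ 1 := fun n => pow_le_one₀ hθ0.le hθ1.le
  have hpw0 : ∀ n, 0 < θ ^ n := fun n => pow_pos hθ0 n
  have hcn : ∀ n, 0 ≤ c n := fun n => div_nonneg (by linarith [hpw n]) (by linarith)
  set S : ℕ → E d → E d := fun n x => x + (c n * x k) • ω with hS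
  have hSk : ∀ n x, S n x k = θ ^ n * x k := fun n x => by
    have := hc1 n
    simp only [hS, PiLp.add_apply, PiLp.smul_apply, smul_eq_mul, hωk]
    linear_combination (-(x k)) * this
  have hSS : ∀ n x, S n x + (S n x k) • ω = S (n + 1) x := fun n x => by
    rw [hSk]
    simp only [hS, add_assoc, ← add_smul]
    congr 2
    have h3 : c (n + 1) = c n + θ ^ n := by
      have : (1 - θ) ≠ 0 := by linarith
      simp only [hc]
      field_simp
      ring
    rw [h3]; ring
  set D : E d → ℝ≥0∞ := fun y => ‖u (y + y k • ω) - u y‖ₑ ^ p with hD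
  set Q : Set (E d) := {y | dist y a < 4 * ρ ∧ 0 < y k} with hQ
  have hck : Continuous fun y : E d => y k := (EuclideanSpace.proj k).continuous
  have hQm : MeasurableSet Q :=
    (isOpen_lt (continuous_id.dist continuous_const) continuous_const).measurableSet.inter
      (isOpen_lt continuous_const hck).measurableSet
  set P : Set (E d) := {x | dist x a < ρ ∧ 0 < x k ∧ x k ≤ ρ} with hP
  have hPm : MeasurableSet P :=
    (isOpen_lt (continuous_id.dist continuous_const) continuous_const).measurableSet.inter
      ((isOpen_lt continuous_const hck).measurableSet.inter
        (isClosed_le hck continuous_const).measurableSet)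
  have hDm : Measurable D := by
    have : Continuous fun y : E d => u (y + y k • ω) - u y :=
      (hu.comp (continuous_id.add (hck.smul continuous_const))).sub hu
    exact this.measurable.enorm.pow_const p
  set g : E d → ℝ≥0∞ := Q.indicator fun y => D y / ENNReal.ofReal (y k) ^ (p * s) with hg
  have hgm : Measurable g :=
    (hDm.div (hck.measurable.ennreal_ofReal.pow_const _)).indicator hQm
  -- Since `‖ω‖ ≤ 3 (1 - θ)`, the whole chain, including its limit at `t = 1 / (1 - θ)`, stays
  -- within `3ρ` of its start.
  have hdist : ∀ x ∈ P, ∀ t, 0 ≤ t → t * (1 - θ) ≤ 1 → dist (x + (t * x k) • ω) a < 4 * ρ := by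
    rintro x ⟨hxa, hx0, hxρ⟩ t ht0 ht1
    have h5 : dist (x + (t * x k) • ω) x ≤ 3 * ρ := by
      rw [dist_self_add_left, norm_smul, Real.norm_eq_abs, abs_of_nonneg (by positivity)]
      calc t * x k * ‖ω‖ ≤ t * x k * (3 * (1 - θ)) := by
            gcongr
            rw [hωk] at hωn
            linarith
        _ = 3 * (t * (1 - θ)) * x k := by ring
        _ ≤ 3 * 1 * ρ := by gcongr
        _ = _ := by ring
    have := dist_triangle (x + (t * x k) • ω) x a
    linarith
  have hSP : ∀ n, ∀ x ∈ P, S n x ∈ Q := fun n x hx =>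
    ⟨hdist x hx (c n) (hcn n) (by rw [hc1]; linarith [hpw0 n]), by
      rw [hSk]; exact mul_pos (hpw0 n) hx.2.1⟩
  have hpoint : ∀ x ∈ P, ‖u x‖ₑ ^ p ≤ K * ∑' n, (ENNReal.ofReal τ)⁻¹ ^ n * D (S n x) := by
    intro x hx
    have hθt : Tendsto (fun n => θ ^ n) atTop (𝓝 0) :=
      tendsto_pow_atTop_nhds_zero_of_lt_one hθ0.le hθ1
    have hct : Tendsto c atTop (𝓝 (1 / (1 - θ))) := by
      have := (hθt.const_sub 1).div_const (1 - θ)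
      simpa using this
    have hxt : Tendsto (fun n => S n x) atTop (𝓝 (x + (1 / (1 - θ) * x k) • ω)) :=
      ((hct.mul_const _).smul_const ω).const_add x
    -- The chain ends at height `0`, where `u` vanishes; hence `u x` is the telescoping sum of the
    -- increments.
    have hlim : u (x + (1 / (1 - θ) * x k) • ω) = 0 := by
      have hne : (1 - θ) ≠ 0 := by linarith
      refine hu0 _ (hdist x hx _ (by have : 0 < 1 - θ := by linarith
                                     positivity) ?_) ?_
      · rw [one_div_mul_cancel hne]
      · simp only [PiLp.add_apply, PiLp.smul_apply, smul_eq_mul, hωk]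
        field_simp
        ring
    have hut : Tendsto (fun n => u (S n x)) atTop (𝓝 0) := by
      rw [← hlim]
      exact (hu.tendsto _).comp hxt
    have h6 := enorm_le_tsum_of_tendsto_zero hut
    have hS0 : S 0 x = x := by simp [hS, hc]
    rw [hS0] at h6
    refine (ENNReal.rpow_le_rpow h6 hp0.le).trans ((hKb _).trans ?_)
    gcongr with n
    simp only [hD]
    rw [hSS, ← enorm_neg, neg_sub]
  -- The weight gives `(θ ^ n * ρ) ^ (p * s)` and the change of variables `θ ^ (-n)`; their product
  -- decays because `ps > 1`.
  have hterm : ∀ n, ∫⁻ x in P, D (S n x) ≤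
      ENNReal.ofReal (ρ ^ (p * s)) * ENNReal.ofReal ((θ₀ ^ (p * s - 1)) ^ n) * ∫⁻ y, g y := by
    intro n
    have hdet : 1 + c n * ω k = θ ^ n := by
      rw [hωk]; linear_combination (-1 : ℝ) * hc1 n
    have h7 : ∀ x ∈ P, D (S n x) ≤ ENNReal.ofReal ((θ ^ n * ρ) ^ (p * s)) * g (S n x) := by
      intro x hx
      have hy0 : 0 < S n x k := (hSP n x hx).2
      rw [hg, indicator_of_mem (hSP n x hx), ENNReal.ofReal_rpow_of_pos hy0,
        ENNReal.div_eq_inv_mul, ← mul_assoc]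
      refine le_mul_of_one_le_left' ?_
      rw [← div_eq_mul_inv, ← ENNReal.ofReal_div_of_pos (Real.rpow_pos_of_pos hy0 _),
        ENNReal.one_le_ofReal, one_le_div (Real.rpow_pos_of_pos hy0 _)]
      refine Real.rpow_le_rpow hy0.le ?_ (by linarith)
      rw [hSk]
      exact mul_le_mul_of_nonneg_left hx.2.2 (hpw0 n).le
    calc ∫⁻ x in P, D (S n x)
        ≤ ∫⁻ x in P, ENNReal.ofReal ((θ ^ n * ρ) ^ (p * s)) * g (S n x) :=
          setLIntegral_mono' hPm h7
      _ ≤ ∫⁻ x, ENNReal.ofReal ((θ ^ n * ρ) ^ (p * s)) * g (S n x) :=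
          lintegral_mono' Measure.restrict_le_self le_rfl
      _ = ENNReal.ofReal ((θ ^ n * ρ) ^ (p * s)) *
            (ENNReal.ofReal (θ ^ n)⁻¹ * ∫⁻ y, g y) := by
          rw [lintegral_const_mul' _ _ ENNReal.ofReal_ne_top,
            lintegral_comp_add_coord_smul k ω (c n) (by rw [hdet]; exact hpw0 n) hgm, hdet]
      _ = ENNReal.ofReal ((θ ^ n * ρ) ^ (p * s) * (θ ^ n)⁻¹) * ∫⁻ y, g y := by
          rw [ENNReal.ofReal_mul (by have := hpw0 n; positivity), mul_assoc]
      _ ≤ _ := by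
          rw [← ENNReal.ofReal_mul (by positivity)]
          refine mul_le_mul' (ENNReal.ofReal_le_ofReal ?_) le_rfl
          rw [Real.mul_rpow (hpw0 n).le hρ.le, ← Real.rpow_natCast θ n, ← Real.rpow_mul hθ0.le,
            ← Real.rpow_neg hθ0.le, mul_right_comm, ← Real.rpow_add hθ0, mul_comm]
          gcongr
          rw [← Real.rpow_natCast _ n, ← Real.rpow_mul h0.le,
            show (n : ℝ) * (p * s) + -(n : ℝ) = (p * s - 1) * n by ring]
          exact Real.rpow_le_rpow hθ0.le hω0 (mul_nonneg (by linarith) (Nat.cast_nonneg n))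
  calc ∫⁻ x in P, ‖u x‖ₑ ^ p
      ≤ ∫⁻ x in P, K * ∑' n, (ENNReal.ofReal τ)⁻¹ ^ n * D (S n x) :=
        setLIntegral_mono' hPm hpoint
    _ = K * ∑' n, (ENNReal.ofReal τ)⁻¹ ^ n * ∫⁻ x in P, D (S n x) := by
        have hSm : ∀ n, Measurable fun x => D (S n x) := fun n => by
          refine hDm.comp (Continuous.measurable ?_)
          exact continuous_id.add ((continuous_const.mul hck).smul continuous_const)
        rw [lintegral_const_mul' _ _ hK, lintegral_tsum fun n => ((hSm n).const_mul _).aemeasurable]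
        congr 2
        ext n
        rw [lintegral_const_mul _ (hSm n)]
    _ ≤ K * ∑' n : ℕ, (ENNReal.ofReal (ρ ^ (p * s)) * (∫⁻ y, g y)) * ENNReal.ofReal τ ^ n := by
        refine mul_le_mul' le_rfl (ENNReal.tsum_le_tsum fun n => ?_)
        refine (mul_le_mul' le_rfl (hterm n)).trans_eq ?_
        have h8 : ENNReal.ofReal ((θ₀ ^ (p * s - 1)) ^ n) =
            ENNReal.ofReal τ ^ n * ENNReal.ofReal τ ^ n := by
          rw [← mul_pow, ← ENNReal.ofReal_mul hτ0.le, ← ENNReal.ofReal_pow (by positivity), hτ,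
            ← Real.rpow_add h0]
          ring_nf
        have h9 : (ENNReal.ofReal τ)⁻¹ ^ n * ENNReal.ofReal τ ^ n = 1 := by
          rw [← mul_pow, ENNReal.inv_mul_cancel (by simpa using hτ0) ENNReal.ofReal_ne_top, one_pow]
        rw [h8]
        calc _ = ((ENNReal.ofReal τ)⁻¹ ^ n * ENNReal.ofReal τ ^ n) *
              (ENNReal.ofReal (ρ ^ (p * s)) * (∫⁻ y, g y) * ENNReal.ofReal τ ^ n) := by ring
          _ = _ := by rw [h9, one_mul]
    _ = _ := by
        rw [ENNReal.tsum_mul_left, ENNReal.tsum_geometric, hg, lintegral_indicator hQm]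
        ring

end BoundaryEstimate

end HetLoc

/-! ### Boundary estimates in charts -/

namespace HetLoc
open Filter Topology

variable {d : ℕ} {Ω : Set (E d)} {s p : ℝ}

/-- Here `t` will be the height and `δ` the distance to the boundary, with `a = d` and `b = ps`. The
factor `t ^ a` cancels against the scaling `ω ↦ y + t • ω`. -/
lemma div_rpow_le_of_le {N δ t l : ℝ≥0∞} {a b : ℝ} (hab : 0 ≤ a + b) (ht0 : t ≠ 0) (ht : t ≠ ∞)
    (hl0 : l ≠ 0) (hl : l ≠ ∞) (h : δ ≤ l * t) :
    N / t ^ b ≤ l ^ (a + b) * t ^ a * (N / δ ^ (a + b)) := by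
  have h1 : N / (l * t) ^ (a + b) ≤ N / δ ^ (a + b) :=
    ENNReal.div_le_div_left (ENNReal.rpow_le_rpow h hab) _
  refine le_trans (le_of_eq ?_) (mul_le_mul' le_rfl h1)
  have hla0 : l ^ (a + b) ≠ 0 := (ENNReal.rpow_pos hl0.bot_lt hl).ne'
  have hla : l ^ (a + b) ≠ ∞ := ENNReal.rpow_ne_top_of_nonneg hab hl
  have hta : t ^ a * (t ^ (a + b))⁻¹ = (t ^ b)⁻¹ := by
    rw [← ENNReal.rpow_neg, ← ENNReal.rpow_neg, ← ENNReal.rpow_add _ _ ht0 ht]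
    congr 1
    ring
  rw [ENNReal.mul_rpow_of_nonneg _ _ hab, div_eq_mul_inv, div_eq_mul_inv,
    ENNReal.mul_inv (Or.inl hla0) (Or.inl hla), ← hta]
  calc _ = (l ^ (a + b) * (l ^ (a + b))⁻¹) * (N * (t ^ a * (t ^ (a + b))⁻¹)) := by
        rw [ENNReal.mul_inv_cancel hla0 hla, one_mul]
    _ = _ := by ring

/-- Near a boundary point the `L^p` norm of a function vanishing outside `Ω` is controlled by its
seminorm. -/
lemma exists_boundary_bound (hΩ : IsOpen Ω) {b : E d} (hb : b ∈ frontier Ω) {Ψ : E d ≃ₜ E d}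
    {k : Fin d} {L : ℝ≥0} {R : ℝ} (h : IsFlatChart Ω b Ψ k L R) (hp : 1 < p) (hps : 1 < p * s) :
    ∃ U : Set (E d), IsOpen U ∧ b ∈ U ∧ ∃ C : ℝ≥0∞, C ≠ ∞ ∧ ∀ v : E d → ℝ, Continuous v →
      (∀ x, x ∉ Ω → v x = 0) → ∫⁻ x in Ω ∩ U, ‖v x‖ₑ ^ p ≤ C * semiPow Ω s p v := by
  have hR := h.pos
  have hL := h.L_pos
  have hL1 : (1 : ℝ) ≤ L := by exact_mod_cast h.one_le
  set a := Ψ.symm b with ha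
  set ρ : ℝ := R / 10 with hρ
  have hρ0 : 0 < ρ := by positivity
  -- Directions `ω` with `‖ω‖ < 3c/2` satisfy `L² ‖ω‖ < 3/4`, so a link of the chain is mapped into
  -- the ball of radius `δ(Ψ y)` about `Ψ y`, where the seminorm sees it.
  set c : ℝ := 1 / (2 * L ^ 2) with hc
  have hc0 : 0 < c := by positivity
  have hcL : c * L ^ 2 = 1 / 2 := by rw [hc]; field_simp
  have hc1 : c ≤ 1 / 2 := by
    have : (1 : ℝ) ≤ L ^ 2 := one_le_pow₀ hL1
    nlinarith
  obtain ⟨C, hC, hCb⟩ := exists_chain_bound (s := s) k (θ₀ := 1 - c / 2) (by linarith)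
    (by linarith) hp hps a hρ0
  -- An open set of downward directions: here `-3c/2 < ω k < -c/2`, so the contraction factor `1 + ω
  -- k` is positive and at most `1 - c/2`, and `‖ω‖ ≤ -3 * ω k`.
  set B : Set (E d) := Metric.ball (EuclideanSpace.single k (-c)) (c / 2) with hB
  have hBvol0 : volume B ≠ 0 := (Metric.measure_ball_pos volume _ (by positivity)).ne'
  have hBvol : volume B ≠ ∞ := measure_ball_lt_top.ne
  set M : ℝ≥0∞ := ENNReal.ofReal L ^ ((d : ℝ) + p * s) with hM
  have hMt : M ≠ ∞ := ENNReal.rpow_ne_top_of_nonneg (by positivity) ENNReal.ofReal_ne_top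
  have hck : Continuous fun y : E d => y k := (EuclideanSpace.proj k).continuous
  refine ⟨Ψ.symm ⁻¹' Metric.ball a ρ, Metric.isOpen_ball.preimage Ψ.symm.continuous,
    by simpa [ha] using hρ0, (volume B)⁻¹ * (C * M),
    ENNReal.mul_ne_top (ENNReal.inv_ne_top.2 hBvol0) (ENNReal.mul_ne_top hC hMt),
    fun v hv hv0 => ?_⟩
  set u : E d → ℝ := v ∘ Ψ with hu
  have huc : Continuous u := hv.comp Ψ.continuous
  set Q : Set (E d) := {y | dist y a < 4 * ρ ∧ 0 < y k} with hQ
  have hQm : MeasurableSet Q :=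
    (isOpen_lt (continuous_id.dist continuous_const) continuous_const).measurableSet.inter
      (isOpen_lt continuous_const hck).measurableSet
  have hBprop : ∀ ω ∈ B, -1 < ω k ∧ 1 + ω k ≤ 1 - c / 2 ∧ ‖ω‖ ≤ -3 * ω k ∧ ‖ω‖ < 3 * c / 2 := by
    intro ω hω
    have h1 : |ω k - (-c)| < c / 2 := by
      have := abs_coord_sub_le ω (EuclideanSpace.single k (-c)) k
      rw [PiLp.single_apply, if_pos rfl] at this
      exact this.trans_lt hω
    have h2 : ‖ω‖ < 3 * c / 2 := by
      have h3 := norm_le_norm_add_norm_sub' ω (EuclideanSpace.single k (-c))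
      have h4 : ‖ω - EuclideanSpace.single k (-c)‖ < c / 2 := by rwa [← dist_eq_norm]
      have h5 : ‖(EuclideanSpace.single k (-c) : E d)‖ = c := by simp [abs_of_pos hc0]
      linarith
    obtain ⟨h6, h7⟩ := abs_lt.1 h1
    exact ⟨by linarith, by linarith, by linarith, h2⟩
  have hleft : ∫⁻ x in Ω ∩ Ψ.symm ⁻¹' Metric.ball a ρ, ‖v x‖ₑ ^ p =
      ∫⁻ x in {x | dist x a < ρ ∧ 0 < x k ∧ x k ≤ ρ}, ‖u x‖ₑ ^ p := by
    rw [← h.preserving.setLIntegral_comp_preimage_emb Ψ.measurableEmbedding]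
    congr 2
    ext x
    simp only [mem_preimage, mem_inter_iff, Ψ.symm_apply_apply, Metric.mem_ball, mem_ofPred_eq]
    constructor
    · rintro ⟨h1, h2⟩
      refine ⟨h2, (h.mem_iff x (h2.trans (by linarith))).1 h1, ?_⟩
      exact (h.coord_le hΩ hb x).trans h2.le
    · rintro ⟨h1, h2, -⟩
      exact ⟨(h.mem_iff x (h1.trans (by linarith))).2 h2, h1⟩
  have hkey : ∀ y ∈ Q, ∀ ω ∈ B, ‖u (y + y k • ω) - u y‖ₑ ^ p / ENNReal.ofReal (y k) ^ (p * s) ≤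
      M * ENNReal.ofReal (y k) ^ (d : ℝ) * pairDensity Ω s p v (Ψ y) (Ψ (y + y k • ω)) := by
    rintro y ⟨hya, hy0⟩ ω hω
    have hyR : 2 * dist y a < R := by linarith
    have hyΩ : Ψ y ∈ Ω := (h.mem_iff y (by
      have := dist_nonneg (x := y) (y := a)
      linarith)).2 hy0
    have h1 : dist (Ψ (y + y k • ω)) (Ψ y) < bdist Ω (Ψ y) := by
      have h2 := h.lip.dist_le_mul (y + y k • ω) y
      rw [dist_self_add_left, norm_smul, Real.norm_eq_abs, abs_of_pos hy0] at h2
      have h3 := h.coord_le_bdist hΩ hb hyR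
      have h4 : L * (L * (y k * ‖ω‖)) < L * bdist Ω (Ψ y) := by
        refine lt_of_lt_of_le ?_ h3
        calc L * (L * (y k * ‖ω‖)) = (L ^ 2 * ‖ω‖) * y k := by ring
          _ < 1 * y k := by
            refine mul_lt_mul_of_pos_right ?_ hy0
            have := (hBprop ω hω).2.2.2
            have : (L : ℝ) ^ 2 * ‖ω‖ < L ^ 2 * (3 * c / 2) := by gcongr
            linarith
          _ = y k := one_mul _
      exact h2.trans_lt (lt_of_mul_lt_mul_left h4 hL.le)
    have h5 : pairDensity Ω s p v (Ψ y) (Ψ (y + y k • ω)) =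
        ‖u (y + y k • ω) - u y‖ₑ ^ p / ENNReal.ofReal (bdist Ω (Ψ y)) ^ ((d : ℝ) + p * s) := by
      rw [pairDensity, indicator_of_mem]
      · rfl
      · exact ⟨hyΩ, h1⟩
    rw [h5]
    refine div_rpow_le_of_le (by positivity) (by simpa using hy0) ENNReal.ofReal_ne_top
      (ENNReal.ofReal_pos.2 hL).ne' ENNReal.ofReal_ne_top ?_
    rw [← ENNReal.ofReal_mul hL.le]
    exact ENNReal.ofReal_le_ofReal (h.bdist_le_coord hΩ hb hy0 hyR)
  have hpm := measurable_pairDensity (s := s) (p := p) hΩ hv.measurable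
  have hinner : ∀ y ∈ Q, ∫⁻ ω in B, ‖u (y + y k • ω) - u y‖ₑ ^ p /
      ENNReal.ofReal (y k) ^ (p * s) ≤ M * ∫⁻ z, pairDensity Ω s p v (Ψ y) (Ψ z) := by
    intro y hy
    have hy0 : 0 < y k := hy.2
    have ht0 : ENNReal.ofReal (y k) ^ (d : ℝ) ≠ 0 :=
      (ENNReal.rpow_pos (by simpa using hy0) ENNReal.ofReal_ne_top).ne'
    have ht : ENNReal.ofReal (y k) ^ (d : ℝ) ≠ ∞ :=
      ENNReal.rpow_ne_top_of_nonneg (by positivity) ENNReal.ofReal_ne_top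
    have hfm : Measurable fun z => pairDensity Ω s p v (Ψ y) (Ψ z) :=
      hpm.comp (measurable_const.prodMk Ψ.continuous.measurable)
    calc _ ≤ ∫⁻ ω in B, M * ENNReal.ofReal (y k) ^ (d : ℝ) *
          pairDensity Ω s p v (Ψ y) (Ψ (y + y k • ω)) :=
          setLIntegral_mono' measurableSet_ball (hkey y hy)
      _ ≤ ∫⁻ ω, M * ENNReal.ofReal (y k) ^ (d : ℝ) *
          pairDensity Ω s p v (Ψ y) (Ψ (y + y k • ω)) :=
          lintegral_mono' Measure.restrict_le_self le_rfl
      _ = M * ((ENNReal.ofReal (y k) ^ (d : ℝ) * (ENNReal.ofReal (y k) ^ (d : ℝ))⁻¹) *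
            ∫⁻ z, pairDensity Ω s p v (Ψ y) (Ψ z)) := by
          rw [lintegral_const_mul' _ _ (ENNReal.mul_ne_top hMt ht),
            lintegral_comp_add_smul y hy0 hfm]
          ring
      _ = _ := by rw [ENNReal.mul_inv_cancel ht0 ht, one_mul]
  -- Averaging the chain bound over `B` turns single-direction increments into the double integral
  -- of the seminorm.
  have hBint : volume B * ∫⁻ x in Ω ∩ Ψ.symm ⁻¹' Metric.ball a ρ, ‖v x‖ₑ ^ p ≤
      C * M * semiPow Ω s p v := by
    rw [hleft]
    calc _ = ∫⁻ ω in B, ∫⁻ x in {x | dist x a < ρ ∧ 0 < x k ∧ x k ≤ ρ}, ‖u x‖ₑ ^ p := by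
          rw [lintegral_const, Measure.restrict_apply_univ, mul_comm]
      _ ≤ ∫⁻ ω in B, C * ∫⁻ y in Q,
            ‖u (y + y k • ω) - u y‖ₑ ^ p / ENNReal.ofReal (y k) ^ (p * s) := by
          refine setLIntegral_mono' measurableSet_ball fun ω hω => ?_
          obtain ⟨h1, h2, h3, -⟩ := hBprop ω hω
          refine hCb ω h1 h2 h3 u huc fun x hx hx0 => hv0 _ ?_
          rw [h.mem_iff x (by linarith), hx0]
          exact lt_irrefl _
      _ = C * ∫⁻ y in Q, ∫⁻ ω in B,
            ‖u (y + y k • ω) - u y‖ₑ ^ p / ENNReal.ofReal (y k) ^ (p * s) := by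
          rw [lintegral_const_mul' _ _ hC, lintegral_lintegral_swap]
          refine Measurable.aemeasurable (Measurable.div ?_ ?_)
          · have : Continuous fun q : E d × E d => u (q.2 + q.2 k • q.1) - u q.2 :=
              (huc.comp (continuous_snd.add ((hck.comp continuous_snd).smul continuous_fst))).sub
                (huc.comp continuous_snd)
            exact this.measurable.enorm.pow_const p
          · exact (hck.comp continuous_snd).measurable.ennreal_ofReal.pow_const _
      _ ≤ C * ∫⁻ y in Q, M * ∫⁻ z, pairDensity Ω s p v (Ψ y) (Ψ z) :=
          mul_le_mul' le_rfl (setLIntegral_mono' hQm hinner)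
      _ ≤ C * ∫⁻ y, M * ∫⁻ z, pairDensity Ω s p v (Ψ y) (Ψ z) :=
          mul_le_mul' le_rfl (lintegral_mono' Measure.restrict_le_self le_rfl)
      _ = _ := by
          rw [lintegral_const_mul' _ _ hMt, lintegral_lintegral_comp_measurePreserving h.preserving,
            ← semiPow_eq_pairDensity hΩ, mul_assoc]
  calc _ = (volume B)⁻¹ * (volume B * ∫⁻ x in Ω ∩ Ψ.symm ⁻¹' Metric.ball a ρ, ‖v x‖ₑ ^ p) := by
        rw [← mul_assoc, ENNReal.inv_mul_cancel hBvol0 hBvol, one_mul]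
    _ ≤ (volume B)⁻¹ * (C * M * semiPow Ω s p v) := mul_le_mul' le_rfl hBint
    _ = _ := by ring

end HetLoc

/-! ### The Poincaré inequality on `W₀` -/

namespace HetLoc
open Filter Topology

variable {d : ℕ} {Ω : Set (E d)} {s p : ℝ}

/-- With empty frontier `Ω` would be clopen, hence empty or the whole space, which is unbounded. -/
lemma frontier_nonempty (hd : 1 ≤ d) (hb : Bornology.IsBounded Ω)
    (hne : Ω.Nonempty) : (frontier Ω).Nonempty := by
  have : Nonempty (Fin d) := ⟨⟨0, hd⟩⟩
  have : NoncompactSpace (E d) := inferInstance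
  by_contra h
  rw [not_nonempty_iff_eq_empty, ← isClopen_iff_frontier_eq_empty, isClopen_iff] at h
  rcases h with h | h
  · exact hne.ne_empty h
  · rw [h] at hb
    exact (isCompact_univ_iff.not.2 (not_compactSpace_iff.2 this))
      (Metric.isCompact_of_isClosed_isBounded isClosed_univ hb)

lemma exists_bdist_bound (hb : Bornology.IsBounded Ω) (hfr : (frontier Ω).Nonempty) :
    ∃ D : ℝ, 0 < D ∧ (∀ x ∈ Ω, bdist Ω x ≤ D) ∧ ∀ x ∈ Ω, ∀ y ∈ Ω, dist x y ≤ D := by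
  obtain ⟨q, hq⟩ := hfr
  have hcl : Bornology.IsBounded (closure Ω) := hb.closure
  obtain ⟨D, hD⟩ := Metric.isBounded_iff.1 hcl
  have hD' : ∀ x ∈ closure Ω, ∀ y ∈ closure Ω, dist x y ≤ max D 1 := fun x hx y hy =>
    (hD hx hy).trans (le_max_left _ _)
  refine ⟨max D 1, by positivity, fun x hx => ?_, fun x hx y hy =>
    hD' x (subset_closure hx) y (subset_closure hy)⟩
  exact (Metric.infDist_le_dist_of_mem hq).trans
    (hD' x (subset_closure hx) q (frontier_subset_closure hq))

lemma lintegral_restrict_union_le {X : Type*} [MeasurableSpace X] (μ : Measure X) (f : X → ℝ≥0∞)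
    (S T : Set X) : ∫⁻ x in S ∪ T, f x ∂μ ≤ (∫⁻ x in S, f x ∂μ) + ∫⁻ x in T, f x ∂μ := by
  rw [← lintegral_add_measure]
  exact lintegral_mono' (Measure.restrict_union_le S T) le_rfl

/-- The `L^p` norm on a boundary layer is controlled by the seminorm. -/
lemma exists_layer_bound (hΩ : IsLipschitzDomain Ω) (hfr : (frontier Ω).Nonempty) (hp : 1 < p)
    (hps : 1 < p * s) :
    ∃ ε : ℝ, 0 < ε ∧ ∃ C : ℝ≥0∞, C ≠ ∞ ∧ ∀ v : E d → ℝ, Continuous v → (∀ x, x ∉ Ω → v x = 0) →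
      ∫⁻ x in {x ∈ Ω | bdist Ω x < ε}, ‖v x‖ₑ ^ p ≤ C * semiPow Ω s p v := by
  obtain ⟨U, hU, hfU, C, hC, hCb⟩ : ∃ U : Set (E d), IsOpen U ∧ frontier Ω ⊆ U ∧ ∃ C : ℝ≥0∞,
      C ≠ ∞ ∧ ∀ v : E d → ℝ, Continuous v → (∀ x, x ∉ Ω → v x = 0) →
        ∫⁻ x in Ω ∩ U, ‖v x‖ₑ ^ p ≤ C * semiPow Ω s p v := by
    refine hΩ.2.1.induction_on (p := fun S => ∃ U : Set (E d), IsOpen U ∧ S ⊆ U ∧ ∃ C : ℝ≥0∞,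
      C ≠ ∞ ∧ ∀ v : E d → ℝ, Continuous v → (∀ x, x ∉ Ω → v x = 0) →
        ∫⁻ x in Ω ∩ U, ‖v x‖ₑ ^ p ≤ C * semiPow Ω s p v) ?_ ?_ ?_ ?_
    · exact ⟨∅, isOpen_empty, Subset.rfl, 0, by simp, fun v _ _ => by simp⟩
    · rintro S T hST ⟨U, hU, hTU, hC⟩
      exact ⟨U, hU, hST.trans hTU, hC⟩
    · rintro S T ⟨U, hU, hSU, C, hC, h⟩ ⟨V, hV, hTV, C', hC', h'⟩
      refine ⟨U ∪ V, hU.union hV, union_subset_union hSU hTV, C + C', ENNReal.add_ne_top.2 ⟨hC, hC'⟩,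
        fun v hv hv0 => ?_⟩
      rw [inter_union_distrib_left, add_mul]
      exact (lintegral_restrict_union_le _ _ _ _).trans (add_le_add (h v hv hv0) (h' v hv hv0))
    · intro b hb
      obtain ⟨Ψ, k, L, R, hch⟩ := exists_flatChart hΩ hb
      obtain ⟨U, hU, hbU, hC⟩ := exists_boundary_bound (s := s) hΩ.1 hb hch hp hps
      exact ⟨U, mem_nhdsWithin_of_mem_nhds (hU.mem_nhds hbU), U, hU, Subset.rfl, hC⟩
  -- By compactness, a neighbourhood of the frontier contains a layer of uniform thickness.
  obtain ⟨ε, hε, hεU⟩ := hΩ.2.1.exists_thickening_subset_open hU hfU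
  refine ⟨ε, hε, C, hC, fun v hv hv0 => le_trans ?_ (hCb v hv hv0)⟩
  refine lintegral_mono_set fun x hx => ⟨hx.1, hεU ?_⟩
  obtain ⟨y, hy, hxy⟩ := (Metric.infDist_lt_iff hfr).1 hx.2
  exact Metric.mem_thickening_iff.2 ⟨y, hy, hxy⟩

/-- Walking from an interior point with steps `ω` until the boundary layer is reached. -/
lemma enorm_le_sum_walk {v : E d → ℝ} {ε : ℝ} {ω : E d} (hω : ‖ω‖ < ε) (n : ℕ) (x : E d)
    (hx : x ∈ Ω) (hxε : ε ≤ bdist Ω x) (hn : ¬ (x + (n : ℝ) • ω ∈ Ω ∧ ε ≤ bdist Ω (x + (n : ℝ) • ω))) :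
    ‖v x‖ₑ ≤ ∑ j ∈ Finset.range n,
      ({y | y ∈ Ω ∧ ε ≤ bdist Ω y}.indicator (fun y => ‖v (y + ω) - v y‖ₑ) (x + (j : ℝ) • ω) +
        {y | y ∈ Ω ∧ bdist Ω y < ε}.indicator (fun y => ‖v y‖ₑ) (x + (j : ℝ) • ω + ω)) := by
  induction n generalizing x with
  | zero => simp [hx, hxε] at hn
  | succ n ih =>
    have hstep : ‖v x‖ₑ ≤ ‖v (x + ω) - v x‖ₑ + ‖v (x + ω)‖ₑ := by
      have := enorm_sub_le (E := ℝ) (a := v (x + ω)) (b := v (x + ω) - v x)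
      rw [sub_sub_cancel] at this
      rwa [add_comm]
    have hmem : x + ω ∈ Ω := mem_of_dist_lt_bdist hx (by
      rw [dist_self_add_left]; exact hω.trans_le hxε)
    have hshift : ∀ j : ℕ, x + ((j + 1 : ℕ) : ℝ) • ω = x + ω + (j : ℝ) • ω := fun j => by
      push_cast
      module
    rw [Finset.sum_range_succ']
    simp only [hshift, Nat.cast_zero, zero_smul, add_zero]
    rw [indicator_of_mem (show x ∈ {y | y ∈ Ω ∧ ε ≤ bdist Ω y} from ⟨hx, hxε⟩)]
    by_cases hc : ε ≤ bdist Ω (x + ω)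
    · have := ih (x + ω) hmem hc (by rwa [hshift] at hn)
      calc _ ≤ _ := hstep
        _ ≤ _ := add_le_add le_rfl this
        _ ≤ _ := by rw [add_comm]; gcongr; exact le_self_add
    · rw [indicator_of_mem (show x + ω ∈ {y | y ∈ Ω ∧ bdist Ω y < ε} from ⟨hmem, not_le.1 hc⟩)]
      exact hstep.trans le_add_self

/-- More than `4D/ε` steps of length above `ε/4` leave `Ω`, while no step from depth `ε` can jump
over the layer. Each term of the resulting finite sum is a translate, so its integral does not
depend on its index. -/
lemma lintegral_interior_le (hΩ : IsOpen Ω) {D ε : ℝ} (hε : 0 < ε)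
    (hD : ∀ x ∈ Ω, ∀ y ∈ Ω, dist x y ≤ D) (hp : 1 < p) :
    ∃ C : ℝ≥0∞, C ≠ ∞ ∧ ∀ ω : E d, ε / 4 < ‖ω‖ → ‖ω‖ < ε / 2 → ∀ v : E d → ℝ, Continuous v →
      ∫⁻ x in {x | x ∈ Ω ∧ ε ≤ bdist Ω x}, ‖v x‖ₑ ^ p ≤
        C * ((∫⁻ y in {y | y ∈ Ω ∧ ε ≤ bdist Ω y}, ‖v (y + ω) - v y‖ₑ ^ p) +
          ∫⁻ y in {y | y ∈ Ω ∧ bdist Ω y < ε}, ‖v y‖ₑ ^ p) := by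
  have hp0 : 0 < p := by linarith
  obtain ⟨N, hN⟩ := exists_nat_gt (D / (ε / 4))
  rw [div_lt_iff₀ (by positivity)] at hN
  set A : Set (E d) := {y | y ∈ Ω ∧ ε ≤ bdist Ω y} with hA
  set B : Set (E d) := {y | y ∈ Ω ∧ bdist Ω y < ε} with hB
  have hAm : MeasurableSet A :=
    hΩ.measurableSet.inter (measurableSet_le measurable_const (measurable_bdist Ω))
  have hBm : MeasurableSet B :=
    hΩ.measurableSet.inter (measurableSet_lt (measurable_bdist Ω) measurable_const)
  refine ⟨(N : ℝ≥0∞) ^ (p - 1) * (N * 2 ^ (p - 1)), ?_, fun ω hω4 hω2 v hv => ?_⟩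
  · refine ENNReal.mul_ne_top (ENNReal.rpow_ne_top_of_nonneg (by linarith) (by simp))
      (ENNReal.mul_ne_top (by simp) (ENNReal.rpow_ne_top_of_nonneg (by linarith) (by simp)))
  set α : E d → ℝ≥0∞ := A.indicator fun y => ‖v (y + ω) - v y‖ₑ with hα
  set β : E d → ℝ≥0∞ := B.indicator fun y => ‖v y‖ₑ with hβ
  have hαm : Measurable α := by
    have : Continuous fun y => v (y + ω) - v y :=
      (hv.comp (continuous_id.add continuous_const)).sub hv
    exact this.measurable.enorm.indicator hAm
  have hβm : Measurable β := hv.measurable.enorm.indicator hBm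
  have hpt : ∀ x ∈ A, ‖v x‖ₑ ^ p ≤ (N : ℝ≥0∞) ^ (p - 1) * ∑ j ∈ Finset.range N,
      2 ^ (p - 1) * (α (x + (j : ℝ) • ω) ^ p + β (x + (j : ℝ) • ω + ω) ^ p) := by
    rintro x ⟨hx, hxε⟩
    have hout : ¬ (x + (N : ℝ) • ω ∈ Ω ∧ ε ≤ bdist Ω (x + (N : ℝ) • ω)) := by
      rintro ⟨h1, -⟩
      have h2 := hD _ h1 x hx
      rw [dist_self_add_left, norm_smul, Real.norm_natCast] at h2
      have : (N : ℝ) * (ε / 4) ≤ N * ‖ω‖ := by gcongr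
      linarith
    have h3 := enorm_le_sum_walk (v := v) (hω2.trans (by linarith)) N x hx hxε hout
    refine (ENNReal.rpow_le_rpow h3 hp0.le).trans ?_
    refine (ENNReal.rpow_sum_le_const_mul_sum_rpow _ _ hp.le).trans ?_
    rw [Finset.card_range]
    gcongr with j
    exact ENNReal.rpow_add_le_mul_rpow_add_rpow _ _ hp.le
  have hαp : ∫⁻ x, α x ^ p = ∫⁻ y in A, ‖v (y + ω) - v y‖ₑ ^ p := by
    rw [← lintegral_indicator hAm]
    refine lintegral_congr fun x => ?_
    by_cases hx : x ∈ A <;> simp [hα, hx, hp0]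
  have hβp : ∫⁻ x, β x ^ p = ∫⁻ y in B, ‖v y‖ₑ ^ p := by
    rw [← lintegral_indicator hBm]
    refine lintegral_congr fun x => ?_
    by_cases hx : x ∈ B <;> simp [hβ, hx, hp0]
  calc ∫⁻ x in A, ‖v x‖ₑ ^ p
      ≤ ∫⁻ x in A, (N : ℝ≥0∞) ^ (p - 1) * ∑ j ∈ Finset.range N,
          2 ^ (p - 1) * (α (x + (j : ℝ) • ω) ^ p + β (x + (j : ℝ) • ω + ω) ^ p) :=
        setLIntegral_mono' hAm hpt
    _ ≤ ∫⁻ x, (N : ℝ≥0∞) ^ (p - 1) * ∑ j ∈ Finset.range N,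
          2 ^ (p - 1) * (α (x + (j : ℝ) • ω) ^ p + β (x + (j : ℝ) • ω + ω) ^ p) :=
        lintegral_mono' Measure.restrict_le_self le_rfl
    _ = (N : ℝ≥0∞) ^ (p - 1) * ∑ j ∈ Finset.range N,
          2 ^ (p - 1) * ((∫⁻ x, α x ^ p) + ∫⁻ x, β x ^ p) := by
        rw [lintegral_const_mul _ (by fun_prop), lintegral_finsetSum _ (by fun_prop)]
        congr 1
        refine Finset.sum_congr rfl fun j _ => ?_
        rw [lintegral_const_mul _ (by fun_prop), lintegral_add_left (by fun_prop),
          lintegral_add_right_eq_self (fun x => α x ^ p)]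
        congr 2
        simp_rw [add_assoc]
        rw [lintegral_add_right_eq_self (fun x => β x ^ p)]
    _ = _ := by
        rw [Finset.sum_const, Finset.card_range, nsmul_eq_mul, hαp, hβp]
        ring

/-- Poincaré inequality for continuous functions vanishing outside `Ω`. -/
lemma exists_poincare (hd : 1 ≤ d) (hΩ : IsLipschitzDomain Ω) (hb : Bornology.IsBounded Ω)
    (hp : 1 < p) (hps : 1 < p * s) :
    ∃ C : ℝ≥0∞, C ≠ ∞ ∧ ∀ v : E d → ℝ, Continuous v → (∀ x, x ∉ Ω → v x = 0) →
      ∫⁻ x in Ω, ‖v x‖ₑ ^ p ≤ C * semiPow Ω s p v := by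
  rcases Ω.eq_empty_or_nonempty with rfl | hne
  · exact ⟨0, by simp, fun v _ _ => by simp⟩
  have hp0 : 0 < p := by linarith
  have hfr := frontier_nonempty hd hb hne
  obtain ⟨D, hD0, hDb, hDd⟩ := exists_bdist_bound hb hfr
  obtain ⟨ε, hε, C₁, hC₁, h₁⟩ := exists_layer_bound hΩ hfr hp hps
  obtain ⟨C₂, hC₂, h₂⟩ := lintegral_interior_le hΩ.1 hε hDd hp
  set A : Set (E d) := {y | y ∈ Ω ∧ ε ≤ bdist Ω y} with hA
  have hAm : MeasurableSet A :=
    hΩ.1.measurableSet.inter (measurableSet_le measurable_const (measurable_bdist Ω))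
  -- For these steps and points at depth at least `ε`, the increments are among those in the
  -- seminorm, whose kernel is bounded below since `δ ≤ D`. Averaging over `S` recovers the double
  -- integral.
  set S : Set (E d) := {ω | ε / 4 < ‖ω‖ ∧ ‖ω‖ < ε / 2} with hS
  have hSo : IsOpen S :=
    (isOpen_lt continuous_const continuous_norm).inter (isOpen_lt continuous_norm continuous_const)
  have hS0 : volume S ≠ 0 := by
    refine (hSo.measure_pos volume ⟨EuclideanSpace.single ⟨0, hd⟩ (3 * ε / 8), ?_⟩).ne'
    have : ‖(EuclideanSpace.single ⟨0, hd⟩ (3 * ε / 8) : E d)‖ = 3 * ε / 8 := by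
      simp [abs_of_pos hε]
    simp only [hS, mem_ofPred_eq, this]
    constructor <;> linarith
  have hSt : volume S ≠ ∞ := by
    refine ((measure_mono fun ω hω => ?_).trans_lt
      (measure_ball_lt_top (x := (0 : E d)) (r := ε / 2))).ne
    simpa using hω.2
  set M : ℝ≥0∞ := ENNReal.ofReal D ^ ((d : ℝ) + p * s) with hM
  have hMt : M ≠ ∞ := ENNReal.rpow_ne_top_of_nonneg (by positivity) ENNReal.ofReal_ne_top
  refine ⟨C₁ + (volume S)⁻¹ * (C₂ * (M + volume S * C₁)), ?_, fun v hv hv0 => ?_⟩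
  · exact ENNReal.add_ne_top.2 ⟨hC₁, ENNReal.mul_ne_top (ENNReal.inv_ne_top.2 hS0)
      (ENNReal.mul_ne_top hC₂ (ENNReal.add_ne_top.2 ⟨hMt, ENNReal.mul_ne_top hSt hC₁⟩))⟩
  have hlayer : ∫⁻ x in {x | x ∈ Ω ∧ bdist Ω x < ε}, ‖v x‖ₑ ^ p ≤ C₁ * semiPow Ω s p v :=
    h₁ v hv hv0
  have hinc : ∀ y ∈ A, ∀ ω ∈ S, ‖v (y + ω) - v y‖ₑ ^ p ≤ M * pairDensity Ω s p v y (y + ω) := by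
    rintro y ⟨hy, hyε⟩ ω hω
    have hpos : 0 < bdist Ω y := hε.trans_le hyε
    have h5 : pairDensity Ω s p v y (y + ω) =
        ‖v (y + ω) - v y‖ₑ ^ p / ENNReal.ofReal (bdist Ω y) ^ ((d : ℝ) + p * s) := by
      rw [pairDensity, indicator_of_mem]
      refine ⟨hy, ?_⟩
      dsimp only
      rw [dist_self_add_left]
      linarith [hω.2]
    have h0 : ENNReal.ofReal (bdist Ω y) ^ ((d : ℝ) + p * s) ≠ 0 :=
      (ENNReal.rpow_pos (ENNReal.ofReal_pos.2 hpos) ENNReal.ofReal_ne_top).ne'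
    have ht : ENNReal.ofReal (bdist Ω y) ^ ((d : ℝ) + p * s) ≠ ∞ :=
      ENNReal.rpow_ne_top_of_nonneg (by positivity) ENNReal.ofReal_ne_top
    rw [h5]
    calc _ = ENNReal.ofReal (bdist Ω y) ^ ((d : ℝ) + p * s) * (‖v (y + ω) - v y‖ₑ ^ p /
          ENNReal.ofReal (bdist Ω y) ^ ((d : ℝ) + p * s)) := (ENNReal.mul_div_cancel h0 ht).symm
      _ ≤ _ := by
        exact mul_le_mul' (ENNReal.rpow_le_rpow (ENNReal.ofReal_le_ofReal (hDb y hy))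
          (by positivity)) le_rfl
  have hpm := measurable_pairDensity (s := s) (p := p) hΩ.1 hv.measurable
  have hdouble : ∫⁻ ω in S, ∫⁻ y in A, ‖v (y + ω) - v y‖ₑ ^ p ≤ M * semiPow Ω s p v := by
    rw [lintegral_lintegral_swap]
    · calc _ ≤ ∫⁻ y in A, ∫⁻ ω in S, M * pairDensity Ω s p v y (y + ω) :=
            setLIntegral_mono' hAm fun y hy => setLIntegral_mono' hSo.measurableSet (hinc y hy)
        _ ≤ ∫⁻ y, ∫⁻ ω, M * pairDensity Ω s p v y (y + ω) :=
            lintegral_mono' Measure.restrict_le_self fun y =>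
              lintegral_mono' Measure.restrict_le_self le_rfl
        _ = ∫⁻ y, M * ∫⁻ z, pairDensity Ω s p v y z := by
            refine lintegral_congr fun y => ?_
            rw [lintegral_const_mul' _ _ hMt,
              lintegral_add_left_eq_self (fun z => pairDensity Ω s p v y z) y]
        _ = _ := by rw [lintegral_const_mul' _ _ hMt, ← semiPow_eq_pairDensity hΩ.1]
    · have : Continuous fun q : E d × E d => v (q.2 + q.1) - v q.2 :=
        (hv.comp (continuous_snd.add continuous_fst)).sub (hv.comp continuous_snd)
      exact (this.measurable.enorm.pow_const p).aemeasurable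
  have hint : volume S * ∫⁻ x in A, ‖v x‖ₑ ^ p ≤
      C₂ * (M + volume S * C₁) * semiPow Ω s p v := by
    calc _ = ∫⁻ ω in S, ∫⁻ x in A, ‖v x‖ₑ ^ p := by
          rw [lintegral_const, Measure.restrict_apply_univ, mul_comm]
      _ ≤ ∫⁻ ω in S, C₂ * ((∫⁻ y in A, ‖v (y + ω) - v y‖ₑ ^ p) + C₁ * semiPow Ω s p v) := by
          refine setLIntegral_mono' hSo.measurableSet fun ω hω => ?_
          exact (h₂ ω hω.1 hω.2 v hv).trans (by gcongr)
      _ = C₂ * ((∫⁻ ω in S, ∫⁻ y in A, ‖v (y + ω) - v y‖ₑ ^ p) +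
            C₁ * semiPow Ω s p v * volume S) := by
          rw [lintegral_const_mul' _ _ hC₂, lintegral_add_right _ measurable_const, lintegral_const,
            Measure.restrict_apply_univ]
      _ ≤ C₂ * (M * semiPow Ω s p v + C₁ * semiPow Ω s p v * volume S) := by gcongr
      _ = _ := by ring
  have hsplit : Ω = {x | x ∈ Ω ∧ bdist Ω x < ε} ∪ A := by
    ext x
    by_cases hx : x ∈ Ω <;> simp [hA, hx, lt_or_ge]
  calc ∫⁻ x in Ω, ‖v x‖ₑ ^ p
      ≤ (∫⁻ x in {x | x ∈ Ω ∧ bdist Ω x < ε}, ‖v x‖ₑ ^ p) + ∫⁻ x in A, ‖v x‖ₑ ^ p := by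
        conv_lhs => rw [hsplit]
        exact lintegral_restrict_union_le _ _ _ _
    _ ≤ C₁ * semiPow Ω s p v +
          (volume S)⁻¹ * (C₂ * (M + volume S * C₁) * semiPow Ω s p v) := by
        refine add_le_add hlayer ?_
        calc ∫⁻ x in A, ‖v x‖ₑ ^ p = (volume S)⁻¹ * (volume S * ∫⁻ x in A, ‖v x‖ₑ ^ p) := by
              rw [← mul_assoc, ENNReal.inv_mul_cancel hS0 hSt, one_mul]
          _ ≤ _ := by gcongr
    _ = _ := by ring

lemma ofReal_p_one_le (hp : 1 ≤ p) : Fact (1 ≤ ENNReal.ofReal p) :=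
  ⟨by simpa using ENNReal.ofReal_le_ofReal hp⟩

lemma lintegral_Lp_add_le (hp : 1 ≤ p) (u v : LpΩ Ω p) :
    ∫⁻ x in Ω, ‖(u + v : LpΩ Ω p) x‖ₑ ^ p ≤
      2 ^ (p - 1) * ((∫⁻ x in Ω, ‖u x‖ₑ ^ p) + ∫⁻ x in Ω, ‖v x‖ₑ ^ p) := by
  refine le_trans (le_of_eq ?_) (lpPow_add_le hp (measurable_coeFn u))
  refine lintegral_congr_ae ?_
  filter_upwards [Lp.coeFn_add u v] with x hx
  rw [hx]

lemma semiPow_Lp_add_le (hp : 1 ≤ p) (u v : LpΩ Ω p) :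
    semiPow Ω s p (u + v : LpΩ Ω p) ≤ 2 ^ (p - 1) * (semiPow Ω s p u + semiPow Ω s p v) := by
  rw [semiPow_congr (Lp.coeFn_add u v)]
  exact semiPow_add_le hp (measurable_coeFn u)

lemma gPow_Lp_add_le (hp : 1 ≤ p) (u v : LpΩ Ω p) :
    gPow Ω s p (u + v : LpΩ Ω p) ≤ 2 ^ (p - 1) * (gPow Ω s p u + gPow Ω s p v) := by
  refine (add_le_add (lintegral_Lp_add_le hp u v) (semiPow_Lp_add_le hp u v)).trans_eq ?_
  unfold gPow
  ring

lemma mem_wClosure_iff (hp : 0 < p) {P : (E d → ℝ) → Prop} {u : LpΩ Ω p} :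
    u ∈ wClosure Ω s p P ↔ gPow Ω s p u < ∞ ∧ ∀ ε : ℝ≥0∞, 0 < ε →
      ∃ w : LpΩ Ω p, (∃ v, P v ∧ w =ᵐ[volume.restrict Ω] v) ∧
        gPow Ω s p (u - w : LpΩ Ω p) < ε := by
  simp only [wClosure, mem_ofPred_eq, wNorm_lt_top_iff hp, wNorm_lt_iff hp]
  refine and_congr_right fun _ => ⟨fun h ε hε => ?_, fun h ε hε => ?_⟩
  · have := h (ε ^ (1 / p)) (ENNReal.rpow_pos_of_nonneg hε (by positivity))
    rwa [← ENNReal.rpow_mul, one_div_mul_cancel hp.ne', ENNReal.rpow_one] at this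
  · exact h _ (ENNReal.rpow_pos_of_nonneg hε hp.le)

lemma IsLipCompact.eq_zero {v : E d → ℝ} (h : IsLipCompact Ω v) {x : E d} (hx : x ∉ Ω) :
    v x = 0 :=
  image_eq_zero_of_notMem_tsupport fun h' => hx (h.2.2 h')

/-- Poincaré inequality on `W₀`. -/
lemma exists_poincare_W₀ (hd : 1 ≤ d) (hΩ : IsLipschitzDomain Ω) (hb : Bornology.IsBounded Ω)
    (hp : 1 < p) (hps : 1 < p * s) :
    ∃ C : ℝ≥0∞, C ≠ ∞ ∧ ∀ u ∈ W₀ Ω s p, ∫⁻ x in Ω, ‖u x‖ₑ ^ p ≤ C * semiPow Ω s p u := by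
  obtain ⟨C, hC, h⟩ := exists_poincare hd hΩ hb hp hps
  have hp0 : 0 < p := by linarith
  have : Fact (1 ≤ ENNReal.ofReal p) := ofReal_p_one_le hp.le
  set c : ℝ≥0∞ := 2 ^ (p - 1) with hc
  have hct : c ≠ ∞ := ENNReal.rpow_ne_top_of_nonneg (by linarith) (by simp)
  refine ⟨c * C * c, ENNReal.mul_ne_top (ENNReal.mul_ne_top hct hC) hct, fun u hu => ?_⟩
  rw [W₀, mem_wClosure_iff hp0] at hu
  obtain ⟨-, hu⟩ := hu
  set K : ℝ≥0∞ := c + c * C * c with hK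
  have hKt : K ≠ ∞ := ENNReal.add_ne_top.2
    ⟨hct, ENNReal.mul_ne_top (ENNReal.mul_ne_top hct hC) hct⟩
  -- The inequality holds for Lipschitz approximants; passing to `u` costs powers of `2` and an
  -- error linear in `ε`.
  have main : ∀ ε : ℝ≥0∞, 0 < ε →
      ∫⁻ x in Ω, ‖u x‖ₑ ^ p ≤ c * C * c * semiPow Ω s p u + K * ε := by
    intro ε hε
    obtain ⟨w, ⟨v, hv, hwv⟩, hw⟩ := hu ε hε
    have h1 : ∫⁻ x in Ω, ‖w x‖ₑ ^ p ≤ C * semiPow Ω s p w := by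
      rw [semiPow_congr hwv]
      refine le_trans (le_of_eq ?_) (h v hv.1.choose_spec.continuous fun x hx => hv.eq_zero hx)
      refine lintegral_congr_ae ?_
      filter_upwards [hwv] with x hx
      rw [hx]
    have h2 := lintegral_Lp_add_le hp.le (u - w) w
    rw [sub_add_cancel] at h2
    have h3 := semiPow_Lp_add_le (s := s) hp.le (w - u) u
    rw [sub_add_cancel] at h3
    have h4 : semiPow Ω s p (w - u : LpΩ Ω p) ≤ ε := by
      have : gPow Ω s p (w - u : LpΩ Ω p) ≤ ε := by rw [gPow_sub_comm]; exact hw.le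
      exact le_add_self.trans this
    have h5 : ∫⁻ x in Ω, ‖(u - w : LpΩ Ω p) x‖ₑ ^ p ≤ ε := le_self_add.trans hw.le
    calc _ ≤ _ := h2
      _ ≤ c * (ε + C * (c * (ε + semiPow Ω s p u))) := by
          gcongr
          exact h1.trans (by gcongr; exact h3.trans (by gcongr))
      _ = _ := by rw [hK]; ring
  refine ENNReal.le_of_forall_pos_le_add fun ε hε _ => ?_
  have hK1 : K + 1 ≠ ∞ := ENNReal.add_ne_top.2 ⟨hKt, by simp⟩
  refine (main (ε / (K + 1)) (ENNReal.div_pos (by simpa using hε.ne') hK1)).trans ?_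
  gcongr
  calc K * (ε / (K + 1)) ≤ (K + 1) * (ε / (K + 1)) := by gcongr; exact le_self_add
    _ = ε := ENNReal.mul_div_cancel (by simp) hK1

end HetLoc

/-! ### Averages and smoothing -/

namespace HetLoc
open Filter Topology

section Averages

variable {d : ℕ} {p : ℝ}

/-- Jensen's inequality, obtained from the monotonicity in the exponent of `L^p` norms on a
probability space. -/
lemma enorm_integral_rpow_le {X : Type*} [MeasurableSpace X] (P : Measure X)
    [IsProbabilityMeasure P] (hp : 1 ≤ p) {g : X → ℝ} (hg : AEStronglyMeasurable g P) :
    ‖∫ z, g z ∂P‖ₑ ^ p ≤ ∫⁻ z, ‖g z‖ₑ ^ p ∂P := by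
  have hp0 : 0 < p := by linarith
  have h1 : ‖∫ z, g z ∂P‖ₑ ≤ eLpNorm g (ENNReal.ofReal p) P := by
    refine (enorm_integral_le_lintegral_enorm g).trans ?_
    rw [← eLpNorm_one_eq_lintegral_enorm]
    exact eLpNorm_le_eLpNorm_of_exponent_le (by simpa using ENNReal.ofReal_le_ofReal hp) hg
  refine (ENNReal.rpow_le_rpow h1 hp0.le).trans_eq ?_
  rw [eLpNorm_eq_lintegral_rpow_enorm_toReal (by simpa using hp0) (by simp),
    ENNReal.toReal_ofReal hp0.le, ← ENNReal.rpow_mul, one_div_mul_cancel hp0.ne', ENNReal.rpow_one]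

lemma lintegral_average_le (P : Measure (E d)) [IsProbabilityMeasure P] (hp : 1 ≤ p)
    {f : E d → ℝ} (hf : Measurable f) :
    ∫⁻ x, ‖∫ z, f (x + z) ∂P‖ₑ ^ p ≤ ∫⁻ x, ‖f x‖ₑ ^ p := by
  calc _ ≤ ∫⁻ x, ∫⁻ z, ‖f (x + z)‖ₑ ^ p ∂P := lintegral_mono fun x =>
        enorm_integral_rpow_le P hp (hf.comp (measurable_const_add x)).aestronglyMeasurable
    _ = ∫⁻ z, (∫⁻ x, ‖f (x + z)‖ₑ ^ p) ∂P := by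
        rw [lintegral_lintegral_swap]
        exact ((hf.comp (measurable_fst.add measurable_snd)).enorm.pow_const p).aemeasurable
    _ = _ := by
        simp_rw [lintegral_add_right_eq_self (fun x => ‖f x‖ₑ ^ p)]
        simp

lemma lintegral_average_sub_le (P : Measure (E d)) [IsProbabilityMeasure P] (hp : 1 ≤ p)
    {f : E d → ℝ} (hf : Measurable f) (hfi : ∀ x, Integrable (fun z => f (x + z)) P) {ε : ℝ≥0∞}
    (h : ∀ᵐ z ∂P, ∫⁻ x, ‖f (x + z) - f x‖ₑ ^ p ≤ ε) :
    ∫⁻ x, ‖(∫ z, f (x + z) ∂P) - f x‖ₑ ^ p ≤ ε := by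
  have h1 : ∀ x, (∫ z, f (x + z) ∂P) - f x = ∫ z, (f (x + z) - f x) ∂P := fun x => by
    rw [integral_sub (hfi x) (integrable_const _)]
    simp
  simp_rw [h1]
  calc _ ≤ ∫⁻ x, ∫⁻ z, ‖f (x + z) - f x‖ₑ ^ p ∂P := lintegral_mono fun x =>
        enorm_integral_rpow_le P hp
          ((hf.comp (measurable_const_add x)).sub measurable_const).aestronglyMeasurable
    _ = ∫⁻ z, (∫⁻ x, ‖f (x + z) - f x‖ₑ ^ p) ∂P := by
        rw [lintegral_lintegral_swap]
        exact (((hf.comp (measurable_fst.add measurable_snd)).sub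
          (hf.comp measurable_fst)).enorm.pow_const p).aemeasurable
    _ ≤ ∫⁻ z, ε ∂P := lintegral_mono_ae h
    _ = ε := by simp

/-- Continuity of translations in `L^p`. -/
lemma exists_translation_bound (hp : 1 ≤ p) {f : E d → ℝ} (hf : MemLp f (ENNReal.ofReal p) volume)
    {ε : ℝ≥0∞} (hε : 0 < ε) :
    ∃ δ : ℝ, 0 < δ ∧ ∀ z : E d, ‖z‖ < δ → ∫⁻ x, ‖f (x + z) - f x‖ₑ ^ p ≤ ε := by
  have hp0 : 0 < p := by linarith
  have : Fact (1 ≤ ENNReal.ofReal p) := ⟨by simpa using ENNReal.ofReal_le_ofReal hp⟩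
  have : Fact (ENNReal.ofReal p ≠ ∞) := ⟨ENNReal.ofReal_ne_top⟩
  set F : Lp ℝ (ENNReal.ofReal p) (volume : Measure (E d)) := hf.toLp f with hF
  have hcont : Continuous fun z : E d => DomAddAct.mk z +ᵥ F := by
    have h1 : Continuous fun z : E d => (DomAddAct.mk z : (E d)ᵈᵃᵃ) := DomAddAct.continuous_mk
    exact h1.vadd continuous_const
  have hz : ∀ z : E d, ∫⁻ x, ‖f (x + z) - f x‖ₑ ^ p = edist (DomAddAct.mk z +ᵥ F) F ^ p := by
    intro z
    rw [edist_eq_enorm_sub, Lp.enorm_def, ← lintegral_eq_eLpNorm_rpow hp0]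
    refine lintegral_congr_ae ?_
    have h2 : (DomAddAct.mk z +ᵥ F : Lp ℝ (ENNReal.ofReal p) (volume : Measure (E d)))
        =ᵐ[volume] fun x => f (z + x) := by
      have h3 := DomAddAct.vadd_Lp_ae_eq (DomAddAct.mk z) F
      have h4 : (F : E d → ℝ) =ᵐ[volume] f := hf.coeFn_toLp
      have h5 := (measurePreserving_add_left (volume : Measure (E d)) z).quasiMeasurePreserving.ae h4
      filter_upwards [h3, h5] with x hx hx'
      rw [hx]
      simpa using hx'
    filter_upwards [h2, hf.coeFn_toLp, Lp.coeFn_sub (DomAddAct.mk z +ᵥ F) F] with x h6 h7 h8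
    rw [h8, Pi.sub_apply, h6, h7, add_comm]
  have h0 : Tendsto (fun z : E d => edist (DomAddAct.mk z +ᵥ F) F ^ p) (𝓝 0) (𝓝 0) := by
    have h1 : Continuous fun z : E d => edist (DomAddAct.mk z +ᵥ F) F ^ p :=
      ENNReal.continuous_rpow_const.comp (hcont.edist continuous_const)
    have h2 := h1.tendsto 0
    simpa [hp0] using h2
  obtain ⟨δ, hδ, h⟩ := Metric.eventually_nhds_iff.1 (ENNReal.tendsto_nhds_zero.1 h0 ε hε)
  refine ⟨δ, hδ, fun z hzδ => ?_⟩
  rw [hz]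
  exact h (by simpa using hzδ)

/-- A smoothing probability measure concentrated on a given ball. -/
lemma exists_smoothing (c : E d) {r : ℝ} (hr : 0 < r) :
    ∃ P : Measure (E d), IsProbabilityMeasure P ∧ (∀ᵐ z ∂P, dist z c < r) ∧
      ∀ f : E d → ℝ, Integrable f volume → (∀ x, Integrable (fun z => f (x + z)) P) ∧
        ∃ K, LipschitzWith K fun x => ∫ z, f (x + z) ∂P := by
  -- The centre `c` is arbitrary: a centre off the origin makes the average also a shift, which is
  -- needed at the boundary.
  let B : ContDiffBump c := ⟨r / 2, r, by positivity, by linarith⟩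
  set ρ : E d → ℝ := B.normed volume with hρ
  have hρ0 : ∀ z, 0 ≤ ρ z := fun z => B.nonneg_normed z
  have hρs : ContDiff ℝ 1 ρ := B.contDiff_normed
  have hρc : HasCompactSupport ρ := B.hasCompactSupport_normed
  have hρi : Integrable ρ volume := hρs.continuous.integrable_of_hasCompactSupport hρc
  have hρm : Measurable ρ := hρs.continuous.measurable
  obtain ⟨K, hK⟩ : ∃ K, LipschitzWith K ρ :=
    ContDiff.lipschitzWith_of_hasCompactSupport hρc hρs one_ne_zero
  obtain ⟨M, hM⟩ := hρc.exists_bound_of_continuous hρs.continuous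
  set P : Measure (E d) := volume.withDensity fun z => ENNReal.ofReal (ρ z) with hP
  have hint : ∀ g : E d → ℝ, ∫ z, g z ∂P = ∫ z, ρ z * g z := fun g => by
    rw [hP, integral_withDensity_eq_integral_toReal_smul (by fun_prop)
      (Eventually.of_forall fun _ => ENNReal.ofReal_lt_top)]
    refine integral_congr_ae (Eventually.of_forall fun z => ?_)
    simp [ENNReal.toReal_ofReal (hρ0 z)]
  have hprod : ∀ (f : E d → ℝ), Integrable f volume → ∀ x, Integrable (fun y => ρ (y - x) * f y) :=
    fun f hf x => by
      refine hf.bdd_mul (c := M) (Continuous.aestronglyMeasurable (by fun_prop)) ?_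
      exact Eventually.of_forall fun y => hM _
  refine ⟨P, ⟨?_⟩, ?_, fun f hf => ⟨fun x => ?_, K * (∫ y, |f y|).toNNReal, ?_⟩⟩
  · rw [hP, withDensity_apply _ MeasurableSet.univ, Measure.restrict_univ,
      ← ofReal_integral_eq_lintegral_ofReal hρi (Eventually.of_forall hρ0), hρ, B.integral_normed,
      ENNReal.ofReal_one]
  · rw [hP, ae_withDensity_iff (by fun_prop)]
    refine Eventually.of_forall fun z hz => ?_
    have : z ∈ Function.support ρ := fun h => hz (by rw [h, ENNReal.ofReal_zero])
    rw [hρ, B.support_normed_eq] at this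
    exact this
  · rw [hP, integrable_withDensity_iff_integrable_smul' (by fun_prop)
      (Eventually.of_forall fun _ => ENNReal.ofReal_lt_top)]
    have h1 := (hprod f hf x).comp_add_left x
    refine h1.congr (Eventually.of_forall fun z => ?_)
    simp [ENNReal.toReal_ofReal (hρ0 z)]
  -- Substitution moves the dependence on `x` onto the Lipschitz density, so averages of merely
  -- integrable functions are Lipschitz.
  · have hconv : ∀ x, ∫ z, f (x + z) ∂P = ∫ y, ρ (y - x) * f y := fun x => by
      rw [hint, ← integral_add_left_eq_self (fun y => ρ (y - x) * f y) x]
      simp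
    refine LipschitzWith.of_dist_le_mul fun x y => ?_
    rw [hconv, hconv, Real.dist_eq, ← integral_sub (hprod f hf x) (hprod f hf y)]
    have hf0 : 0 ≤ ∫ y, |f y| := integral_nonneg fun _ => abs_nonneg _
    calc |∫ a, (ρ (a - x) * f a - ρ (a - y) * f a)|
        ≤ ∫ a, K * dist x y * |f a| := by
          rw [← Real.norm_eq_abs]
          refine norm_integral_le_of_norm_le (hf.abs.const_mul _) (Eventually.of_forall fun a => ?_)
          rw [← sub_mul, norm_mul, Real.norm_eq_abs (f a)]
          refine mul_le_mul_of_nonneg_right ?_ (abs_nonneg _)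
          rw [← dist_eq_norm]
          refine (hK.dist_le_mul _ _).trans_eq ?_
          rw [dist_sub_left]
      _ = _ := by
          rw [integral_const_mul, NNReal.coe_mul, Real.coe_toNNReal _ hf0]
          ring

end Averages

end HetLoc

/-! ### Compactly supported functions and convexity of the energy -/

namespace HetLoc
open Filter Topology

variable {d : ℕ} {Ω : Set (E d)} {s p : ℝ}

lemma volume_ne_top_of_isBounded (hb : Bornology.IsBounded Ω) : volume Ω ≠ ∞ :=
  hb.measure_lt_top.ne

lemma enorm_sub_rpow_le (hp : 1 ≤ p) (a b : ℝ) :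
    ‖a - b‖ₑ ^ p ≤ 2 ^ (p - 1) * (‖a‖ₑ ^ p + ‖b‖ₑ ^ p) :=
  (ENNReal.rpow_le_rpow (enorm_sub_le (a := a) (b := b)) (by linarith)).trans
    (ENNReal.rpow_add_le_mul_rpow_add_rpow _ _ hp)

lemma lintegral_lintegral_add_rpow {g : E d → ℝ} (hg : Measurable g) (c : ℝ≥0∞) :
    ∫⁻ x in Ω, ∫⁻ y in Ω, c * (‖g y‖ₑ ^ p + ‖g x‖ₑ ^ p) =
      c * (2 * volume Ω) * ∫⁻ x in Ω, ‖g x‖ₑ ^ p := by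
  have hm : Measurable fun x => ‖g x‖ₑ ^ p := hg.enorm.pow_const p
  have h1 : ∀ x, ∫⁻ y in Ω, c * (‖g y‖ₑ ^ p + ‖g x‖ₑ ^ p) =
      c * ((∫⁻ y in Ω, ‖g y‖ₑ ^ p) + ‖g x‖ₑ ^ p * volume Ω) := fun x => by
    rw [lintegral_const_mul _ (by fun_prop), lintegral_add_left hm, lintegral_const,
      Measure.restrict_apply_univ]
  simp_rw [h1]
  rw [lintegral_const_mul _ (by fun_prop),
    lintegral_add_left measurable_const, lintegral_const, Measure.restrict_apply_univ,
    lintegral_mul_const _ hm]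
  ring

/-- On functions supported away from the boundary, `gPow` is controlled by the `L^p` norm. -/
lemma gPow_le_of_support (hb : Bornology.IsBounded Ω) (hΩm : MeasurableSet Ω)
    (hs : 0 ≤ s) (hp : 1 ≤ p) {ε : ℝ} (hε : 0 < ε) :
    ∃ C : ℝ≥0∞, C ≠ ∞ ∧ ∀ g : E d → ℝ, Measurable g → (∀ x, bdist Ω x < ε → g x = 0) →
      gPow Ω s p g ≤ C * ∫⁻ x in Ω, ‖g x‖ₑ ^ p := by
  have hp0 : 0 < p := by linarith
  set a : ℝ := (d : ℝ) + p * s with ha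
  have ha0 : 0 ≤ a := by positivity
  set c : ℝ≥0∞ := 2 ^ (p - 1) / ENNReal.ofReal (ε / 2) ^ a with hc
  have hct : c ≠ ∞ := by
    refine ENNReal.div_ne_top (ENNReal.rpow_ne_top_of_nonneg (by linarith) (by simp)) ?_
    exact (ENNReal.rpow_pos (ENNReal.ofReal_pos.2 (by positivity)) ENNReal.ofReal_ne_top).ne'
  refine ⟨1 + c * (2 * volume Ω), ?_, fun g hg hg0 => ?_⟩
  · exact ENNReal.add_ne_top.2 ⟨by simp, ENNReal.mul_ne_top hct
      (ENNReal.mul_ne_top (by simp) (volume_ne_top_of_isBounded hb))⟩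
  rw [gPow, add_mul, one_mul, ← lintegral_lintegral_add_rpow hg]
  refine add_le_add le_rfl ?_
  unfold semiPow
  refine lintegral_mono fun x => ?_
  refine (setLIntegral_mono' (hΩm.inter measurableSet_ball) fun y hy => ?_).trans
    (lintegral_mono_set inter_subset_left)
  have hxy : dist y x < bdist Ω x := hy.2
  -- If `δ(x) < ε/2`, every `y` in the ball has `δ(y) < ε`, so both values vanish; otherwise the
  -- kernel is at most `(ε/2)^{-d-ps}`.
  by_cases hx : bdist Ω x < ε / 2
  · have h1 : g x = 0 := hg0 x (by linarith)
    have h2 : g y = 0 := hg0 y (by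
      have := bdist_le_add_dist (Ω := Ω) y x
      linarith)
    simp [h1, h2, hp0]
  · calc _ ≤ (2 ^ (p - 1) * (‖g y‖ₑ ^ p + ‖g x‖ₑ ^ p)) / ENNReal.ofReal (ε / 2) ^ a := by
          refine ENNReal.div_le_div (enorm_sub_rpow_le hp _ _) ?_
          exact ENNReal.rpow_le_rpow (ENNReal.ofReal_le_ofReal (not_lt.1 hx)) ha0
      _ = _ := by rw [hc, ENNReal.mul_div_right_comm]

lemma memLp_indicator (hΩm : MeasurableSet Ω) (u : LpΩ Ω p) :
    MemLp (Ω.indicator u) (ENNReal.ofReal p) volume :=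
  (memLp_indicator_iff_restrict hΩm).2 (Lp.memLp u)

lemma integrable_of_memLp (hb : Bornology.IsBounded Ω) (hp : 1 ≤ p) (u : LpΩ Ω p) :
    IntegrableOn u Ω volume := by
  have : IsFiniteMeasure (volume.restrict Ω) :=
    ⟨by rw [Measure.restrict_apply_univ]; exact hb.measure_lt_top⟩
  exact (Lp.memLp u).integrable (by simpa using ENNReal.ofReal_le_ofReal hp)

/-- A compactly supported `L^p` function belongs to `W₀`. -/
lemma mem_W₀_of_compact_support (hd : 1 ≤ d) (hΩ : IsOpen Ω) (hb : Bornology.IsBounded Ω)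
    (hs : 0 ≤ s) (hp : 1 ≤ p) {C : Set (E d)} (hC : IsCompact C) (hCΩ : C ⊆ Ω) (u : LpΩ Ω p)
    (hu : ∀ᵐ x ∂(volume.restrict Ω), x ∉ C → u x = 0) : u ∈ W₀ Ω s p := by
  have hp0 : 0 < p := by linarith
  have hfact : Fact (1 ≤ ENNReal.ofReal p) := ofReal_p_one_le hp
  have hΩm := hΩ.measurableSet
  obtain ⟨m, hm, hmC⟩ : ∃ m : ℝ, 0 < m ∧ ∀ x ∈ C, m ≤ bdist Ω x := by
    rcases C.eq_empty_or_nonempty with rfl | hne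
    · exact ⟨1, one_pos, by simp⟩
    · have hfr := frontier_nonempty hd hb (hne.mono hCΩ)
      obtain ⟨x₀, hx₀, hmin⟩ := hC.exists_isMinOn hne
        (Metric.continuous_infDist_pt (frontier Ω)).continuousOn
      exact ⟨bdist Ω x₀, bdist_pos hΩ hfr (hCΩ hx₀), fun x hx => hmin hx⟩
  obtain ⟨K, hK, hKb⟩ := gPow_le_of_support (Ω := Ω) (s := s) hb hΩm hs hp
    (ε := m / 2) (by positivity)
  set f : E d → ℝ := C.indicator u with hf
  have hfm : Measurable f := (measurable_coeFn u).indicator hC.measurableSet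
  have huf : (u : E d → ℝ) =ᵐ[volume.restrict Ω] f := by
    filter_upwards [hu] with x hx
    by_cases hxC : x ∈ C
    · simp [hf, hxC]
    · simp [hf, hxC, hx hxC]
  have hfeq : f = C.indicator (Ω.indicator u) := by
    rw [indicator_indicator, inter_eq_self_of_subset_left hCΩ]
  have hfLp : MemLp f (ENNReal.ofReal p) volume := by
    rw [hfeq]
    exact (memLp_indicator hΩm u).indicator hC.measurableSet
  have hfint : Integrable f volume := by
    rw [hfeq]
    exact ((integrable_of_memLp hb hp u).integrable_indicator hΩm).indicator hC.measurableSet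
  have hfsupp : ∀ x, bdist Ω x < m / 2 → f x = 0 := fun x hx => by
    rw [hf, indicator_of_notMem]
    intro hxC
    linarith [hmC x hxC]
  rw [W₀, mem_wClosure_iff hp0]
  refine ⟨?_, fun ε hε => ?_⟩
  · rw [gPow_congr huf]
    refine (hKb f hfm hfsupp).trans_lt (ENNReal.mul_lt_top hK.lt_top ?_)
    refine (lintegral_mono' Measure.restrict_le_self le_rfl).trans_lt ?_
    rw [lintegral_eq_eLpNorm_rpow hp0]
    exact ENNReal.rpow_lt_top_of_nonneg hp0.le hfLp.eLpNorm_ne_top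
  · obtain ⟨ε', hε', hεK⟩ : ∃ ε' : ℝ≥0∞, 0 < ε' ∧ K * ε' < ε := by
      obtain ⟨ε', h1, h2⟩ := ENNReal.exists_pos_mul_lt hK hε.ne'
      exact ⟨ε', h1, by rwa [mul_comm]⟩
    obtain ⟨δ, hδ, hδb⟩ := exists_translation_bound hp hfLp hε'
    -- `r ≤ δ` makes the mollification `L^p`-close, and `r ≤ m/2` keeps its support at depth `m/2`,
    -- where the `L^p` norm controls `gPow`.
    set r : ℝ := min δ (m / 2) with hr
    have hr0 : 0 < r := lt_min hδ (by positivity)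
    obtain ⟨P, hPprob, hPball, hP⟩ := exists_smoothing (0 : E d) hr0
    obtain ⟨hPint, L, hL⟩ := hP f hfint
    set g : E d → ℝ := fun x => ∫ z, f (x + z) ∂P with hg
    have hgzero : ∀ x, x ∉ Metric.cthickening r C → g x = 0 := by
      intro x hx
      refine integral_eq_zero_of_ae ?_
      filter_upwards [hPball] with z hz
      rw [hf, Pi.zero_apply, indicator_of_notMem]
      intro hxz
      refine hx (Metric.mem_cthickening_of_dist_le x (x + z) r C hxz ?_)
      rw [dist_self_add_right]
      simpa using hz.le
    have hthick : ∀ x ∈ Metric.cthickening r C, x ∈ Ω ∧ m / 2 ≤ bdist Ω x := by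
      intro x hx
      rw [hC.cthickening_eq_biUnion_closedBall hr0.le] at hx
      obtain ⟨y, hy, hxy⟩ := mem_iUnion₂.1 hx
      rw [Metric.mem_closedBall] at hxy
      have h1 : r ≤ m / 2 := min_le_right _ _
      have h2 := hmC y hy
      have h3 := bdist_le_add_dist (Ω := Ω) y x
      rw [dist_comm] at h3
      exact ⟨mem_of_dist_lt_bdist (hCΩ hy) (by linarith), by linarith⟩
    have hgsub : tsupport g ⊆ Metric.cthickening r C :=
      closure_minimal (fun x hx => by_contra fun h => hx (hgzero x h)) Metric.isClosed_cthickening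
    have hgc : HasCompactSupport g :=
      HasCompactSupport.of_support_subset_isCompact hC.cthickening
        ((subset_tsupport g).trans hgsub)
    have hgLp : MemLp g (ENNReal.ofReal p) (volume.restrict Ω) :=
      (hL.continuous.memLp_of_hasCompactSupport hgc).restrict _
    refine ⟨hgLp.toLp g, ⟨g, ⟨⟨L, hL⟩, hgc, fun x hx => (hthick x (hgsub hx)).1⟩,
      hgLp.coeFn_toLp⟩, ?_⟩
    have hsub : ((u - hgLp.toLp g : LpΩ Ω p) : E d → ℝ) =ᵐ[volume.restrict Ω]
        fun x => f x - g x := by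
      filter_upwards [Lp.coeFn_sub u (hgLp.toLp g), hgLp.coeFn_toLp, huf] with x h1 h2 h3
      rw [h1, Pi.sub_apply, h2, h3]
    rw [gPow_congr hsub]
    have hgm : Measurable g := hL.continuous.measurable
    refine (hKb _ (hfm.sub hgm) fun x hx => ?_).trans_lt (lt_of_le_of_lt ?_ hεK)
    · have : g x = 0 := hgzero x fun h => by linarith [(hthick x h).2]
      simp [hfsupp x hx, this]
    · refine mul_le_mul' le_rfl ((lintegral_mono' Measure.restrict_le_self le_rfl).trans ?_)
      have h4 := lintegral_average_sub_le P hp hfm hPint (ε := ε') (by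
        filter_upwards [hPball] with z hz
        refine hδb z (lt_of_lt_of_le ?_ (min_le_left _ _ : r ≤ δ))
        rwa [dist_zero_right] at hz)
      refine le_trans (le_of_eq ?_) h4
      refine lintegral_congr fun x => ?_
      rw [← enorm_neg, Pi.sub_apply, neg_sub]

lemma IsLipCompact.isLipClosed {v : E d → ℝ} (h : IsLipCompact Ω v) : IsLipClosed Ω v := by
  obtain ⟨⟨L, hL⟩, hc, hs⟩ := h
  exact ⟨⟨L, hL.lipschitzOnWith⟩, tsupport v, hc, fun x _ hx => image_eq_zero_of_notMem_tsupport hx⟩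

lemma wClosure_mono {P Q : (E d → ℝ) → Prop} (h : ∀ v, P v → Q v) :
    wClosure Ω s p P ⊆ wClosure Ω s p Q := by
  rintro u ⟨hu, hu'⟩
  refine ⟨hu, fun ε hε => ?_⟩
  obtain ⟨w, ⟨v, hv, hwv⟩, hw⟩ := hu' ε hε
  exact ⟨w, ⟨v, h v hv, hwv⟩, hw⟩

lemma W₀_subset_W (hp : 1 ≤ p) : W₀ Ω s p ⊆ (W Ω s p hp : Set (LpΩ Ω p)) :=
  wClosure_mono fun _ hv => hv.isLipClosed

lemma coeFn_midpoint (u v : LpΩ Ω p) :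
    (((1 / 2 : ℝ) • (u + v) : LpΩ Ω p) : E d → ℝ) =ᵐ[volume.restrict Ω]
      fun x => (1 / 2 : ℝ) * (u x + v x) := by
  filter_upwards [Lp.coeFn_smul (1 / 2 : ℝ) (u + v), Lp.coeFn_add u v] with x h1 h2
  rw [h1, Pi.smul_apply, h2, smul_eq_mul, Pi.add_apply]

/-- Midpoint convexity of the energy. -/
lemma energy_midpoint_le {A : E d → E d → ℝ}
    (hA : AEMeasurable (Function.uncurry A) ((volume.restrict Ω).prod (volume.restrict Ω)))
    (hA0 : ∀ᵐ z ∂(pairMeasure Ω s p), 0 ≤ A z.1 z.2) {F : ℝ → ℝ} (hF : ConvexOn ℝ univ F)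
    (hF0 : ∀ t, 0 ≤ F t) (u v : LpΩ Ω p) :
    energy s A F ((1 / 2 : ℝ) • (u + v) : LpΩ Ω p) ≤
      ENNReal.ofReal (1 / 2) * (energy s A F u + energy s A F v) := by
  have hFm : Measurable F := (continuousOn_univ.1 (hF.continuousOn isOpen_univ)).measurable
  have hA' : AEMeasurable (fun z : E d × E d => A z.1 z.2) (pairMeasure Ω s p) :=
    hA.mono_ac pairMeasure_absolutelyContinuous
  have hu := measurable_coeFn u
  have hv := measurable_coeFn v
  simp only [energy_eq_lintegral hA hFm]
  rw [← lintegral_add_left', ← lintegral_const_mul' _ _ ENNReal.ofReal_ne_top]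
  · refine lintegral_mono_ae ?_
    filter_upwards [hA0, ae_pairMeasure_of_ae (coeFn_midpoint u v)] with z hz hm
    rw [hm.1, hm.2, ← ENNReal.ofReal_add (mul_nonneg hz (hF0 _)) (mul_nonneg hz (hF0 _)),
      ← ENNReal.ofReal_mul (by norm_num)]
    refine ENNReal.ofReal_le_ofReal ?_
    have h1 := hF.2 (mem_univ (u z.2 - u z.1)) (mem_univ (v z.2 - v z.1))
      (by norm_num : (0 : ℝ) ≤ 1 / 2) (by norm_num : (0 : ℝ) ≤ 1 / 2) (by norm_num)
    simp only [smul_eq_mul] at h1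
    have h2 : 1 / 2 * (u z.2 + v z.2) - 1 / 2 * (u z.1 + v z.1) =
        1 / 2 * (u z.2 - u z.1) + 1 / 2 * (v z.2 - v z.1) := by ring
    rw [h2]
    calc _ ≤ A z.1 z.2 * (1 / 2 * F (u z.2 - u z.1) + 1 / 2 * F (v z.2 - v z.1)) := by gcongr
      _ = _ := by ring
  · refine (hA'.mul (Measurable.aemeasurable ?_)).ennreal_ofReal
    exact hFm.comp ((hu.comp measurable_snd).sub (hu.comp measurable_fst))

/-- Makes convexity of the seminorm power a special case of convexity of the energy. -/
lemma semiPow_eq_energy (hp : 0 ≤ p) (u : LpΩ Ω p) :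
    semiPow Ω s p u = energy s (fun _ _ => 1) (fun t => |t| ^ p) u := by
  have hm : Measurable fun t : ℝ => |t| ^ p :=
    (continuous_abs.rpow_const fun _ => Or.inr hp).measurable
  rw [semiPow_eq_lintegral (measurable_coeFn u), energy_eq_lintegral (by fun_prop) hm]
  simp only [enorm_rpow_eq _ hp, one_mul]

lemma convexOn_abs_rpow (hp : 1 ≤ p) : ConvexOn ℝ univ fun t : ℝ => |t| ^ p := by
  refine ⟨convex_univ, fun x _ y _ a b ha hb hab => ?_⟩
  simp only [smul_eq_mul]
  have h1 := (convexOn_rpow hp).2 (abs_nonneg x) (abs_nonneg y) ha hb hab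
  simp only [smul_eq_mul] at h1
  refine le_trans (Real.rpow_le_rpow (abs_nonneg _) ?_ (by linarith)) h1
  calc _ ≤ |a * x| + |b * y| := abs_add_le _ _
    _ = _ := by rw [abs_mul, abs_mul, abs_of_nonneg ha, abs_of_nonneg hb]

lemma semiPow_midpoint_le (hp : 1 ≤ p) (u v : LpΩ Ω p) {M : ℝ≥0∞} (hu : semiPow Ω s p u ≤ M)
    (hv : semiPow Ω s p v ≤ M) : semiPow Ω s p ((1 / 2 : ℝ) • (u + v) : LpΩ Ω p) ≤ M := by
  have hp0 : 0 ≤ p := by linarith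
  rw [semiPow_eq_energy hp0] at hu hv ⊢
  refine (energy_midpoint_le (by fun_prop) (by simp) (convexOn_abs_rpow hp)
    (fun t => by positivity) u v).trans ?_
  calc _ ≤ ENNReal.ofReal (1 / 2) * (M + M) := by gcongr
    _ = M := by
      rw [← two_mul, ← mul_assoc, show (2 : ℝ≥0∞) = ENNReal.ofReal 2 by simp,
        ← ENNReal.ofReal_mul (by norm_num)]
      norm_num

/-- An `L^p` limit of Lipschitz functions with bounded seminorms belongs to `W`. -/
lemma mem_W_of_bounded_approx (hp : 1 < p) [Fact (1 ≤ ENNReal.ofReal p)] (u : LpΩ Ω p)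
    {M : ℝ≥0∞} (hM : M ≠ ∞)
    (h : ∀ ε : ℝ, 0 < ε → ∃ w : LpΩ Ω p, (∃ v, IsLipClosed Ω v ∧ w =ᵐ[volume.restrict Ω] v) ∧
      ‖w - u‖ ≤ ε ∧ semiPow Ω s p w ≤ M) : u ∈ W Ω s p hp.le := by
  have hp0 : 0 < p := by linarith
  -- These sets are midpoint-convex, decreasing and bounded, so points of them converge strongly;
  -- the `L^p` constraint identifies the limit with `u`. This serves as a substitute for Mazur's
  -- lemma.
  set C : ℕ → Set (LpΩ Ω p) := fun n => {w | (∃ v, IsLipClosed Ω v ∧ w =ᵐ[volume.restrict Ω] v) ∧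
      ‖w - u‖ ≤ 1 / ((n : ℝ) + 1) ∧ semiPow Ω s p w ≤ M} with hC
  have hbdd : ∀ w ∈ C 0, gPow Ω s p w ≤ (‖u‖ₑ + 1) ^ p + M := by
    rintro w ⟨-, h1, h2⟩
    refine add_le_add ?_ h2
    rw [lintegral_eq_eLpNorm_rpow hp0, ← Lp.enorm_def]
    refine ENNReal.rpow_le_rpow ?_ hp0.le
    have h3 : ‖w‖ ≤ ‖u‖ + 1 := by
      have := norm_le_norm_add_norm_sub' w u
      simp at h1
      linarith
    rw [← ofReal_norm, ← ofReal_norm, ← ENNReal.ofReal_one,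
      ← ENNReal.ofReal_add (norm_nonneg _) zero_le_one]
    exact ENNReal.ofReal_le_ofReal h3
  have hMt : (‖u‖ₑ + 1) ^ p + M ≠ ∞ := ENNReal.add_ne_top.2
    ⟨ENNReal.rpow_ne_top_of_nonneg hp0.le (ENNReal.add_ne_top.2 ⟨enorm_ne_top, by simp⟩), hM⟩
  obtain ⟨y, u', hy, hyu⟩ := exists_tendsto_of_antitone (s := s) hp (C := C) (M := _)
    (fun n m hnm w ⟨h1, h2, h3⟩ => ⟨h1, h2.trans (by gcongr), h3⟩)
    (fun n => h _ (by positivity)) (by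
      rintro n w₁ ⟨⟨v₁, hv₁, hw₁⟩, h1, h1'⟩ w₂ ⟨⟨v₂, hv₂, hw₂⟩, h2, h2'⟩
      refine ⟨⟨_, (hv₁.add hv₂).smul (1 / 2), ?_⟩, ?_, semiPow_midpoint_le hp.le _ _ h1' h2'⟩
      · exact (Lp.coeFn_smul _ _).trans (((Lp.coeFn_add w₁ w₂).trans (hw₁.add hw₂)).const_smul _)
      · have h3 : (1 / 2 : ℝ) • (w₁ + w₂) - u = (1 / 2 : ℝ) • ((w₁ - u) + (w₂ - u)) := by module
        rw [h3, norm_smul, Real.norm_of_nonneg (by norm_num)]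
        have := norm_add_le (w₁ - u) (w₂ - u)
        linarith)
    hMt hbdd
  have hyt := tendsto_of_tendsto_gPow hp.le hyu
  have hyt' : Tendsto y atTop (𝓝 u) := by
    rw [tendsto_iff_norm_sub_tendsto_zero]
    exact squeeze_zero (fun _ => norm_nonneg _) (fun n => (hy n).2.1)
      tendsto_one_div_add_atTop_nhds_zero_nat
  obtain rfl := tendsto_nhds_unique hyt hyt'
  refine (mem_wClosure_iff hp0).2 ⟨?_, fun ε hε => ?_⟩
  · refine (gPow_le_of_tendsto hyt (C := (‖u'‖ₑ + 1) ^ p + M) (Eventually.of_forall fun n =>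
      hbdd _ ⟨(hy n).1, (hy n).2.1.trans ?_, (hy n).2.2⟩)).trans_lt
        (ENNReal.mul_lt_top (by simp) hMt.lt_top)
    gcongr
    simp
  · obtain ⟨n, hn⟩ := (hyu.eventually (gt_mem_nhds hε)).exists
    exact ⟨y n, (hy n).1, by rwa [gPow_sub_comm]⟩

end HetLoc

/-! ### Multipliers and Gagliardo averages -/

namespace HetLoc
open Filter Topology

variable {d : ℕ} {Ω : Set (E d)} {s p : ℝ}

/-- The seminorm of a product with a Lipschitz function. -/
lemma semiPow_mul_le (hΩ : IsOpen Ω) (hs1 : s ≤ 1) (hp : 1 ≤ p) {D : ℝ}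
    (hpos : ∀ x ∈ Ω, 0 < bdist Ω x) (hD : ∀ x ∈ Ω, bdist Ω x ≤ D) {η : E d → ℝ} {K : ℝ≥0}
    (hη : LipschitzWith K η) {w : E d → ℝ} (hw : Measurable w) :
    semiPow Ω s p (fun x => η x * w x) ≤ 2 ^ (p - 1) *
      ((∫⁻ x in Ω, ∫⁻ y in Ω ∩ Metric.ball x (bdist Ω x),
        ‖η y‖ₑ ^ p * ‖w y - w x‖ₑ ^ p / ENNReal.ofReal (bdist Ω x) ^ ((d : ℝ) + p * s)) +
      ((K : ℝ≥0∞) ^ p * volume (Metric.ball (0 : E d) 1) * ENNReal.ofReal D ^ (p * (1 - s))) *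
        ∫⁻ x in Ω, ‖w x‖ₑ ^ p) := by
  have hp0 : 0 < p := by linarith
  set a : ℝ := (d : ℝ) + p * s with ha
  set V := volume (Metric.ball (0 : E d) 1) with hV
  have h2 : (2 : ℝ≥0∞) ^ (p - 1) ≠ ∞ := ENNReal.rpow_ne_top_of_nonneg (by linarith) (by simp)
  have hmw : Measurable fun x => ‖w x‖ₑ ^ p := hw.enorm.pow_const p
  rw [← lintegral_const_mul _ hmw, ← lintegral_add_right _ (hmw.const_mul _),
    ← lintegral_const_mul' _ _ h2]
  unfold semiPow
  refine setLIntegral_mono' hΩ.measurableSet fun x hx => ?_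
  set δ := bdist Ω x with hδ
  have hδ0 : 0 < δ := hpos x hx
  have ht0 : ENNReal.ofReal δ ≠ 0 := (ENNReal.ofReal_pos.2 hδ0).ne'
  have ht : ENNReal.ofReal δ ≠ ∞ := ENNReal.ofReal_ne_top
  have hball : Ω ∩ Metric.ball x δ = Metric.ball x δ :=
    inter_eq_right.2 fun y hy => mem_of_dist_lt_bdist hx hy
  have hpt : ∀ y ∈ Ω ∩ Metric.ball x δ, ‖η y * w y - η x * w x‖ₑ ^ p / ENNReal.ofReal δ ^ a ≤
      2 ^ (p - 1) * (‖η y‖ₑ ^ p * ‖w y - w x‖ₑ ^ p / ENNReal.ofReal δ ^ a +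
        (K : ℝ≥0∞) ^ p * ENNReal.ofReal δ ^ p * ‖w x‖ₑ ^ p / ENNReal.ofReal δ ^ a) := by
    rintro y ⟨-, hy⟩
    rw [← ENNReal.add_div, ← mul_div_assoc]
    refine ENNReal.div_le_div_right ?_ _
    have h3 : η y * w y - η x * w x = η y * (w y - w x) + (η y - η x) * w x := by ring
    rw [h3]
    refine (ENNReal.rpow_le_rpow (enorm_add_le _ _) hp0.le).trans
      ((ENNReal.rpow_add_le_mul_rpow_add_rpow _ _ hp).trans ?_)
    rw [enorm_mul, enorm_mul, ENNReal.mul_rpow_of_nonneg _ _ hp0.le,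
      ENNReal.mul_rpow_of_nonneg _ _ hp0.le]
    have h4 : ‖η y - η x‖ₑ ≤ K * ENNReal.ofReal δ := by
      rw [← edist_eq_enorm_sub]
      refine (hη y x).trans ?_
      rw [edist_dist]
      gcongr
      exact (Metric.mem_ball.1 hy).le
    have h6 : ‖η y - η x‖ₑ ^ p ≤ (K : ℝ≥0∞) ^ p * ENNReal.ofReal δ ^ p := by
      rw [← ENNReal.mul_rpow_of_nonneg _ _ hp0.le]
      exact ENNReal.rpow_le_rpow h4 hp0.le
    gcongr
  calc _ ≤ ∫⁻ y in Ω ∩ Metric.ball x δ,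
        2 ^ (p - 1) * (‖η y‖ₑ ^ p * ‖w y - w x‖ₑ ^ p / ENNReal.ofReal δ ^ a +
        (K : ℝ≥0∞) ^ p * ENNReal.ofReal δ ^ p * ‖w x‖ₑ ^ p / ENNReal.ofReal δ ^ a) :=
        setLIntegral_mono' (hΩ.measurableSet.inter measurableSet_ball) hpt
    _ = 2 ^ (p - 1) * ((∫⁻ y in Ω ∩ Metric.ball x δ,
          ‖η y‖ₑ ^ p * ‖w y - w x‖ₑ ^ p / ENNReal.ofReal δ ^ a) +
        (K : ℝ≥0∞) ^ p * ENNReal.ofReal δ ^ p * ‖w x‖ₑ ^ p / ENNReal.ofReal δ ^ a *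
          (ENNReal.ofReal δ ^ (d : ℝ) * V)) := by
        rw [lintegral_const_mul' _ _ h2, lintegral_add_right _ measurable_const, lintegral_const,
          Measure.restrict_apply_univ, hball, Measure.addHaar_ball_of_pos _ _ hδ0,
          finrank_euclideanSpace_fin, ENNReal.ofReal_pow hδ0.le, ENNReal.rpow_natCast]
    _ ≤ _ := by
        refine mul_le_mul' le_rfl (add_le_add le_rfl ?_)
        -- The Lipschitz bound gives `δ^p`, the kernel `δ^{-d-ps}` and the ball `δ^d`; the total
        -- `δ^{p(1-s)}` is bounded because `s ≤ 1`.
        have h5 : ENNReal.ofReal δ ^ p * (ENNReal.ofReal δ ^ a)⁻¹ * ENNReal.ofReal δ ^ (d : ℝ) =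
            ENNReal.ofReal δ ^ (p * (1 - s)) := by
          rw [← ENNReal.rpow_neg, ← ENNReal.rpow_add _ _ ht0 ht, ← ENNReal.rpow_add _ _ ht0 ht, ha]
          congr 1
          ring
        calc _ = (K : ℝ≥0∞) ^ p * V * (ENNReal.ofReal δ ^ p * (ENNReal.ofReal δ ^ a)⁻¹ *
              ENNReal.ofReal δ ^ (d : ℝ)) * ‖w x‖ₑ ^ p := by
              rw [div_eq_mul_inv]
              ring
          _ ≤ _ := by
              rw [h5]
              refine mul_le_mul' (mul_le_mul' le_rfl (ENNReal.rpow_le_rpow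
                (ENNReal.ofReal_le_ofReal (hD x hx)) ?_)) le_rfl
              exact mul_nonneg hp0.le (by linarith)

/-- The integrand of the Gagliardo seminorm with exponent `a`. -/
noncomputable def gagliardo (p a : ℝ) (u : E d → ℝ) (x y : E d) : ℝ≥0∞ :=
  ‖u y - u x‖ₑ ^ p / ENNReal.ofReal ‖y - x‖ ^ a

lemma measurable_gagliardo {a : ℝ} {u : E d → ℝ} (hu : Measurable u) :
    Measurable (Function.uncurry (gagliardo p a u)) := by
  refine Measurable.div ?_ ?_
  · exact ((hu.comp measurable_snd).sub (hu.comp measurable_fst)).enorm.pow_const p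
  · exact ((measurable_snd.sub measurable_fst).norm).ennreal_ofReal.pow_const _

lemma setLIntegral_translate_le {S T : Set (E d)} (hS : MeasurableSet S) (hT : MeasurableSet T)
    {z : E d} (h : ∀ x ∈ S, x + z ∈ T) (F : E d → ℝ≥0∞) :
    ∫⁻ x in S, F (x + z) ≤ ∫⁻ x in T, F x := by
  rw [← lintegral_indicator hS, ← lintegral_indicator hT,
    ← lintegral_add_right_eq_self (T.indicator F) z]
  refine lintegral_mono fun x => ?_
  by_cases hx : x ∈ S
  · rw [indicator_of_mem hx, indicator_of_mem (h x hx)]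
  · simp [hx]

/-- Translating both points leaves `y - x` unchanged, so Jensen's inequality on the increments
suffices. -/
lemma gagliardo_average_le (P : Measure (E d)) [IsProbabilityMeasure P] (hp : 1 ≤ p)
    {a : ℝ} {f : E d → ℝ} (hf : Measurable f) (hfi : ∀ x, Integrable (fun z => f (x + z)) P)
    (x y : E d) : gagliardo p a (fun x => ∫ z, f (x + z) ∂P) x y ≤
      ∫⁻ z, gagliardo p a f (x + z) (y + z) ∂P := by
  have hm : Measurable fun z => f (y + z) - f (x + z) :=
    (hf.comp (measurable_const_add y)).sub (hf.comp (measurable_const_add x))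
  have h1 : (∫ z, f (y + z) ∂P) - ∫ z, f (x + z) ∂P = ∫ z, (f (y + z) - f (x + z)) ∂P :=
    (integral_sub (hfi y) (hfi x)).symm
  simp only [gagliardo, add_sub_add_right_eq_sub, div_eq_mul_inv, h1]
  rw [lintegral_mul_const _ (hm.enorm.pow_const p)]
  exact mul_le_mul' (enorm_integral_rpow_le P hp hm.aestronglyMeasurable) le_rfl

lemma lintegral_lintegral_lintegral_rotate (P : Measure (E d)) [SFinite P] (S : Set (E d))
    {H : E d → E d → ℝ≥0∞} (hH : Measurable (Function.uncurry H)) :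
    ∫⁻ x in S, ∫⁻ y in S, ∫⁻ z, H (x + z) (y + z) ∂P =
      ∫⁻ z, (∫⁻ x in S, ∫⁻ y in S, H (x + z) (y + z)) ∂P := by
  have hm : Measurable fun q : (E d × E d) × E d => H (q.1.1 + q.1.2) (q.2 + q.1.2) :=
    hH.comp (by fun_prop : Measurable fun q : (E d × E d) × E d =>
      (q.1.1 + q.1.2, q.2 + q.1.2))
  have h1 : ∀ x, ∫⁻ y in S, ∫⁻ z, H (x + z) (y + z) ∂P =
      ∫⁻ z, (∫⁻ y in S, H (x + z) (y + z)) ∂P := fun x => by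
    refine lintegral_lintegral_swap (f := fun y z => H (x + z) (y + z)) (Measurable.aemeasurable ?_)
    exact hm.comp (by fun_prop : Measurable fun r : E d × E d => ((x, r.2), r.1))
  simp_rw [h1]
  refine lintegral_lintegral_swap (f := fun x z => ∫⁻ y in S, H (x + z) (y + z))
    (Measurable.aemeasurable ?_)
  exact hm.lintegral_prod_right' (ν := volume.restrict S)

/-- Averaging over translations does not increase the Gagliardo seminorm. -/
lemma lintegral_gagliardo_average_le (P : Measure (E d)) [IsProbabilityMeasure P] (hp : 1 ≤ p)
    {a : ℝ} {f : E d → ℝ} (hf : Measurable f) (hfi : ∀ x, Integrable (fun z => f (x + z)) P)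
    {S T : Set (E d)} (hS : MeasurableSet S) (hT : MeasurableSet T)
    (hST : ∀ᵐ z ∂P, ∀ x ∈ S, x + z ∈ T) :
    ∫⁻ x in S, ∫⁻ y in S, gagliardo p a (fun x => ∫ z, f (x + z) ∂P) x y ≤
      ∫⁻ x in T, ∫⁻ y in T, gagliardo p a f x y := by
  calc _ ≤ ∫⁻ x in S, ∫⁻ y in S, ∫⁻ z, gagliardo p a f (x + z) (y + z) ∂P :=
        lintegral_mono fun x => lintegral_mono fun y => gagliardo_average_le P hp hf hfi x y
    _ = ∫⁻ z, (∫⁻ x in S, ∫⁻ y in S, gagliardo p a f (x + z) (y + z)) ∂P :=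
        lintegral_lintegral_lintegral_rotate P S (measurable_gagliardo hf)
    _ ≤ ∫⁻ z, (∫⁻ x in T, ∫⁻ y in T, gagliardo p a f x y) ∂P := by
        refine lintegral_mono_ae ?_
        filter_upwards [hST] with z hz
        calc _ ≤ ∫⁻ x in S, ∫⁻ y in T, gagliardo p a f (x + z) y := lintegral_mono fun x =>
              setLIntegral_translate_le hS hT hz fun y => gagliardo p a f (x + z) y
          _ ≤ _ := setLIntegral_translate_le hS hT hz fun x => ∫⁻ y in T, gagliardo p a f x y
    _ = _ := by rw [lintegral_const, measure_univ, mul_one]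

lemma div_rpow_le_mul_div_rpow {N δ t l : ℝ≥0∞} {b : ℝ} (hb : 0 ≤ b) (hl0 : l ≠ 0) (hl : l ≠ ∞)
    (h : δ ≤ l * t) : N / t ^ b ≤ l ^ b * (N / δ ^ b) := by
  have hlb0 : l ^ b ≠ 0 := (ENNReal.rpow_pos hl0.bot_lt hl).ne'
  have hlb : l ^ b ≠ ∞ := ENNReal.rpow_ne_top_of_nonneg hb hl
  have h1 : N / (l * t) ^ b ≤ N / δ ^ b := ENNReal.div_le_div_left (ENNReal.rpow_le_rpow h hb) _
  refine le_trans (le_of_eq ?_) (mul_le_mul' le_rfl h1)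
  rw [ENNReal.mul_rpow_of_nonneg _ _ hb, div_eq_mul_inv, div_eq_mul_inv,
    ENNReal.mul_inv (Or.inl hlb0) (Or.inl hlb)]
  calc _ = (l ^ b * (l ^ b)⁻¹) * (N * (t ^ b)⁻¹) := by rw [ENNReal.mul_inv_cancel hlb0 hlb, one_mul]
    _ = _ := by ring

lemma gagliardo_le_of_lipschitz {a : ℝ} (ha : 0 ≤ a) {Ψ : E d → E d} {L : ℝ≥0} (hL0 : 0 < L)
    (hΨ : LipschitzWith L Ψ) {u v : E d → ℝ} {x y : E d} (hx : u x = v (Ψ x))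
    (hy : u y = v (Ψ y)) : gagliardo p a u x y ≤ (L : ℝ≥0∞) ^ a * gagliardo p a v (Ψ x) (Ψ y) := by
  unfold gagliardo
  rw [hx, hy]
  refine div_rpow_le_mul_div_rpow ha (by simpa using hL0.ne') (by simp) ?_
  rw [← dist_eq_norm, ← dist_eq_norm, ← edist_dist, ← edist_dist]
  exact hΨ y x

lemma lipschitzOnWith_mul {η w : E d → ℝ} {K M : ℝ≥0} (hη : LipschitzWith K η)
    (hw : LipschitzWith M w) {S : Set (E d)} (hS : IsCompact S) :
    ∃ L, LipschitzOnWith L (fun x => η x * w x) S := by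
  obtain ⟨A, hA⟩ := hS.exists_bound_of_continuousOn hη.continuous.continuousOn
  obtain ⟨B, hB⟩ := hS.exists_bound_of_continuousOn hw.continuous.continuousOn
  refine ⟨(|A|.toNNReal) * M + (|B|.toNNReal) * K, LipschitzOnWith.of_dist_le_mul
    fun x hx y hy => ?_⟩
  rw [Real.dist_eq, show η x * w x - η y * w y = η x * (w x - w y) + w y * (η x - η y) by ring]
  have h1 := hη.dist_le_mul x y
  have h2 := hw.dist_le_mul x y
  rw [Real.dist_eq] at h1 h2
  have h3 : |η x| ≤ |A| := (hA x hx).trans (le_abs_self _)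
  have h4 : |w y| ≤ |B| := (hB y hy).trans (le_abs_self _)
  calc _ ≤ |η x| * |w x - w y| + |w y| * |η x - η y| := by
        rw [← abs_mul, ← abs_mul]; exact abs_add_le _ _
    _ ≤ |A| * (M * dist x y) + |B| * (K * dist x y) := by gcongr
    _ = _ := by
        push_cast [Real.coe_toNNReal _ (abs_nonneg A), Real.coe_toNNReal _ (abs_nonneg B)]
        ring

end HetLoc

/-! ### Localization at the boundary -/

namespace HetLoc
open Filter Topology

variable {d : ℕ} {Ω : Set (E d)} {s p : ℝ}

/-- Pull-back of the Gagliardo seminorm to a flat chart. -/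
lemma lintegral_gagliardo_chart_le {b : E d} {Ψ : E d ≃ₜ E d} {k : Fin d} {L : ℝ≥0} {R : ℝ}
    (h : IsFlatChart Ω b Ψ k L R) {a : ℝ} (ha : 0 ≤ a) (φ : E d → ℝ) {T : Set (E d)}
    (hT : MeasurableSet T) (hTΩ : ∀ x ∈ T, Ψ x ∈ Ω) :
    ∫⁻ x in T, ∫⁻ y in T, gagliardo p a (Ω.indicator φ ∘ Ψ) x y ≤
      (L : ℝ≥0∞) ^ a * ∫⁻ x in Ω, ∫⁻ y in Ω, gagliardo p a φ x y := by
  have hL0 : 0 < L := h.L_pos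
  have hLt : (L : ℝ≥0∞) ^ a ≠ ∞ := ENNReal.rpow_ne_top_of_nonneg ha (by simp)
  have hemb := Ψ.measurableEmbedding
  have hsub : T ⊆ Ψ ⁻¹' Ω := hTΩ
  have hval : ∀ x ∈ T, (Ω.indicator φ ∘ Ψ) x = φ (Ψ x) := fun x hx => by
    rw [Function.comp_apply, indicator_of_mem (hTΩ x hx)]
  calc _ ≤ ∫⁻ x in T, ∫⁻ y in T, (L : ℝ≥0∞) ^ a * gagliardo p a φ (Ψ x) (Ψ y) :=
        setLIntegral_mono' hT fun x hx => setLIntegral_mono' hT fun y hy =>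
          gagliardo_le_of_lipschitz ha hL0 h.lip (hval x hx) (hval y hy)
    _ ≤ ∫⁻ x in Ψ ⁻¹' Ω, ∫⁻ y in Ψ ⁻¹' Ω, (L : ℝ≥0∞) ^ a * gagliardo p a φ (Ψ x) (Ψ y) :=
        lintegral_mono' (Measure.restrict_mono hsub le_rfl) fun x => lintegral_mono_set hsub
    _ = ∫⁻ x in Ψ ⁻¹' Ω, (L : ℝ≥0∞) ^ a * ∫⁻ y in Ω, gagliardo p a φ (Ψ x) y := by
        refine lintegral_congr fun x => ?_
        rw [lintegral_const_mul' _ _ hLt,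
          h.preserving.setLIntegral_comp_preimage_emb hemb (fun y => gagliardo p a φ (Ψ x) y)]
    _ = _ := by
        rw [lintegral_const_mul' _ _ hLt, h.preserving.setLIntegral_comp_preimage_emb hemb
          (fun x => ∫⁻ y in Ω, gagliardo p a φ x y)]

/-- Push-forward of the Gagliardo seminorm from a flat chart. -/
lemma lintegral_gagliardo_chart_symm_le {Ψ : E d ≃ₜ E d} {L : ℝ≥0} (hL0 : 0 < L)
    (hL : LipschitzWith L Ψ.symm) (hΨ : MeasurePreserving Ψ volume volume) {a : ℝ} (ha : 0 ≤ a)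
    (g : E d → ℝ) {S : Set (E d)} (hS : MeasurableSet S) :
    ∫⁻ x in Ψ.symm ⁻¹' S, ∫⁻ y in Ψ.symm ⁻¹' S, gagliardo p a (g ∘ Ψ.symm) x y ≤
      (L : ℝ≥0∞) ^ a * ∫⁻ x in S, ∫⁻ y in S, gagliardo p a g x y := by
  have hLt : (L : ℝ≥0∞) ^ a ≠ ∞ := ENNReal.rpow_ne_top_of_nonneg ha (by simp)
  have hΨ' : MeasurePreserving Ψ.symm volume volume := hΨ.symm Ψ.toMeasurableEquiv
  have hemb := Ψ.symm.measurableEmbedding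
  have hm : MeasurableSet (Ψ.symm ⁻¹' S) := Ψ.symm.continuous.measurable hS
  calc _ ≤ ∫⁻ x in Ψ.symm ⁻¹' S, ∫⁻ y in Ψ.symm ⁻¹' S,
          (L : ℝ≥0∞) ^ a * gagliardo p a g (Ψ.symm x) (Ψ.symm y) :=
        lintegral_mono fun x => lintegral_mono fun y =>
          gagliardo_le_of_lipschitz ha hL0 hL rfl rfl
    _ = ∫⁻ x in Ψ.symm ⁻¹' S, (L : ℝ≥0∞) ^ a * ∫⁻ y in S, gagliardo p a g (Ψ.symm x) y := by
        refine lintegral_congr fun x => ?_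
        rw [lintegral_const_mul' _ _ hLt,
          hΨ'.setLIntegral_comp_preimage_emb hemb (fun y => gagliardo p a g (Ψ.symm x) y)]
    _ = _ := by
        rw [lintegral_const_mul' _ _ hLt, hΨ'.setLIntegral_comp_preimage_emb hemb
          (fun x => ∫⁻ y in S, gagliardo p a g x y)]

/-- Splitting of the seminorm of a localized function into near and far interactions. -/
lemma lintegral_cutoff_le (hΩ : IsOpen Ω) (hs0 : 0 ≤ s) (hp : 1 ≤ p) {η : E d → ℝ} {M : ℝ≥0∞}
    (hM : ∀ x, ‖η x‖ₑ ≤ M) {S : Set (E d)} (hS : MeasurableSet S) {ρ : ℝ}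
    (hηS : ∀ x ∈ Ω, ∀ y ∈ Ω, η y ≠ 0 → dist y x < ρ → x ∈ S ∧ y ∈ S) {w : E d → ℝ}
    (hw : Measurable w) :
    ∫⁻ x in Ω, ∫⁻ y in Ω ∩ Metric.ball x (bdist Ω x),
        ‖η y‖ₑ ^ p * ‖w y - w x‖ₑ ^ p / ENNReal.ofReal (bdist Ω x) ^ ((d : ℝ) + p * s) ≤
      M ^ p * (∫⁻ x in S, ∫⁻ y in S, gagliardo p ((d : ℝ) + p * s) w x y) +
        M ^ p * (2 ^ (p - 1) / ENNReal.ofReal ρ ^ ((d : ℝ) + p * s)) * (2 * volume Ω) *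
          ∫⁻ x in Ω, ‖w x‖ₑ ^ p := by
  have hp0 : 0 < p := by linarith
  set a : ℝ := (d : ℝ) + p * s with ha
  have ha0 : 0 ≤ a := by positivity
  have hG := measurable_gagliardo (p := p) (a := a) hw
  set N : E d → E d → ℝ≥0∞ := fun x y =>
    M ^ p * (S ×ˢ S).indicator (Function.uncurry (gagliardo p a w)) (x, y) with hN
  have hNm : Measurable (Function.uncurry N) :=
    (hG.indicator (hS.prod hS)).const_mul _
  set c : ℝ≥0∞ := M ^ p * (2 ^ (p - 1) / ENNReal.ofReal ρ ^ a) with hc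
  have hpt : ∀ x ∈ Ω, ∀ y ∈ Ω ∩ Metric.ball x (bdist Ω x),
      ‖η y‖ₑ ^ p * ‖w y - w x‖ₑ ^ p / ENNReal.ofReal (bdist Ω x) ^ a ≤
        N x y + c * (‖w y‖ₑ ^ p + ‖w x‖ₑ ^ p) := by
    rintro x hx y ⟨hy, hyx⟩
    rw [Metric.mem_ball] at hyx
    have hηM : ‖η y‖ₑ ^ p ≤ M ^ p := ENNReal.rpow_le_rpow (hM y) hp0.le
    by_cases hη0 : η y = 0
    · simp [hη0, hp0]
    -- For near pairs `|y - x| < δ(x)` makes the kernel smaller than the Gagliardo kernel; for far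
    -- pairs `δ(x) ≥ ρ` bounds it, leaving an `L^p` term.
    by_cases hnear : dist y x < ρ
    · refine le_trans ?_ le_self_add
      have hmem : (x, y) ∈ S ×ˢ S := hηS x hx y hy hη0 hnear
      simp only [hN]
      rw [indicator_of_mem hmem, mul_div_assoc]
      refine mul_le_mul' hηM (ENNReal.div_le_div_left (ENNReal.rpow_le_rpow ?_ ha0) _)
      rw [← dist_eq_norm]
      exact ENNReal.ofReal_le_ofReal hyx.le
    · refine le_trans ?_ le_add_self
      have hρx : ρ ≤ bdist Ω x := (not_lt.1 hnear).trans hyx.le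
      calc _ ≤ M ^ p * (2 ^ (p - 1) * (‖w y‖ₑ ^ p + ‖w x‖ₑ ^ p)) / ENNReal.ofReal ρ ^ a := by
            refine ENNReal.div_le_div (mul_le_mul' hηM (enorm_sub_rpow_le hp _ _)) ?_
            exact ENNReal.rpow_le_rpow (ENNReal.ofReal_le_ofReal hρx) ha0
        _ = _ := by
            rw [hc, div_eq_mul_inv, div_eq_mul_inv]
            ring
  have hNS : ∫⁻ x in Ω, ∫⁻ y in Ω, N x y ≤
      M ^ p * ∫⁻ x in S, ∫⁻ y in S, gagliardo p a w x y := by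
    calc _ ≤ ∫⁻ x, ∫⁻ y, N x y := lintegral_mono' Measure.restrict_le_self fun x =>
          lintegral_mono' Measure.restrict_le_self le_rfl
      _ = ∫⁻ x, S.indicator (fun x => M ^ p * ∫⁻ y in S, gagliardo p a w x y) x := by
          refine lintegral_congr fun x => ?_
          by_cases hx : x ∈ S
          · rw [indicator_of_mem hx, ← lintegral_const_mul _ hG.of_uncurry_left,
              ← lintegral_indicator hS]
            refine lintegral_congr fun y => ?_
            by_cases hy : y ∈ S <;> simp [hN, hx, hy]
          · simp [hN, hx]
      _ = _ := by
          rw [lintegral_indicator hS, lintegral_const_mul]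
          exact hG.lintegral_prod_right' (ν := volume.restrict S)
  calc _ ≤ ∫⁻ x in Ω, ∫⁻ y in Ω, (N x y + c * (‖w y‖ₑ ^ p + ‖w x‖ₑ ^ p)) :=
        setLIntegral_mono' hΩ.measurableSet fun x hx =>
          (setLIntegral_mono' (hΩ.measurableSet.inter measurableSet_ball) (hpt x hx)).trans
            (lintegral_mono_set inter_subset_left)
    _ = (∫⁻ x in Ω, ∫⁻ y in Ω, N x y) +
          ∫⁻ x in Ω, ∫⁻ y in Ω, c * (‖w y‖ₑ ^ p + ‖w x‖ₑ ^ p) := by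
        have hNi : Measurable fun x => ∫⁻ y in Ω, N x y :=
          hNm.lintegral_prod_right' (ν := volume.restrict Ω)
        rw [← lintegral_add_left hNi]
        refine lintegral_congr fun x => ?_
        exact lintegral_add_left hNm.of_uncurry_left _
    _ ≤ _ := by
        rw [lintegral_lintegral_add_rpow hw]
        exact add_le_add hNS le_rfl

/-- Near a boundary point, localizations of functions in `W^{s,p}` belong to `W`. -/
lemma exists_boundary_localization (hΩ : IsOpen Ω) (hb : Bornology.IsBounded Ω)
    (hs0 : 0 ≤ s) (hs1 : s ≤ 1) (hp : 1 < p) {b : E d} (hbΩ : b ∈ frontier Ω) {Ψ : E d ≃ₜ E d}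
    {k : Fin d} {L : ℝ≥0} {R : ℝ} (h : IsFlatChart Ω b Ψ k L R) (φ : LpΩ Ω p)
    (hφ : MemSobolev s φ) :
    ∃ U : Set (E d), IsOpen U ∧ b ∈ U ∧ ∀ η : E d → ℝ, (∃ K, LipschitzWith K η) →
      (∃ M : ℝ≥0, ∀ x, ‖η x‖ₑ ≤ M) → Function.support η ⊆ U → ∀ w : LpΩ Ω p,
        (w =ᵐ[volume.restrict Ω] fun x => η x * φ x) → w ∈ W Ω s p hp.le := by
  have hp0 : 0 < p := by linarith
  have hfact : Fact (1 ≤ ENNReal.ofReal p) := ofReal_p_one_le hp.le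
  have hΩm := hΩ.measurableSet
  have hfr : (frontier Ω).Nonempty := ⟨b, hbΩ⟩
  obtain ⟨D, hD0, hDb, -⟩ := exists_bdist_bound hb hfr
  have hR := h.pos
  have hL0 : 0 < L := h.L_pos
  have hLr : (0 : ℝ) < L := h.L_pos
  set a : ℝ := (d : ℝ) + p * s with ha
  have ha0 : 0 ≤ a := by positivity
  set c := Ψ.symm b with hc
  set r : ℝ := R / 4 with hr
  have hr0 : 0 < r := by positivity
  have hck : Continuous fun y : E d => y k := (EuclideanSpace.proj k).continuous
  -- `S` is where the averaged function is evaluated and `T` where it samples `f`: shifts shorter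
  -- than `r` with positive `k`-th coordinate carry `S` into `T`, still inside the chart.
  set S : Set (E d) := {x | dist x c < 2 * r ∧ 0 < x k} with hS
  set T : Set (E d) := {x | dist x c < 3 * r ∧ 0 < x k} with hT
  have hSm : MeasurableSet S :=
    (isOpen_lt (continuous_id.dist continuous_const) continuous_const).measurableSet.inter
      (isOpen_lt continuous_const hck).measurableSet
  have hTm : MeasurableSet T :=
    (isOpen_lt (continuous_id.dist continuous_const) continuous_const).measurableSet.inter
      (isOpen_lt continuous_const hck).measurableSet
  have hTΩ : ∀ x ∈ T, Ψ x ∈ Ω := fun x hx => (h.mem_iff x (by linarith [hx.1])).2 hx.2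
  set f : E d → ℝ := Ω.indicator φ ∘ Ψ with hf
  have hfm : Measurable f :=
    ((measurable_coeFn φ).indicator hΩm).comp Ψ.continuous.measurable
  have hfLp : MemLp f (ENNReal.ofReal p) volume :=
    (memLp_indicator hΩm φ).comp_measurePreserving h.preserving
  have hfint : Integrable f volume :=
    (h.preserving.integrable_comp_emb Ψ.measurableEmbedding).2
      ((integrable_of_memLp hb hp.le φ).integrable_indicator hΩm)
  set Φ : ℝ≥0∞ := ∫⁻ x, ‖f x‖ₑ ^ p with hΦ
  have hΦt : Φ ≠ ∞ := by
    rw [hΦ, lintegral_eq_eLpNorm_rpow hp0]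
    exact ENNReal.rpow_ne_top_of_nonneg hp0.le hfLp.eLpNorm_ne_top
  set G : ℝ≥0∞ := ∫⁻ x in Ω, ∫⁻ y in Ω, gagliardo p a φ x y with hG
  have hGt : G ≠ ∞ := hφ.ne
  refine ⟨Ψ.symm ⁻¹' Metric.ball c r, Metric.isOpen_ball.preimage Ψ.symm.continuous,
    by simpa [hc] using hr0, ?_⟩
  rintro η ⟨K, hK⟩ ⟨M, hM⟩ hsupp w hw
  have hcl : IsCompact (closure Ω) := Metric.isCompact_of_isClosed_isBounded isClosed_closure hb.closure
  have hηS : ∀ x ∈ Ω, ∀ y ∈ Ω, η y ≠ 0 → dist y x < r / L →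
      x ∈ Ψ.symm ⁻¹' S ∧ y ∈ Ψ.symm ⁻¹' S := by
    intro x hx y hy hη0 hyx
    have h1 : dist (Ψ.symm y) c < r := hsupp hη0
    have h2 : dist (Ψ.symm x) (Ψ.symm y) < r := by
      refine (h.lip_symm.dist_le_mul x y).trans_lt ?_
      rw [dist_comm, lt_div_iff₀' hLr] at hyx
      exact hyx
    have h3 := dist_triangle (Ψ.symm x) (Ψ.symm y) c
    have h4 : ∀ z ∈ Ω, dist (Ψ.symm z) c < 2 * r → Ψ.symm z ∈ S := fun z hz hzc =>
      ⟨hzc, (h.mem_iff _ (by linarith)).1 (by rwa [Ψ.apply_symm_apply])⟩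
    exact ⟨h4 x hx (by linarith), h4 y hy (by linarith)⟩
  -- `C₁` and `C₂` do not depend on the accuracy `ε` below, as `mem_W_of_bounded_approx` requires.
  set C₁ : ℝ≥0∞ := (M : ℝ≥0∞) ^ p * ((L : ℝ≥0∞) ^ a * ((L : ℝ≥0∞) ^ a * G)) +
    (M : ℝ≥0∞) ^ p * (2 ^ (p - 1) / ENNReal.ofReal (r / L) ^ a) * (2 * volume Ω) * Φ with hC₁
  set C₂ : ℝ≥0∞ := (K : ℝ≥0∞) ^ p * volume (Metric.ball (0 : E d) 1) *
    ENNReal.ofReal D ^ (p * (1 - s)) with hC₂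
  have hM' : (2 : ℝ≥0∞) ^ (p - 1) * (C₁ + C₂ * Φ) ≠ ∞ := by
    have e1 : (2 : ℝ≥0∞) ^ (p - 1) ≠ ∞ := ENNReal.rpow_ne_top_of_nonneg (by linarith) (by simp)
    have e2 : (M : ℝ≥0∞) ^ p ≠ ∞ := ENNReal.rpow_ne_top_of_nonneg hp0.le (by simp)
    have e3 : (L : ℝ≥0∞) ^ a ≠ ∞ := ENNReal.rpow_ne_top_of_nonneg ha0 (by simp)
    have e4 : (K : ℝ≥0∞) ^ p ≠ ∞ := ENNReal.rpow_ne_top_of_nonneg hp0.le (by simp)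
    have e5 : ENNReal.ofReal (r / L) ^ a ≠ 0 :=
      (ENNReal.rpow_pos (ENNReal.ofReal_pos.2 (by positivity)) ENNReal.ofReal_ne_top).ne'
    have e6 : ENNReal.ofReal D ^ (p * (1 - s)) ≠ ∞ := ENNReal.rpow_ne_top_of_nonneg
      (mul_nonneg hp0.le (by linarith)) ENNReal.ofReal_ne_top
    have e7 : volume (Metric.ball (0 : E d) 1) ≠ ∞ := measure_ball_lt_top.ne
    have e8 := volume_ne_top_of_isBounded hb
    refine ENNReal.mul_ne_top e1 (ENNReal.add_ne_top.2 ⟨ENNReal.add_ne_top.2 ⟨?_, ?_⟩, ?_⟩)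
    · exact ENNReal.mul_ne_top e2 (ENNReal.mul_ne_top e3 (ENNReal.mul_ne_top e3 hGt))
    · exact ENNReal.mul_ne_top (ENNReal.mul_ne_top (ENNReal.mul_ne_top e2
        (ENNReal.div_ne_top e1 e5)) (ENNReal.mul_ne_top (by simp) e8)) hΦt
    · exact ENNReal.mul_ne_top (ENNReal.mul_ne_top (ENNReal.mul_ne_top e4 e7) e6) hΦt
  refine mem_W_of_bounded_approx hp w hM' fun ε hε => ?_
  obtain ⟨ε', hε', hεM⟩ : ∃ ε' : ℝ≥0∞, 0 < ε' ∧ (M : ℝ≥0∞) ^ p * ε' < ENNReal.ofReal ε ^ p := by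
    obtain ⟨ε', h1, h2⟩ := ENNReal.exists_pos_mul_lt
      (ENNReal.rpow_ne_top_of_nonneg hp0.le (by simp) : (M : ℝ≥0∞) ^ p ≠ ∞)
      (ENNReal.rpow_pos (ENNReal.ofReal_pos.2 hε) ENNReal.ofReal_ne_top : 0 < ENNReal.ofReal ε ^ p).ne'
    exact ⟨ε', h1, by rwa [mul_comm]⟩
  obtain ⟨δ, hδ, hδb⟩ := exists_translation_bound hp.le hfLp hε'
  set t : ℝ := min δ r / 2 with ht
  have ht0 : 0 < t := by positivity
  have htδ : 2 * t ≤ δ := by rw [ht]; linarith [min_le_left δ r]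
  have htr : 2 * t ≤ r := by rw [ht]; linarith [min_le_right δ r]
  -- Centred at height `t` with radius `t/2`, the average uses only strictly upward shifts. It
  -- therefore never samples `f` across the flat boundary, and no extension of `φ` is needed.
  obtain ⟨P, hPprob, hPball, hP⟩ := exists_smoothing (EuclideanSpace.single k t : E d)
    (r := t / 2) (by positivity)
  obtain ⟨hPint, Q, hQ⟩ := hP f hfint
  have hz : ∀ᵐ z ∂P, ‖z‖ < 2 * t ∧ 0 < z k := by
    filter_upwards [hPball] with z hz
    constructor
    · have h1 := norm_le_norm_add_norm_sub' z (EuclideanSpace.single k t)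
      rw [← dist_eq_norm] at h1
      have h2 : ‖(EuclideanSpace.single k t : E d)‖ = t := by simp [abs_of_pos ht0]
      linarith
    · have h1 := (abs_coord_sub_le z (EuclideanSpace.single k t) k).trans_lt hz
      rw [PiLp.single_apply, if_pos rfl] at h1
      linarith [(abs_lt.1 h1).1]
  set g : E d → ℝ := fun x => ∫ z, f (x + z) ∂P with hg
  set v : E d → ℝ := fun x => η x * (g ∘ Ψ.symm) x with hv
  have hglip : LipschitzWith (Q * L) (g ∘ Ψ.symm) := hQ.comp h.lip_symm
  have hgm : Measurable (g ∘ Ψ.symm) := hglip.continuous.measurable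
  obtain ⟨N, hN⟩ := lipschitzOnWith_mul hK hglip hcl
  have hΨ' : MeasurePreserving Ψ.symm volume volume := h.preserving.symm Ψ.toMeasurableEquiv
  have hgΦ : ∫⁻ x in Ω, ‖(g ∘ Ψ.symm) x‖ₑ ^ p ≤ Φ := by
    calc _ ≤ ∫⁻ x, ‖(g ∘ Ψ.symm) x‖ₑ ^ p := lintegral_mono' Measure.restrict_le_self le_rfl
      _ = ∫⁻ x, ‖g x‖ₑ ^ p :=
          hΨ'.lintegral_comp_emb Ψ.symm.measurableEmbedding (fun x => ‖g x‖ₑ ^ p)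
      _ ≤ Φ := lintegral_average_le P hp.le hfm
  have hvc : Continuous v := hK.continuous.mul hglip.continuous
  have hvLp : MemLp v (ENNReal.ofReal p) (volume.restrict Ω) := by
    obtain ⟨B, hB⟩ := hcl.exists_bound_of_continuousOn hvc.continuousOn
    have : IsFiniteMeasure (volume.restrict Ω) :=
      ⟨by rw [Measure.restrict_apply_univ]; exact hb.measure_lt_top⟩
    refine MemLp.of_bound hvc.aestronglyMeasurable B ?_
    filter_upwards [ae_restrict_mem hΩm] with x hx using hB x (subset_closure hx)
  refine ⟨hvLp.toLp v, ⟨v, ⟨⟨N, hN⟩, closure Ω, hcl, fun x hx hx' => absurd hx hx'⟩,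
    hvLp.coeFn_toLp⟩, ?_, ?_⟩
  · have h1 : ‖hvLp.toLp v - w‖ₑ ^ p ≤ ENNReal.ofReal ε ^ p := by
      rw [Lp.enorm_def, ← lintegral_eq_eLpNorm_rpow hp0]
      calc _ = ∫⁻ x in Ω, ‖η x‖ₑ ^ p * ‖(g ∘ Ψ.symm) x - (f ∘ Ψ.symm) x‖ₑ ^ p := by
            refine lintegral_congr_ae ?_
            filter_upwards [Lp.coeFn_sub (hvLp.toLp v) w, hvLp.coeFn_toLp, hw,
              ae_restrict_mem hΩm] with x h1 h2 h3 hx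
            have h4 : (f ∘ Ψ.symm) x = φ x := by
              simp [hf, hx]
            rw [h1, Pi.sub_apply, h2, h3, h4, ← ENNReal.mul_rpow_of_nonneg _ _ hp0.le, ← enorm_mul,
              mul_sub]
        _ ≤ ∫⁻ x in Ω, (M : ℝ≥0∞) ^ p * ‖(g ∘ Ψ.symm) x - (f ∘ Ψ.symm) x‖ₑ ^ p := by
            refine lintegral_mono fun x => mul_le_mul' (ENNReal.rpow_le_rpow (hM x) hp0.le) le_rfl
        _ ≤ ∫⁻ x, (M : ℝ≥0∞) ^ p * ‖(g ∘ Ψ.symm) x - (f ∘ Ψ.symm) x‖ₑ ^ p :=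
            lintegral_mono' Measure.restrict_le_self le_rfl
        _ = (M : ℝ≥0∞) ^ p * ∫⁻ x, ‖g x - f x‖ₑ ^ p := by
            rw [lintegral_const_mul' _ _ (ENNReal.rpow_ne_top_of_nonneg hp0.le (by simp))]
            congr 1
            exact hΨ'.lintegral_comp_emb Ψ.symm.measurableEmbedding (fun x => ‖g x - f x‖ₑ ^ p)
        _ ≤ (M : ℝ≥0∞) ^ p * ε' := by
            refine mul_le_mul' le_rfl (lintegral_average_sub_le P hp.le hfm hPint ?_)
            filter_upwards [hz] with z hz
            exact hδb z (hz.1.trans_le htδ)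
        _ ≤ _ := hεM.le
    rw [ENNReal.rpow_le_rpow_iff hp0, ← ofReal_norm, ENNReal.ofReal_le_ofReal_iff hε.le] at h1
    exact h1
  · rw [semiPow_congr hvLp.coeFn_toLp]
    refine (semiPow_mul_le hΩ hs1 hp.le (fun x hx => bdist_pos hΩ hfr hx) hDb hK hgm).trans ?_
    refine mul_le_mul' le_rfl (add_le_add ?_ (mul_le_mul' le_rfl hgΦ))
    refine (lintegral_cutoff_le hΩ hs0 hp.le hM (Ψ.symm.continuous.measurable hSm)
      (ρ := r / L) hηS hgm).trans ?_
    refine add_le_add (mul_le_mul' le_rfl ?_) (mul_le_mul' le_rfl hgΦ)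
    refine (lintegral_gagliardo_chart_symm_le hL0 h.lip_symm h.preserving ha0 g hSm).trans ?_
    refine mul_le_mul' le_rfl ((lintegral_gagliardo_average_le P hp.le hfm hPint hSm hTm ?_).trans
      (lintegral_gagliardo_chart_le h ha0 φ hTm hTΩ))
    filter_upwards [hz] with z hz x hx
    refine ⟨?_, ?_⟩
    · have h1 : dist (x + z) x = ‖z‖ := by rw [dist_self_add_left]
      have h2 := dist_triangle (x + z) x c
      have h3 := hx.1
      linarith [hz.1]
    · rw [PiLp.add_apply]
      exact add_pos hx.2 hz.2

end HetLoc

/-! ### Sobolev functions, closedness of `W` and bounds for the energy -/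

namespace HetLoc
open Filter Topology
open scoped Manifold

variable {d : ℕ} {Ω : Set (E d)} {s p : ℝ}

/-- The fractional Sobolev space `W^{s,p}` is contained in `W`. -/
lemma mem_W_of_memSobolev (hd : 1 ≤ d) (hΩ : IsLipschitzDomain Ω) (hb : Bornology.IsBounded Ω)
    (hs0 : 0 ≤ s) (hs1 : s ≤ 1) (hp : 1 < p) (φ : LpΩ Ω p) (hφ : MemSobolev s φ) :
    φ ∈ W Ω s p hp.le := by
  have hΩm := hΩ.1.measurableSet
  have hfact : Fact (1 ≤ ENNReal.ofReal p) := ofReal_p_one_le hp.le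
  have hloc : ∀ b ∈ closure Ω, ∃ U : Set (E d), IsOpen U ∧ b ∈ U ∧ ∀ η : E d → ℝ,
      (∃ K, LipschitzWith K η) → (∃ M : ℝ≥0, ∀ x, ‖η x‖ₑ ≤ M) → HasCompactSupport η →
      tsupport η ⊆ U → ∀ w : LpΩ Ω p, (w =ᵐ[volume.restrict Ω] fun x => η x * φ x) →
        w ∈ W Ω s p hp.le := by
    intro b hbc
    -- Interior pieces have compact support in `Ω` and already lie in `W₀`; only boundary pieces
    -- need a chart.
    by_cases hbΩ : b ∈ Ω
    · refine ⟨Ω, hΩ.1, hbΩ, fun η _ _ hc hsupp w hw => W₀_subset_W hp.le ?_⟩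
      refine mem_W₀_of_compact_support hd hΩ.1 hb hs0 hp.le hc hsupp w ?_
      filter_upwards [hw] with x hx hxs
      rw [hx, image_eq_zero_of_notMem_tsupport hxs, zero_mul]
    · have hbf : b ∈ frontier Ω := by
        rw [hΩ.1.frontier_eq]
        exact ⟨hbc, hbΩ⟩
      obtain ⟨Ψ, k, L, R, hch⟩ := exists_flatChart hΩ hbf
      obtain ⟨U, hU, hbU, h⟩ := exists_boundary_localization hΩ.1 hb hs0 hs1 hp hbf hch φ hφ
      exact ⟨U, hU, hbU, fun η hK hM _ hsupp => h η hK hM ((subset_tsupport η).trans hsupp)⟩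
  choose! U hU hbU hloc using hloc
  have hcl : IsCompact (closure Ω) :=
    Metric.isCompact_of_isClosed_isBounded isClosed_closure hb.closure
  -- Intersecting with unit balls gives the partition functions compact support, hence global
  -- Lipschitz bounds.
  obtain ⟨t, ht, htU⟩ := hcl.elim_nhds_subcover (fun b => U b ∩ Metric.ball b 1) fun b hbc =>
    Filter.inter_mem ((hU b hbc).mem_nhds (hbU b hbc)) (Metric.ball_mem_nhds b one_pos)
  obtain ⟨ρ, hρ⟩ := SmoothPartitionOfUnity.exists_isSubordinate 𝓘(ℝ, E d) isClosed_closure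
    (s := closure Ω) (fun b : t => U b ∩ Metric.ball (b : E d) 1)
    (fun b => (hU b (ht b b.2)).inter Metric.isOpen_ball)
    (fun x hx => by
      obtain ⟨b, hbt, hxb⟩ := mem_iUnion₂.1 (htU hx)
      exact mem_iUnion.2 ⟨⟨b, hbt⟩, hxb⟩)
  have hρc : ∀ b : t, HasCompactSupport (ρ b) := fun b => by
    refine Metric.isCompact_of_isClosed_isBounded (isClosed_tsupport _) ?_
    exact Metric.isBounded_ball.subset ((hρ b).trans inter_subset_right)
  have hρs : ∀ b : t, ContDiff ℝ 1 (ρ b) := fun b =>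
    ((ρ b).contMDiff.contDiff).of_le (by exact_mod_cast le_top)
  have hρlip : ∀ b : t, ∃ K, LipschitzWith K (ρ b) := fun b =>
    ContDiff.lipschitzWith_of_hasCompactSupport (hρc b) (hρs b) one_ne_zero
  have hρ1 : ∀ (b : t) x, ‖ρ b x‖ ≤ 1 := fun b x => by
    rw [Real.norm_of_nonneg (ρ.nonneg b x)]
    exact ρ.le_one b x
  have hmem : ∀ b : t, MemLp (fun x => ρ b x * φ x) (ENNReal.ofReal p) (volume.restrict Ω) :=
    fun b => by
      refine (Lp.memLp φ).of_le ?_ (Eventually.of_forall fun x => ?_)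
      · exact ((hρs b).continuous.measurable.mul (measurable_coeFn φ)).aestronglyMeasurable
      · rw [norm_mul]
        exact mul_le_of_le_one_left (norm_nonneg _) (hρ1 b x)
  have hW : ∀ b : t, (hmem b).toLp _ ∈ W Ω s p hp.le := fun b =>
    hloc b (ht b b.2) (ρ b) (hρlip b) ⟨1, fun x => by
      rw [← ofReal_norm, ENNReal.coe_one, ← ENNReal.ofReal_one]
      exact ENNReal.ofReal_le_ofReal (hρ1 b x)⟩ (hρc b) ((hρ b).trans inter_subset_left) _
      (hmem b).coeFn_toLp
  have hsum : φ = ∑ b : t, (hmem b).toLp _ := by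
    refine Lp.ext ?_
    have h1 : ∀ᵐ x ∂(volume.restrict Ω), ∀ b : t, (hmem b).toLp _ x = ρ b x * φ x :=
      ae_all_iff.2 fun b => (hmem b).coeFn_toLp
    have h2 := Lp.coeFn_finsetSum Finset.univ fun b : t => (hmem b).toLp _
    filter_upwards [h1, h2, ae_restrict_mem hΩm] with x h1 h2 hx
    rw [h2, Finset.sum_apply]
    simp_rw [h1]
    rw [← Finset.sum_mul, ← finsum_eq_sum_of_fintype, ρ.sum_eq_one (subset_closure hx), one_mul]
  rw [hsum]
  exact Submodule.sum_mem _ fun b _ => hW b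

lemma mem_wClosure_of_tendsto (hp : 1 ≤ p) {P : (E d → ℝ) → Prop} {y : ℕ → LpΩ Ω p}
    {u : LpΩ Ω p} (hy : ∀ n, y n ∈ wClosure Ω s p P)
    (h : Tendsto (fun n => gPow Ω s p (y n - u : LpΩ Ω p)) atTop (𝓝 0)) :
    u ∈ wClosure Ω s p P := by
  have hp0 : 0 < p := by linarith
  simp only [mem_wClosure_iff hp0] at hy ⊢
  have h2 : (2 : ℝ≥0∞) ^ (p - 1) ≠ ∞ := ENNReal.rpow_ne_top_of_nonneg (by linarith) (by simp)
  constructor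
  · obtain ⟨n, hn⟩ := (h.eventually (gt_mem_nhds one_pos)).exists
    have h3 := gPow_Lp_add_le (s := s) hp (u - y n) (y n)
    rw [sub_add_cancel] at h3
    refine h3.trans_lt (ENNReal.mul_lt_top h2.lt_top (ENNReal.add_lt_top.2 ⟨?_, (hy n).1⟩))
    rw [gPow_sub_comm]
    exact hn.trans ENNReal.one_lt_top
  · intro ε hε
    obtain ⟨ε', hε', hlt⟩ := ENNReal.exists_pos_mul_lt (ENNReal.mul_ne_top h2 (by simp :
      (2 : ℝ≥0∞) ≠ ∞)) hε.ne'
    obtain ⟨n, hn⟩ := (h.eventually (gt_mem_nhds (show (0 : ℝ≥0∞) < ε' from hε'))).exists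
    obtain ⟨w, hw, hwy⟩ := (hy n).2 ε' hε'
    refine ⟨w, hw, lt_of_le_of_lt ?_ hlt⟩
    have h3 := gPow_Lp_add_le (s := s) hp (u - y n) (y n - w)
    rw [sub_add_sub_cancel] at h3
    refine h3.trans ?_
    rw [gPow_sub_comm u]
    calc _ ≤ 2 ^ (p - 1) * (ε' + ε') := by gcongr
      _ = _ := by ring

lemma IsLipCompact.midpoint {u v : E d → ℝ} (hu : IsLipCompact Ω u) (hv : IsLipCompact Ω v) :
    IsLipCompact Ω ((1 / 2 : ℝ) • (u + v)) := by
  obtain ⟨⟨L, hL⟩, hc, hs⟩ := hu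
  obtain ⟨⟨M, hM⟩, hc', hs'⟩ := hv
  have hsub : tsupport ((1 / 2 : ℝ) • (u + v)) ⊆ tsupport u ∪ tsupport v := by
    refine closure_minimal (fun x hx => ?_) ((isClosed_tsupport u).union (isClosed_tsupport v))
    by_contra hn
    rw [mem_union, not_or] at hn
    refine hx ?_
    simp [image_eq_zero_of_notMem_tsupport hn.1, image_eq_zero_of_notMem_tsupport hn.2]
  refine ⟨⟨_, (lipschitzWith_smul (1 / 2 : ℝ)).comp (hL.add hM)⟩, ?_,
    hsub.trans (union_subset hs hs')⟩
  exact (hc.isCompact.union hc'.isCompact).of_isClosed_subset (isClosed_tsupport _) hsub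

/-- The factor `1/2` cancels the constant `2` of the quasi-triangle inequality. -/
lemma wNorm_midpoint_le (hp : 1 ≤ p) (u v : LpΩ Ω p) :
    wNorm Ω s p ((1 / 2 : ℝ) • (u + v) : LpΩ Ω p) ≤ wNorm Ω s p u + wNorm Ω s p v := by
  refine (wNorm_smul_le hp _ _).trans ?_
  have h1 : ‖(1 / 2 : ℝ)‖ₑ = ENNReal.ofReal (1 / 2) := by
    rw [← ofReal_norm, Real.norm_of_nonneg (by norm_num)]
  calc _ ≤ ENNReal.ofReal (1 / 2) * (2 * (wNorm Ω s p u + wNorm Ω s p v)) := by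
        rw [h1]
        exact mul_le_mul' le_rfl (wNorm_add_le hp u v)
    _ = _ := by
        have h2 : ENNReal.ofReal (1 / 2) * ENNReal.ofReal 2 = 1 := by
          rw [← ENNReal.ofReal_mul (by norm_num)]
          norm_num
        rw [ENNReal.ofReal_ofNat] at h2
        rw [← mul_assoc, h2, one_mul]

lemma W₀_midpoint (hp : 1 ≤ p) {u v : LpΩ Ω p} (hu : u ∈ W₀ Ω s p) (hv : v ∈ W₀ Ω s p) :
    (1 / 2 : ℝ) • (u + v) ∈ W₀ Ω s p := by
  obtain ⟨hu, hu'⟩ := hu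
  obtain ⟨hv, hv'⟩ := hv
  refine ⟨(wNorm_midpoint_le hp u v).trans_lt (ENNReal.add_lt_top.2 ⟨hu, hv⟩), fun ε hε => ?_⟩
  obtain ⟨w, ⟨a, ha, hwa⟩, hw⟩ := hu' (ε / 2) (ENNReal.half_pos hε.ne')
  obtain ⟨z, ⟨b, hb, hzb⟩, hz⟩ := hv' (ε / 2) (ENNReal.half_pos hε.ne')
  refine ⟨(1 / 2 : ℝ) • (w + z), ⟨_, ha.midpoint hb, (Lp.coeFn_smul _ _).trans
    (((Lp.coeFn_add w z).trans (hwa.add hzb)).const_smul _)⟩, ?_⟩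
  have h1 : (1 / 2 : ℝ) • (u + v) - (1 / 2 : ℝ) • (w + z) =
      (1 / 2 : ℝ) • ((u - w) + (v - z)) := by module
  rw [h1]
  refine (wNorm_midpoint_le hp _ _).trans_lt ?_
  calc _ < ε / 2 + ε / 2 := ENNReal.add_lt_add hw hz
    _ = ε := ENNReal.add_halves ε

/-! ### Two-sided bounds and lower semicontinuity of the energy. -/

section Energy

variable {A : E d → E d → ℝ} {F : ℝ → ℝ}

lemma ae_pairMeasure_mem (hΩm : MeasurableSet Ω) :
    ∀ᵐ z ∂(pairMeasure Ω s p), z.1 ∈ Ω ∧ z.2 ∈ Ω :=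
  ae_pairMeasure_of_ae (ae_restrict_mem hΩm)

lemma le_energy (hA : AEMeasurable (Function.uncurry A) ((volume.restrict Ω).prod (volume.restrict Ω)))
    (hΩm : MeasurableSet Ω) (hp : 0 ≤ p) (hFm : Measurable F) {α c : ℝ} (hα : 0 ≤ α) (hc : 0 ≤ c)
    (hAα : ∀ x ∈ Ω, ∀ y ∈ Ω, α ≤ A x y) (hF : ∀ t, c * |t| ^ p ≤ F t) (u : LpΩ Ω p) :
    ENNReal.ofReal (α * c) * semiPow Ω s p u ≤ energy s A F u := by
  rw [energy_eq_lintegral hA hFm, semiPow_eq_lintegral (measurable_coeFn u),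
    ← lintegral_const_mul' _ _ ENNReal.ofReal_ne_top]
  refine lintegral_mono_ae ?_
  filter_upwards [ae_pairMeasure_mem hΩm] with z hz
  rw [enorm_rpow_eq _ hp, ← ENNReal.ofReal_mul (by positivity), mul_assoc]
  refine ENNReal.ofReal_le_ofReal (mul_le_mul (hAα _ hz.1 _ hz.2) (hF _) (by positivity) ?_)
  exact hα.trans (hAα _ hz.1 _ hz.2)

lemma energy_le (hA : AEMeasurable (Function.uncurry A) ((volume.restrict Ω).prod (volume.restrict Ω)))
    (hΩm : MeasurableSet Ω) (hp : 0 ≤ p) (hFm : Measurable F) {α c : ℝ} (hc : 0 ≤ c)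
    (hAα : ∀ x ∈ Ω, ∀ y ∈ Ω, A x y ≤ α) (hF0 : ∀ t, 0 ≤ F t) (hF : ∀ t, F t ≤ c * |t| ^ p)
    (u : LpΩ Ω p) :
    energy s A F u ≤ ENNReal.ofReal (|α| * c) * semiPow Ω s p u := by
  rw [energy_eq_lintegral hA hFm, semiPow_eq_lintegral (measurable_coeFn u),
    ← lintegral_const_mul' _ _ ENNReal.ofReal_ne_top]
  refine lintegral_mono_ae ?_
  filter_upwards [ae_pairMeasure_mem hΩm] with z hz
  rw [enorm_rpow_eq _ hp, ← ENNReal.ofReal_mul (by positivity), mul_assoc]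
  refine ENNReal.ofReal_le_ofReal ?_
  calc _ ≤ |α| * F (u z.2 - u z.1) :=
        mul_le_mul_of_nonneg_right ((hAα _ hz.1 _ hz.2).trans (le_abs_self α)) (hF0 _)
    _ ≤ _ := mul_le_mul_of_nonneg_left (hF _) (abs_nonneg α)

lemma energy_le_of_tendsto [Fact (1 ≤ ENNReal.ofReal p)]
    (hA : AEMeasurable (Function.uncurry A) ((volume.restrict Ω).prod (volume.restrict Ω)))
    (hF : Continuous F) {y : ℕ → LpΩ Ω p} {u : LpΩ Ω p} (h : Tendsto y atTop (𝓝 u)) {C : ℝ≥0∞}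
    (hC : ∀ᶠ k in atTop, energy s A F (y k) ≤ C) : energy s A F u ≤ C := by
  rw [energy_eq_lintegral hA hF.measurable]
  refine lintegral_pair_le_of_tendsto h
    (H := fun z a b => ENNReal.ofReal (A z.1 z.2 * F (b - a))) (fun z => ?_) (fun w => ?_) ?_
  · exact ENNReal.continuous_ofReal.comp
      (continuous_const.mul (hF.comp (continuous_snd.sub continuous_fst)))
  · have hA' : AEMeasurable (fun z : E d × E d => A z.1 z.2) (pairMeasure Ω s p) :=
      hA.mono_ac pairMeasure_absolutelyContinuous
    have hw := measurable_coeFn w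
    refine (hA'.mul (Measurable.aemeasurable ?_)).ennreal_ofReal
    exact hF.measurable.comp ((hw.comp measurable_snd).sub (hw.comp measurable_fst))
  · filter_upwards [hC] with k hk
    rwa [← energy_eq_lintegral hA hF.measurable]

end Energy

/-- For `N > 1` one may replace `β` by `β * N` and divide by `N`, leaving a bound on `N ^ (p - 1)`.
-/
lemma le_max_of_rpow_le {p N α β : ℝ} (hp : 1 < p) (hN : 0 ≤ N) (hβ : 0 ≤ β)
    (h : N ^ p ≤ α * N + β) : N ≤ max 1 ((|α| + β) ^ (1 / (p - 1))) := by
  by_cases h1 : N ≤ 1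
  · exact h1.trans (le_max_left _ _)
  rw [not_le] at h1
  refine le_trans ?_ (le_max_right _ _)
  have hp1 : 0 < p - 1 := by linarith
  have hN0 : 0 < N := by linarith
  have h2 : N ^ (p - 1) * N ≤ (|α| + β) * N := by
    calc N ^ (p - 1) * N = N ^ p := by
          rw [← Real.rpow_add_one hN0.ne']
          congr 1
          ring
      _ ≤ α * N + β := h
      _ ≤ |α| * N + β * N := by
          have := mul_le_mul_of_nonneg_right (le_abs_self α) hN
          nlinarith
      _ = _ := by ring
  have h3 := le_of_mul_le_mul_right h2 hN0
  rw [one_div]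
  exact (Real.le_rpow_inv_iff_of_pos hN (by positivity) hp1).2 h3

end HetLoc

/-! ### Existence of a minimizer -/

namespace HetLoc
open Filter Topology

variable {d : ℕ} {Ω : Set (E d)} {s p : ℝ}

/-- On the affine space `φ + W₀`, the power of the norm is controlled by the seminorm. -/
lemma exists_gPow_le_semiPow (hd : 1 ≤ d) (hΩ : IsLipschitzDomain Ω) (hb : Bornology.IsBounded Ω)
    (hp : 1 < p) (hps : 1 < p * s) {φ : LpΩ Ω p} (hφ : gPow Ω s p φ < ∞) :
    ∃ B B' : ℝ≥0∞, B ≠ ∞ ∧ B' ≠ ∞ ∧ ∀ u : LpΩ Ω p, u - φ ∈ W₀ Ω s p →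
      gPow Ω s p u ≤ B * semiPow Ω s p u + B' := by
  obtain ⟨P, hP, hPoinc⟩ := exists_poincare_W₀ hd hΩ hb hp hps
  have h2 : (2 : ℝ≥0∞) ^ (p - 1) ≠ ∞ := ENNReal.rpow_ne_top_of_nonneg (by linarith) (by simp)
  set c := (2 : ℝ≥0∞) ^ (p - 1)
  have hφ' := ENNReal.add_lt_top.1 (show _ + _ < ∞ from hφ)
  refine ⟨c * P * c + 1, c * P * c * semiPow Ω s p φ + c * ∫⁻ x in Ω, ‖φ x‖ₑ ^ p, ?_, ?_,
    fun u hu => ?_⟩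
  · finiteness
  · have := hφ'.1.ne
    have := hφ'.2.ne
    finiteness
  · have h3 := lintegral_Lp_add_le hp.le (u - φ) φ
    rw [sub_add_cancel] at h3
    have h4 := semiPow_Lp_add_le (s := s) hp.le u (-φ)
    rw [← sub_eq_add_neg, semiPow_congr (Lp.coeFn_neg φ), semiPow_neg] at h4
    -- Poincaré's inequality is applied to `u - φ`, whose seminorm is at most that of `u` plus that
    -- of `φ`, up to `2 ^ (p - 1)`.
    calc gPow Ω s p u
        ≤ c * ((∫⁻ x in Ω, ‖(u - φ : LpΩ Ω p) x‖ₑ ^ p) + ∫⁻ x in Ω, ‖φ x‖ₑ ^ p)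
          + semiPow Ω s p u := add_le_add h3 le_rfl
      _ ≤ c * (P * (c * (semiPow Ω s p u + semiPow Ω s p φ)) + ∫⁻ x in Ω, ‖φ x‖ₑ ^ p)
          + semiPow Ω s p u := by
        refine add_le_add (mul_le_mul' le_rfl (add_le_add ?_ le_rfl)) le_rfl
        exact (hPoinc _ hu).trans (mul_le_mul' le_rfl h4)
      _ = _ := by ring

/-- Coercivity on `φ + W₀`: a sublinear bound on the seminorm power bounds the norm. -/
lemma exists_gPow_bound (hd : 1 ≤ d) (hΩ : IsLipschitzDomain Ω) (hb : Bornology.IsBounded Ω)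
    (hp : 1 < p) (hps : 1 < p * s) {φ : LpΩ Ω p} (hφ : gPow Ω s p φ < ∞)
    {κ : ℝ} (hκ : 0 < κ) (a : ℝ) (C : ℝ≥0) :
    ∃ M : ℝ≥0∞, M ≠ ∞ ∧ ∀ u : LpΩ Ω p, gPow Ω s p u < ∞ → u - φ ∈ W₀ Ω s p →
      κ * (semiPow Ω s p u).toReal ≤ a + C * (wNorm Ω s p u).toReal → gPow Ω s p u ≤ M := by
  have hp0 : 0 < p := by linarith
  obtain ⟨B, B', hB, hB', hBB⟩ := exists_gPow_le_semiPow hd hΩ hb hp hps hφ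
  set β := B.toReal / κ * |a| + B'.toReal
  set R := max 1 ((|B.toReal / κ * C| + β) ^ (1 / (p - 1)))
  refine ⟨ENNReal.ofReal R ^ p, ENNReal.rpow_ne_top_of_nonneg hp0.le ENNReal.ofReal_ne_top,
    fun u hu huφ hle => ?_⟩
  have hw : wNorm Ω s p u ≠ ∞ := ((wNorm_lt_top_iff hp0 _).2 hu).ne
  have hS : semiPow Ω s p u ≠ ∞ := (ENNReal.add_lt_top.1 (show _ + _ < ∞ from hu)).2.ne
  rw [← wNorm_rpow hp0]
  refine ENNReal.rpow_le_rpow ?_ hp0.le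
  rw [ENNReal.le_ofReal_iff_toReal_le hw (zero_le_one.trans (le_max_left _ _))]
  -- The `p`-th power of the norm is bounded by a linear function of the norm, which is impossible
  -- for large norms since `p > 1`.
  refine le_max_of_rpow_le hp ENNReal.toReal_nonneg (by positivity) ?_
  have h1 : (wNorm Ω s p u).toReal ^ p ≤ B.toReal * (semiPow Ω s p u).toReal + B'.toReal := by
    have h2 := hBB u huφ
    rw [← wNorm_rpow hp0] at h2
    have h3 := ENNReal.toReal_mono (by finiteness) h2
    rwa [← ENNReal.toReal_rpow, ENNReal.toReal_add (by finiteness) hB', ENNReal.toReal_mul] at h3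
  have h2 : (semiPow Ω s p u).toReal ≤ (|a| + C * (wNorm Ω s p u).toReal) / κ := by
    rw [le_div_iff₀ hκ, mul_comm]
    exact hle.trans (by linarith [le_abs_self a])
  calc _ ≤ B.toReal * ((|a| + C * (wNorm Ω s p u).toReal) / κ) + B'.toReal :=
        h1.trans (by gcongr)
    _ = _ := by
      simp only [β]
      ring

/-- If the boundary datum lies in `W`, every obstacle in `L^p` admits competitors. -/
lemma K_nonempty (hd : 1 ≤ d) (hΩ : IsOpen Ω) (hb : Bornology.IsBounded Ω) (hs : 0 ≤ s)
    (hp : 1 ≤ p) {Ω₀ : Set (E d)} (hΩ₀o : IsOpen Ω₀) (hΩ₀c : IsCompact (closure Ω₀))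
    (hΩ₀ : closure Ω₀ ⊆ Ω) {φ : LpΩ Ω p} (hφ : φ ∈ W Ω s p hp) (h : LpΩ Ω p) :
    (K Ω₀ s p hp φ h).Nonempty := by
  have hCm : MeasurableSet (closure Ω₀) := isClosed_closure.measurableSet
  -- The competitor is `max φ h` on the closure of `Ω₀` and `φ` elsewhere, so it differs from `φ` by
  -- an `L^p` function of compact support.
  have hmem : MemLp ((closure Ω₀).indicator fun x => max (h x - φ x) 0) (ENNReal.ofReal p)
      (volume.restrict Ω) := (((Lp.memLp h).sub (Lp.memLp φ)).pos_part).indicator hCm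
  set w := hmem.toLp _ with hw
  have hwW₀ : w ∈ W₀ Ω s p := by
    refine mem_W₀_of_compact_support hd hΩ hb hs hp hΩ₀c hΩ₀ w ?_
    filter_upwards [hmem.coeFn_toLp] with x hx hxC
    rw [hx, indicator_of_notMem hxC]
  refine ⟨⟨φ + w, add_mem hφ (W₀_subset_W hp hwW₀)⟩, ?_, ?_⟩
  · have h1 : ∀ᵐ x ∂(volume.restrict Ω), x ∈ Ω₀ → h x ≤ (φ + w : LpΩ Ω p) x := by
      filter_upwards [hmem.coeFn_toLp, Lp.coeFn_add φ w] with x hx hx' hxΩ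
      rw [hx', Pi.add_apply, hx, indicator_of_mem (subset_closure hxΩ)]
      linarith [le_max_left (h x - φ x) 0]
    filter_upwards [ae_restrict_of_ae_restrict_of_subset (subset_closure.trans hΩ₀) h1,
      ae_restrict_mem hΩ₀o.measurableSet] with x hx hxΩ using hx hxΩ
  · simpa using hwW₀

lemma midpoint_mem_K (hp : 1 ≤ p) {Ω₀ : Set (E d)} (hΩ₀ : Ω₀ ⊆ Ω) {φ h : LpΩ Ω p}
    {u v : W Ω s p hp} (hu : u ∈ K Ω₀ s p hp φ h) (hv : v ∈ K Ω₀ s p hp φ h) :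
    (1 / 2 : ℝ) • (u + v) ∈ K Ω₀ s p hp φ h := by
  constructor
  · filter_upwards [hu.1, hv.1, ae_restrict_of_ae_restrict_of_subset hΩ₀
      (coeFn_midpoint (u : LpΩ Ω p) (v : LpΩ Ω p))] with x hux hvx hx
    have hx' : (((1 / 2 : ℝ) • (u + v) : W Ω s p hp) : LpΩ Ω p) x =
      1 / 2 * ((u : LpΩ Ω p) x + (v : LpΩ Ω p) x) := hx
    rw [hx']
    linarith
  · have h1 : (((1 / 2 : ℝ) • (u + v) : W Ω s p hp) : LpΩ Ω p) - φ =
        (1 / 2 : ℝ) • (((u : LpΩ Ω p) - φ) + ((v : LpΩ Ω p) - φ)) := by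
      simp only [Submodule.coe_smul, Submodule.coe_add]
      module
    rw [h1]
    exact W₀_midpoint hp hu.2 hv.2

lemma mem_K_of_tendsto (hp : 1 ≤ p) {Ω₀ : Set (E d)} (hΩ₀ : Ω₀ ⊆ Ω) {φ h : LpΩ Ω p}
    {y : ℕ → W Ω s p hp} {u : W Ω s p hp} (hy : ∀ n, y n ∈ K Ω₀ s p hp φ h)
    (hyu : Tendsto (fun n => gPow Ω s p ((y n : LpΩ Ω p) - u : LpΩ Ω p)) atTop (𝓝 0)) :
    u ∈ K Ω₀ s p hp φ h := by
  have hfact : Fact (1 ≤ ENNReal.ofReal p) := ofReal_p_one_le hp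
  constructor
  · obtain ⟨ns, -, hns⟩ := exists_subseq_ae (tendsto_of_tendsto_gPow hp hyu)
    filter_upwards [ae_restrict_of_ae_restrict_of_subset hΩ₀ hns,
      ae_all_iff.2 fun n => (hy n).1] with x hx hyx
    exact ge_of_tendsto' hx fun k => hyx _
  · refine mem_wClosure_of_tendsto hp (fun n => (hy n).2) ?_
    simpa only [sub_sub_sub_cancel_right] using hyu

lemma IsBoundedFunctional.tendsto {hp : 1 ≤ p} {f : W Ω s p hp →ₗ[ℝ] ℝ}
    (hf : IsBoundedFunctional f) {y : ℕ → W Ω s p hp} {u : W Ω s p hp}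
    (hyu : Tendsto (fun n => gPow Ω s p ((y n : LpΩ Ω p) - u : LpΩ Ω p)) atTop (𝓝 0)) :
    Tendsto (fun n => f (y n)) atTop (𝓝 (f u)) := by
  have hp0 : 0 < p := by linarith
  obtain ⟨C, hC⟩ := hf
  rw [tendsto_iff_edist_tendsto_0]
  have h1 : Tendsto (fun n => (C : ℝ≥0∞) *
      gPow Ω s p ((y n : LpΩ Ω p) - u : LpΩ Ω p) ^ (1 / p)) atTop (𝓝 0) := by
    have h2 := ((ENNReal.continuous_rpow_const (y := 1 / p)).tendsto 0).comp hyu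
    rw [ENNReal.zero_rpow_of_pos (by positivity)] at h2
    have h3 := ENNReal.Tendsto.const_mul h2 (Or.inr (ENNReal.coe_ne_top (r := C)))
    rwa [mul_zero] at h3
  refine tendsto_of_tendsto_of_tendsto_of_le_of_le tendsto_const_nhds h1 (fun n => zero_le)
    fun n => ?_
  have h2 := hC (y n - u)
  rw [map_sub, wNorm_eq_gPow] at h2
  rwa [edist_eq_enorm_sub]

/-- The direct method: a convex, coercive functional attains its infimum over `K`. -/
theorem exists_isMinOn_energy_sub (hd : 1 ≤ d) (hΩ : IsLipschitzDomain Ω)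
    (hb : Bornology.IsBounded Ω) (hp : 1 < p) (hps : 1 < p * s)
    {A : E d → E d → ℝ}
    (hA : AEMeasurable (Function.uncurry A) ((volume.restrict Ω).prod (volume.restrict Ω)))
    {α₁ α₂ : ℝ} (hα₁ : 0 < α₁) (hAα : ∀ x ∈ Ω, ∀ y ∈ Ω, α₁ ≤ A x y ∧ A x y ≤ α₂)
    {F : ℝ → ℝ} (hF : ConvexOn ℝ univ F) {c₁ c₂ : ℝ} (hc₁ : 0 < c₁) (hc₂ : 0 ≤ c₂)
    (hFc : ∀ t : ℝ, c₁ * |t| ^ p ≤ F t ∧ F t ≤ c₂ * |t| ^ p)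
    {Ω₀ : Set (E d)} (hΩ₀ : Ω₀ ⊆ Ω) {φ h : LpΩ Ω p} (hφ : φ ∈ W Ω s p hp.le)
    (hK : (K Ω₀ s p hp.le φ h).Nonempty) {f : W Ω s p hp.le →ₗ[ℝ] ℝ}
    (hf : IsBoundedFunctional f) :
    (∀ v : W Ω s p hp.le, energy s A F (v : LpΩ Ω p) ≠ ∞) ∧
    ∃ u ∈ K Ω₀ s p hp.le φ h, ∀ v ∈ K Ω₀ s p hp.le φ h,
      (energy s A F (u : LpΩ Ω p)).toReal - f u ≤ (energy s A F (v : LpΩ Ω p)).toReal - f v := by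
  have hp0 : 0 < p := by linarith
  have hfact : Fact (1 ≤ ENNReal.ofReal p) := ofReal_p_one_le hp.le
  have hΩm := hΩ.1.measurableSet
  have hF0 : ∀ t, 0 ≤ F t := fun t => (by positivity : 0 ≤ c₁ * |t| ^ p).trans (hFc t).1
  have hFcont : Continuous F := continuousOn_univ.1 (hF.continuousOn isOpen_univ)
  have hA0 : ∀ᵐ z ∂(pairMeasure Ω s p), 0 ≤ A z.1 z.2 := by
    filter_upwards [ae_pairMeasure_mem hΩm] with z hz
    exact hα₁.le.trans (hAα _ hz.1 _ hz.2).1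
  have hg : ∀ v : W Ω s p hp.le, gPow Ω s p (v : LpΩ Ω p) < ∞ := fun v =>
    ((mem_wClosure_iff hp0).1 v.2).1
  have hsemi : ∀ v : W Ω s p hp.le, semiPow Ω s p (v : LpΩ Ω p) ≠ ∞ := fun v =>
    (ENNReal.add_lt_top.1 (show _ + _ < ∞ from hg v)).2.ne
  have hfin : ∀ v : W Ω s p hp.le, energy s A F (v : LpΩ Ω p) ≠ ∞ := fun v =>
    ne_top_of_le_ne_top (ENNReal.mul_ne_top ENNReal.ofReal_ne_top (hsemi v))
      (energy_le hA hΩm hp0.le hFcont.measurable hc₂ (fun x hx y hy => (hAα x hx y hy).2) hF0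
        (fun t => (hFc t).2) _)
  refine ⟨hfin, ?_⟩
  set J : W Ω s p hp.le → ℝ := fun v => (energy s A F (v : LpΩ Ω p)).toReal - f v with hJ
  have hJmid : ∀ u v r, J u ≤ r → J v ≤ r → J ((1 / 2 : ℝ) • (u + v)) ≤ r := by
    intro u v r hu hv
    have h1 := ENNReal.toReal_mono (by have := hfin u; have := hfin v; finiteness)
      (energy_midpoint_le hA hA0 hF hF0 (u : LpΩ Ω p) (v : LpΩ Ω p))
    rw [ENNReal.toReal_mul, ENNReal.toReal_ofReal (by norm_num),
      ENNReal.toReal_add (hfin u) (hfin v)] at h1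
    have h2 : J ((1 / 2 : ℝ) • (u + v)) =
        (energy s A F ((1 / 2 : ℝ) • ((u : LpΩ Ω p) + (v : LpΩ Ω p)))).toReal - 1 / 2 * (f u + f v) := by
      simp only [hJ, map_smul, map_add, smul_eq_mul, Submodule.coe_smul, Submodule.coe_add]
    rw [h2]
    simp only [hJ] at hu hv
    linarith
  have hcoer : ∀ a : ℝ, ∃ M : ℝ≥0∞, M ≠ ∞ ∧ ∀ u ∈ K Ω₀ s p hp.le φ h, J u ≤ a →
      gPow Ω s p (u : LpΩ Ω p) ≤ M := by
    intro a
    obtain ⟨C, hC⟩ := hf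
    obtain ⟨M, hM, hMb⟩ := exists_gPow_bound hd hΩ hb hp hps (hg ⟨φ, hφ⟩)
      (mul_pos hα₁ hc₁) a C
    refine ⟨M, hM, fun u hu hua => hMb u (hg u) hu.2 ?_⟩
    have h1 := ENNReal.toReal_mono (hfin u) (le_energy hA hΩm hp0.le hFcont.measurable hα₁.le
      hc₁.le (fun x hx y hy => (hAα x hx y hy).1) (fun t => (hFc t).1) (u : LpΩ Ω p))
    rw [ENNReal.toReal_mul, ENNReal.toReal_ofReal (by positivity)] at h1
    have hw : wNorm Ω s p (u : LpΩ Ω p) ≠ ∞ := ((wNorm_lt_top_iff hp0 _).2 (hg u)).ne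
    have h2 := ENNReal.toReal_mono (ENNReal.mul_ne_top ENNReal.coe_ne_top hw) (hC u)
    rw [ENNReal.toReal_mul, ENNReal.coe_toReal, toReal_enorm, Real.norm_eq_abs] at h2
    have h3 : (energy s A F (u : LpΩ Ω p)).toReal - f u ≤ a := hua
    linarith [le_abs_self (f u)]
  -- The infimum is taken in `EReal`, so boundedness below need not be shown beforehand.
  set m : EReal := ⨅ v ∈ K Ω₀ s p hp.le φ h, ((J v : ℝ) : EReal) with hm
  have hmtop : m < ⊤ := by
    obtain ⟨v, hv⟩ := hK
    exact (iInf₂_le v hv).trans_lt (EReal.coe_lt_top _)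
  obtain ⟨a, haanti, ha, halim⟩ := exists_seq_strictAnti_tendsto' hmtop
  have har : ∀ n, ((a n).toReal : EReal) = a n := fun n =>
    EReal.coe_toReal (ha n).2.ne (bot_le.trans_lt (ha n).1).ne'
  -- Sublevel sets of `J` in `K`, for levels decreasing to the infimum; coercivity bounds the first
  -- one.
  set C : ℕ → Set (LpΩ Ω p) := fun n =>
    Subtype.val '' {v : W Ω s p hp.le | v ∈ K Ω₀ s p hp.le φ h ∧ J v ≤ (a n).toReal}
  have hanti : Antitone C := fun i j hij => by
    refine image_mono fun v hv => ⟨hv.1, hv.2.trans ?_⟩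
    rw [← EReal.coe_le_coe_iff, har, har]
    exact haanti.antitone hij
  have hne : ∀ n, (C n).Nonempty := fun n => by
    obtain ⟨v, hv⟩ := iInf_lt_iff.1 (ha n).1
    obtain ⟨hv, hvn⟩ := iInf_lt_iff.1 hv
    refine ⟨v, v, ⟨hv, ?_⟩, rfl⟩
    rw [← EReal.coe_le_coe_iff, har]
    exact hvn.le
  have hmid : ∀ n, ∀ u ∈ C n, ∀ v ∈ C n, (1 / 2 : ℝ) • (u + v) ∈ C n := by
    rintro n _ ⟨u, hu, rfl⟩ _ ⟨v, hv, rfl⟩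
    exact ⟨(1 / 2 : ℝ) • (u + v), ⟨midpoint_mem_K hp.le hΩ₀ hu.1 hv.1,
      hJmid _ _ _ hu.2 hv.2⟩, rfl⟩
  obtain ⟨M, hM, hMb⟩ := hcoer (a 0).toReal
  obtain ⟨y, u, hy, hyu⟩ := exists_tendsto_of_antitone hp hanti hne hmid hM (by
    rintro _ ⟨u, hu, rfl⟩
    exact hMb u hu.1 hu.2)
  choose z hz hzy using hy
  obtain rfl : (fun n => (z n : LpΩ Ω p)) = y := funext hzy
  have huW : u ∈ W Ω s p hp.le := mem_wClosure_of_tendsto hp.le (fun n => (z n).2) hyu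
  lift u to W Ω s p hp.le using huW
  -- Fatou's lemma bounds the energy of the limit, and `f` converges by continuity; `ε` absorbs the
  -- error in `f`.
  have hJu : ∀ n, J u ≤ (a n).toReal := by
    intro n
    refine le_of_forall_pos_le_add fun ε hε => ?_
    have h1 : ∀ᶠ k in atTop,
        (energy s A F (z k : LpΩ Ω p)).toReal ≤ (a n).toReal + f u + ε := by
      filter_upwards [eventually_ge_atTop n,
        (hf.tendsto hyu).eventually (gt_mem_nhds (show f u < f u + ε by linarith))] with k hk hfk
      have hak : (a k).toReal ≤ (a n).toReal := by
        rw [← EReal.coe_le_coe_iff, har, har]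
        exact haanti.antitone hk
      have hzk : (energy s A F (z k : LpΩ Ω p)).toReal - f (z k) ≤ (a k).toReal := (hz k).2
      linarith
    have h2 : energy s A F (u : LpΩ Ω p) ≤ ENNReal.ofReal ((a n).toReal + f u + ε) := by
      refine energy_le_of_tendsto hA hFcont (tendsto_of_tendsto_gPow hp.le hyu) ?_
      filter_upwards [h1] with k hk
      rw [← ENNReal.ofReal_toReal (hfin (z k))]
      exact ENNReal.ofReal_le_ofReal hk
    have h3 : 0 ≤ (a n).toReal + f u + ε := by
      obtain ⟨k, hk⟩ := h1.exists
      exact ENNReal.toReal_nonneg.trans hk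
    have h4 := ENNReal.toReal_le_of_le_ofReal h3 h2
    simp only [hJ]
    linarith
  refine ⟨u, mem_K_of_tendsto hp.le hΩ₀ (fun n => (hz n).1) hyu, fun v hv => ?_⟩
  rw [← EReal.coe_le_coe_iff]
  refine le_trans ?_ (show m ≤ ((J v : ℝ) : EReal) from iInf₂_le v hv)
  refine ge_of_tendsto' halim fun n => ?_
  rw [← har, EReal.coe_le_coe_iff]
  exact hJu n

end HetLoc

theorem theorem1p3 (d : ℕ) (hd : 2 ≤ d) (Ω : Set (HetLoc.E d))
    (hΩ : HetLoc.IsLipschitzDomain Ω) (hΩb : Bornology.IsBounded Ω)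
    (p s : ℝ) (hp : 1 < p) (hs0 : 0 < s) (hs1 : s < 1) (hps : 1 < p * s)
    (A : HetLoc.E d → HetLoc.E d → ℝ)
    (hAm : AEMeasurable (Function.uncurry A) ((volume.restrict Ω).prod (volume.restrict Ω)))
    (hAsymm : ∀ x ∈ Ω, ∀ y ∈ Ω, A x y = A y x)
    (α₁ α₂ : ℝ) (hα₁ : 0 < α₁) (hA : ∀ x ∈ Ω, ∀ y ∈ Ω, α₁ ≤ A x y ∧ A x y ≤ α₂)
    (F : ℝ → ℝ) (hF : ConvexOn ℝ Set.univ F)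
    (c₁ c₂ c₃ : ℝ) (hc₁ : 0 < c₁) (hc₂ : 0 < c₂) (hc₃ : 0 < c₃)
    (hFgrowth : ∀ t : ℝ, c₁ * |t| ^ p ≤ F t ∧ F t ≤ c₂ * |t| ^ p)
    (hFderiv : ∀ᵐ t : ℝ, |deriv F t| ≤ c₃ * |t| ^ (p - 1))
    (Ω₀ : Set (HetLoc.E d)) (hΩ₀ : IsOpen Ω₀) (hΩ₀c : IsCompact (closure Ω₀))
    (hΩ₀sub : closure Ω₀ ⊆ Ω)
    (φ : HetLoc.LpΩ Ω p) (hφ : HetLoc.MemSobolev s φ)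
    (h : HetLoc.LpΩ Ω p) (hh0 : ∀ᵐ x ∂(volume.restrict Ω), 0 ≤ h x)
    (hh : ¬ HetLoc.MemSobolev s h)
    (f : HetLoc.W Ω s p hp.le →ₗ[ℝ] ℝ) (hf : HetLoc.IsBoundedFunctional f) :
    ∃ u ∈ HetLoc.K Ω₀ s p hp.le φ h,
      HetLoc.energy s A F (u : HetLoc.LpΩ Ω p) ≠ ∞ ∧
      ((HetLoc.energy s A F (u : HetLoc.LpΩ Ω p) : ℝ≥0∞) : EReal) - ((f u : ℝ) : EReal) =
        ⨅ v ∈ HetLoc.K Ω₀ s p hp.le φ h,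
          (((HetLoc.energy s A F (v : HetLoc.LpΩ Ω p) : ℝ≥0∞) : EReal) - ((f v : ℝ) : EReal)) := by
  have hd1 : 1 ≤ d := by omega
  have hφW := HetLoc.mem_W_of_memSobolev hd1 hΩ hΩb hs0.le hs1.le hp φ hφ
  obtain ⟨hfin, u, hu, hmin⟩ := HetLoc.exists_isMinOn_energy_sub hd1 hΩ hΩb hp hps hAm hα₁
    hA hF hc₁ hc₂.le hFgrowth (subset_closure.trans hΩ₀sub) hφW
    (HetLoc.K_nonempty hd1 hΩ.1 hΩb hs0.le hp.le hΩ₀ hΩ₀c hΩ₀sub hφW h) hf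
  refine ⟨u, hu, hfin u, le_antisymm (le_iInf₂ fun v hv => ?_) (iInf₂_le u hu)⟩
  -- All energies on `W` are finite, so the extended differences are coercions of real ones.
  rw [← ENNReal.ofReal_toReal (hfin u), ← ENNReal.ofReal_toReal (hfin v),
    EReal.coe_ennreal_ofReal, EReal.coe_ennreal_ofReal, max_eq_left ENNReal.toReal_nonneg,
    max_eq_left ENNReal.toReal_nonneg]
  exact_mod_cast hmin v hv
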